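/- Let $\widetilde{\mathcal{SV}}$ be the extended Schrödinger–Virasoro Lie conformal algebra: the free $\mathbb{C}[\partial]$-module on $L,N,Y,M$ with $\lambda$-brackets determined by sesquilinearity and skew-symmetry from $$[L_\lambda L]=(\partial+2\lambda)L,\quad [L_\lambda Y]=(\partial+\tfrac32\lambda)Y,\quad [L_\lambda M]=(\partial+\lambda)M,\quad [L_\lambda N]=(\partial+\lambda)N,$$ $$[Y_\lambda Y]=(\partial+2\lambda)M,\quad [N_\lambda Y]=Y,\quad [N_\lambda M]=2M,$$ all other brackets of two generators, apart from those forced by skew-symmetry, being zero. For $n\ge 0$ let $\tilde C^n$ be the space of $n$-cochains with trivial coefficients $\mathbb{C}$, that is, of $\mathbb{C}$-linear maps $\gamma:\widetilde{\mathcal{SV}}^{\otimes n}\to\mathbb{C}[\lambda_1,\dots,\lambda_n]$ with $\gamma_{\lambda_1,\dots,\lambda_n}(a_1,\dots,\partial a_i,\dots,a_n)=-\lambda_i\gamma_{\lambda_1,\dots,\lambda_n}(a_1,\dots,a_n)$ that are skew-symmetric under simultaneous permutations of the $a_i$ and the $\lambda_i$. The differential is $$(d\gamma)_{\lambda_1,\dots,\lambda_{n+1}}(a_1,\dots,a_{n+1})=\sum_{1\le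 i<j\le n+1}(-1)^{i+j}\gamma_{\lambda_i+\lambda_j,\lambda_1,\dots,\hat\lambda_i,\dots,\hat\lambda_j,\dots,\lambda_{n+1}}([a_{i\,\lambda_i}a_j],a_1,\dots,\hat a_i,\dots,\hat a_j,\dots,a_{n+1}),$$ and $(\partial\gamma)_{\lambda_1,\dots,\lambda_n}=(\lambda_1+\dots+\lambda_n)\gamma_{\lambda_1,\dots,\lambda_n}$. The reduced cohomology $H^q(\widetilde{\mathcal{SV}},\mathbb{C})$ is the cohomology of the quotient complex $\tilde C^\bullet/\partial\tilde C^\bullet$. For $\gamma\in\tilde C^{q}$ with $q\ge1$ put $$(\tau\gamma)_{\lambda_1,\dots,\lambda_{q-1}}(a_1,\dots,a_{q-1})=(-1)^{q-1}\frac{\partial}{\partial\lambda}\gamma_{\lambda_1,\dots,\lambda_{q-1},\lambda}(a_1,\dots,a_{q-1},L)\Big|_{\lambda=0},\qquad \widehat{X}=\tau(\partial X).$$ Let $\Phi^1,\Phi^2,\Phi^3\in\tilde C^3$ and $\Psi^1,\Psi^2\in\tilde C^4$ be the cochains with $$\Phi^1_{\lambda_1,\lambda_2,\lambda_3}(L,N,N)=\lambda_2-\lambda_3,\qquad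 \Phi^2_{\lambda_1,\lambda_2,\lambda_3}(L,L,N)=(\lambda_1-\lambda_2)\lambda_3,$$ $$\Phi^3_{\lambda_1,\lambda_2,\lambda_3}(L,L,L)=(\lambda_1-\lambda_2)(\lambda_1-\lambda_3)(\lambda_2-\lambda_3),$$ $$\Psi^1_{\lambda_1,\dots,\lambda_4}(L,L,N,N)=(\lambda_1-\lambda_2)(\lambda_3-\lambda_4),\qquad \Psi^2_{\lambda_1,\dots,\lambda_4}(L,L,L,N)=(\lambda_1-\lambda_2)(\lambda_1-\lambda_3)(\lambda_2-\lambda_3),$$ each of them vanishing on all tuples of generators that are not a rearrangement of the indicated one. (There are such cochains, and these conditions determine them.) Then the following hold. $H^0(\widetilde{\mathcal{SV}},\mathbb{C})=\mathbb{C}$, spanned by the class of the constant $1$. The classes of $\widehat{\Phi^1},\widehat{\Phi^2},\widehat{\Phi^3}$ form a basis of $H^2(\widetilde{\mathcal{SV}},\mathbb{C})$. The classes of $\Phi^1,\Phi^2,\Phi^3,\widehat{\Psi^1},\widehat{\Psi^2}$ form a basis of $H^3(\widetilde{\mathcal{SV}},\mathbb{C})$. The classes of $\Psi^1,\Psi^2$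 form a basis of $H^4(\widetilde{\mathcal{SV}},\mathbb{C})$. Finally $H^q(\widetilde{\mathcal{SV}},\mathbb{C})=0$ for all other $q$. Moreover $\widehat{\Phi^i}$ and $\widehat{\Psi^j}$ are the cochains given by $$\widehat{\Phi^1}_{\lambda_1,\lambda_2}(N,N)=\lambda_1-\lambda_2,\qquad \widehat{\Phi^2}_{\lambda_1,\lambda_2}(L,N)=\lambda_2^2,\qquad \widehat{\Phi^3}_{\lambda_1,\lambda_2}(L,L)=-\lambda_1^3+\lambda_2^3,$$ $$\widehat{\Psi^1}_{\lambda_1,\lambda_2,\lambda_3}(L,N,N)=\lambda_2^2-\lambda_3^2,\qquad \widehat{\Psi^2}_{\lambda_1,\lambda_2,\lambda_3}(L,L,N)=-\lambda_1^3-\lambda_1^2\lambda_3+\lambda_2^3+\lambda_2^2\lambda_3,$$ each vanishing on all tuples of generators that are not a rearrangement of the indicated one. -/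

import Mathlib

open Polynomial

noncomputable section

namespace LieConformal

/-- The value at `z` of a polynomial `∑ λ^k c_k` in `λ` with coefficients in `A`.
Polynomials with coefficients in `A` are finitely supported functions `ℕ →₀ A`. -/
def evalAt {A : Type*} [AddCommGroup A] [Module ℂ A] (z : ℂ) (p : ℕ →₀ A) : A :=
  p.sum fun k c => z ^ k • c

end LieConformal

/-- A Lie conformal algebra structure on a complex vector space `A`. The `ℂ[∂]`-module structure
is given by the endomorphism `D` (the action of `∂`), and `bracket a b` is the polynomial
`[a_λ b] ∈ A[λ]`. Two polynomials with coefficients in a complex vector space agree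
if and only if they agree at all complex values of the variables, so the axioms are stated for
all complex values `z` of `λ` and `w` of `μ`. In the skew-symmetry axiom the right-hand side is
`-[b_{-λ-∂} a]`, with the powers of `-λ-∂` acting on the coefficients. -/
structure LieConformalAlgebra (A : Type*) [AddCommGroup A] [Module ℂ A] where
  D : Module.End ℂ A
  bracket : A →ₗ[ℂ] A →ₗ[ℂ] (ℕ →₀ A)
  bracket_D_left : ∀ (z : ℂ) (a b : A),
    LieConformal.evalAt z (bracket (D a) b) = -(z • LieConformal.evalAt z (bracket a b))
  bracket_D_right : ∀ (z : ℂ) (a b : A),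
    LieConformal.evalAt z (bracket a (D b)) =
      D (LieConformal.evalAt z (bracket a b)) + z • LieConformal.evalAt z (bracket a b)
  skew : ∀ (z : ℂ) (a b : A),
    LieConformal.evalAt z (bracket a b) =
      -((bracket b a).sum fun k c => ((-(z • (1 : Module.End ℂ A)) - D) ^ k) c)
  jacobi : ∀ (z w : ℂ) (a b c : A),
    LieConformal.evalAt z (bracket a (LieConformal.evalAt w (bracket b c))) =
      LieConformal.evalAt (z + w) (bracket (LieConformal.evalAt z (bracket a b)) c) +
        LieConformal.evalAt w (bracket b (LieConformal.evalAt z (bracket a c)))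

namespace LieConformal

/-! ### Cochains with coefficients in the trivial module `ℂ` -/

/-- Arbitrary maps `(a₁, …, aₙ) ↦ γ_{λ₁,…,λₙ}(a₁, …, aₙ) ∈ ℂ[λ₁, …, λₙ]`. -/
abbrev PreCochain (A : Type*) (n : ℕ) : Type _ := (Fin n → A) → MvPolynomial (Fin n) ℂ

section Complex

variable {A : Type*} [AddCommGroup A] [Module ℂ A] (𝔤 : LieConformalAlgebra A)

/-- The space of `n`-cochains with coefficients in `ℂ`: multilinear, conformally antilinear and
skew-symmetric under simultaneous permutations of the arguments and the variables. -/
def cochains (n : ℕ) : Submodule ℂ (PreCochain A n) where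
  carrier := {γ |
    (∀ (a : Fin n → A) (i : Fin n) (x y : A),
      γ (Function.update a i (x + y)) =
        γ (Function.update a i x) + γ (Function.update a i y)) ∧
    (∀ (a : Fin n → A) (i : Fin n) (c : ℂ) (x : A),
      γ (Function.update a i (c • x)) = c • γ (Function.update a i x)) ∧
    (∀ (a : Fin n → A) (i : Fin n),
      γ (Function.update a i (𝔤.D (a i))) = -(MvPolynomial.X i * γ a)) ∧
    (∀ (σ : Equiv.Perm (Fin n)) (a : Fin n → A),
      MvPolynomial.rename σ (γ (a ∘ σ)) = (Equiv.Perm.sign σ : ℤ) • γ a)}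
  add_mem' := by
    rintro γ η ⟨h1, h2, h3, h4⟩ ⟨k1, k2, k3, k4⟩
    refine ⟨fun a i x y => ?_, fun a i c x => ?_, fun a i => ?_, fun σ a => ?_⟩
    · simp only [Pi.add_apply, h1, k1]; abel
    · simp only [Pi.add_apply, h2, k2, smul_add]
    · simp only [Pi.add_apply, h3, k3]; ring
    · simp only [Pi.add_apply, map_add, h4, k4, smul_add]
  zero_mem' := by
    refine ⟨fun a i x y => ?_, fun a i c x => ?_, fun a i => ?_, fun σ a => ?_⟩ <;> simp
  smul_mem' := by
    rintro r γ ⟨h1, h2, h3, h4⟩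
    refine ⟨fun a i x y => ?_, fun a i c x => ?_, fun a i => ?_, fun σ a => ?_⟩
    · simp only [Pi.smul_apply, h1, smul_add]
    · simp only [Pi.smul_apply, h2, smul_comm r c]
    · simp only [Pi.smul_apply, h3, smul_neg, mul_smul_comm]
    · simp only [Pi.smul_apply, map_smul, h4, smul_comm r]

/-- The increasing enumeration of the indices different from `i` and `j`, for `i < j`. Here
`i : Fin (m + 1)` stands for the index `i.castSucc`. -/
def skip {m : ℕ} (i : Fin (m + 1)) (j : Fin (m + 2)) (k : Fin m) : Fin (m + 2) :=
  j.succAbove (i.succAbove k)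

/-- The term
`γ_{λ_i + λ_j, λ_1, …, λ̂_i, …, λ̂_j, …}([a_i _{λ_i} a_j], a_1, …, â_i, …, â_j, …)`,
where `γ` is extended linearly over the powers of `λ_i`. -/
def bracketTerm {m : ℕ} (γ : PreCochain A (m + 1)) (a : Fin (m + 2) → A)
    (i : Fin (m + 1)) (j : Fin (m + 2)) : MvPolynomial (Fin (m + 2)) ℂ :=
  (𝔤.bracket (a i.castSucc) (a j)).sum fun k c =>
    MvPolynomial.X i.castSucc ^ k *
      MvPolynomial.aeval
        (Fin.cons (MvPolynomial.X i.castSucc + MvPolynomial.X j)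
          (fun l => MvPolynomial.X (skip i j l)) :
            Fin (m + 1) → MvPolynomial (Fin (m + 2)) ℂ)
        (γ (Fin.cons c (fun l => a (skip i j l))))

/-- The differential with coefficients in the trivial module `ℂ`, on which all `a_λ` act
by zero: `(dγ)(a) = ∑_{i<j} (-1)^{i+j} γ_{λ_i+λ_j,…}([a_i _{λ_i} a_j], …)`. -/
def d : (n : ℕ) → PreCochain A n →ₗ[ℂ] PreCochain A (n + 1)
  | 0 => 0
  | m + 1 =>
    { toFun := fun γ a => ∑ j : Fin (m + 2), ∑ i : Fin (m + 1),
        if i.castSucc < j then (-1) ^ ((i : ℕ) + (j : ℕ)) * bracketTerm 𝔤 γ a i j else 0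
      map_add' := by
        intro γ η
        funext a
        simp only [Pi.add_apply, ← Finset.sum_add_distrib]
        refine Finset.sum_congr rfl fun j _ => Finset.sum_congr rfl fun i _ => ?_
        split_ifs
        · simp only [bracketTerm, Finsupp.sum, Pi.add_apply, map_add, mul_add,
            Finset.sum_add_distrib]
        · simp
      map_smul' := by
        intro r γ
        funext a
        simp only [Pi.smul_apply, Finset.smul_sum, RingHom.id_apply]
        refine Finset.sum_congr rfl fun j _ => Finset.sum_congr rfl fun i _ => ?_
        split_ifs
        · simp only [bracketTerm, Finsupp.sum, Pi.smul_apply, map_smul, mul_smul_comm,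
            ← Finset.smul_sum]
        · simp }

/-- The action of `∂` on cochains: multiplication by `λ₁ + ⋯ + λₙ`. -/
def del (A : Type*) (n : ℕ) : PreCochain A n →ₗ[ℂ] PreCochain A n where
  toFun γ a := (∑ i : Fin n, MvPolynomial.X i) * γ a
  map_add' γ η := by funext a; simp [mul_add]
  map_smul' r γ := by funext a; simp

/-- The subspace `∂C̃ⁿ`. -/
def delCochains (n : ℕ) : Submodule ℂ (PreCochain A n) :=
  (cochains 𝔤 n).map (del A n)

/-- The cochains whose classes in `C̃ⁿ / ∂C̃ⁿ` are cocycles of the reduced complex. -/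
def reducedCocycles (n : ℕ) : Submodule ℂ (PreCochain A n) :=
  cochains 𝔤 n ⊓ (delCochains 𝔤 (n + 1)).comap (d 𝔤 n)

/-- The cochains whose classes in `C̃ⁿ / ∂C̃ⁿ` are coboundaries of the reduced complex:
`∂C̃ⁿ + d C̃ⁿ⁻¹` (and `∂C̃⁰` for `n = 0`). -/
def reducedCoboundaries : (n : ℕ) → Submodule ℂ (PreCochain A n)
  | 0 => delCochains 𝔤 0
  | n + 1 => delCochains 𝔤 (n + 1) ⊔ (cochains 𝔤 n).map (d 𝔤 n)

/-- The reduced cohomology `Hⁿ(A, ℂ)`, the cohomology of the quotient complex `C̃ / ∂C̃`. -/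
abbrev ReducedCohomology (n : ℕ) : Type _ :=
  reducedCocycles 𝔤 n ⧸ (reducedCoboundaries 𝔤 n).submoduleOf (reducedCocycles 𝔤 n)

/-- The members of the family `v` are reduced cocycles, and their classes form a basis
of `Hⁿ(A, ℂ)`. -/
def IsReducedCohomologyBasis (n : ℕ) {ι : Type} (v : ι → PreCochain A n) : Prop :=
  ∃ hv : ∀ i, v i ∈ reducedCocycles 𝔤 n,
    ∃ b : Module.Basis ι ℂ (ReducedCohomology 𝔤 n),
      ∀ i, b i = Submodule.Quotient.mk ⟨v i, hv i⟩

end Complex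

end LieConformal

/-! ### The extended Schrödinger-Virasoro conformal algebra -/

namespace ExtendedSV

/-- The free generators. -/
inductive Gen : Type
  | L | N | Y | M
  deriving DecidableEq

open Gen

instance : Fintype Gen where
  elems := {L, N, Y, M}
  complete := by intro g; cases g <;> decide

theorem sum_gen {R : Type*} [AddCommMonoid R] (f : Gen → R) :
    ∑ g : Gen, f g = f L + (f N + (f Y + f M)) := by
  change ∑ g ∈ ({L, N, Y, M} : Finset Gen), f g = _
  rw [Finset.sum_insert (by decide), Finset.sum_insert (by decide),
    Finset.sum_insert (by decide), Finset.sum_singleton]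

/-- The free `ℂ[∂]`-module on `L, N, Y, M`; the variable of `ℂ[X]` is `∂`. -/
abbrev Carrier : Type := Gen → ℂ[X]

/-- The generators as elements of the algebra. -/
def gen (g : Gen) : Carrier := Pi.single g 1

/-- `brGen g h m ∈ ℂ[∂][λ]` is the coefficient of the generator `m` in `[g_λ h]`. The outer
variable `X` is `λ` and `C X` is `∂`. The brackets `[N_λ L]`, `[Y_λ N]` and `[M_λ N]` are forced
by skew-symmetry. -/
def brGen : Gen → Gen → Gen → ℂ[X][X]
  | L, L, L => C X + 2 * X
  | L, Y, Y => C X + C (C (3 / 2)) * X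
  | Y, L, Y => C (C (1 / 2)) * C X + C (C (3 / 2)) * X
  | Y, Y, M => C X + 2 * X
  | L, M, M => C X + X
  | M, L, M => X
  | L, N, N => C X + X
  | N, L, N => X
  | N, Y, Y => 1
  | Y, N, Y => -1
  | N, M, M => 2
  | M, N, M => -2
  | _, _, _ => 0

/-- `[a_λ b]`, by sesquilinearity: `[f(∂)g _λ h(∂)k] = f(-λ) h(∂+λ) [g_λ k]`. -/
def bracketPoly (a b : Carrier) (m : Gen) : ℂ[X][X] :=
  ∑ g : Gen, ∑ h : Gen,
    eval₂ (C.comp C) (-X) (a g) * eval₂ (C.comp C) (C X + X) (b h) * brGen g h m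

/-- The polynomial in `λ` with coefficients in the free `ℂ[∂]`-module whose components are given
polynomials in `λ`. -/
def lambdaCoeffs (p : Gen → ℂ[X][X]) : ℕ →₀ Carrier :=
  Finsupp.onFinset (Finset.univ.biUnion fun m => (p m).support) (fun k m => (p m).coeff k) (by
    intro k hk
    obtain ⟨m, hm⟩ := Function.ne_iff.mp hk
    exact Finset.mem_biUnion.mpr ⟨m, Finset.mem_univ _, mem_support_iff.mpr hm⟩)

theorem lambdaCoeffs_sum (p : Gen → ℂ[X][X]) (r : ℂ[X]) :
    ((lambdaCoeffs p).sum fun k c => (fun m => r ^ k * c m : Carrier)) =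
      fun m => (p m).eval r := by
  rw [lambdaCoeffs, Finsupp.onFinset_sum _ (fun k => by funext m; simp)]
  funext m
  rw [Finset.sum_apply, eval_eq_sum, Polynomial.sum]
  symm
  refine Finset.sum_subset_zero_on_sdiff ?_ ?_ ?_
  · exact fun k hk => Finset.mem_biUnion.mpr ⟨m, Finset.mem_univ _, hk⟩
  · intro k hk
    rw [Finset.mem_sdiff, mem_support_iff, not_not] at hk
    simp [hk.2]
  · intro k _
    ring

theorem evalAt_lambdaCoeffs (p : Gen → ℂ[X][X]) (z : ℂ) :
    LieConformal.evalAt z (lambdaCoeffs p) = fun m => (p m).eval (C z) := by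
  rw [← lambdaCoeffs_sum, LieConformal.evalAt]
  refine Finsupp.sum_congr fun k _ => ?_
  funext m
  simp [smul_eq_C_mul]

/-- The action of `∂`. -/
def delEnd : Module.End ℂ Carrier where
  toFun a := fun m => X * a m
  map_add' a b := by funext m; simp [mul_add]
  map_smul' r a := by funext m; simp

theorem pow_apply_eq (z : ℂ) (k : ℕ) (c : Carrier) :
    ((-(z • (1 : Module.End ℂ Carrier)) - delEnd) ^ k) c = fun m => (-C z - X) ^ k * c m := by
  induction k with
  | zero => simp
  | succ k ih =>
    rw [pow_succ', Module.End.mul_apply, ih]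
    funext m
    simp [delEnd, smul_eq_C_mul]
    ring

theorem eval_eval2_comp (f : ℂ[X]) (p : ℂ[X][X]) (r : ℂ[X]) :
    (eval₂ (C.comp C) p f).eval r = f.comp (p.eval r) := by
  induction f using Polynomial.induction_on' with
  | add f g hf hg => simp [eval₂_add, hf, hg]
  | monomial n c => simp [← C_mul_X_pow_eq_monomial]

theorem eval_bracketPoly (a b : Carrier) (r : ℂ[X]) (m : Gen) :
    (bracketPoly a b m).eval r = ∑ g : Gen, ∑ h : Gen,
        (a g).comp (-r) * (b h).comp (X + r) * (brGen g h m).eval r := by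
  simp [bracketPoly, eval_finsetSum, eval_eval2_comp]

theorem lambdaCoeffs_add (p q : Gen → ℂ[X][X]) :
    lambdaCoeffs (p + q) = lambdaCoeffs p + lambdaCoeffs q := by
  ext k m
  simp [lambdaCoeffs]

theorem lambdaCoeffs_smul (c : ℂ) (p : Gen → ℂ[X][X]) :
    lambdaCoeffs (c • p) = c • lambdaCoeffs p := by
  ext k m
  simp [lambdaCoeffs]

theorem eval2_smul_comp (c : ℂ) (f : ℂ[X]) (p : ℂ[X][X]) :
    eval₂ (C.comp C) p (c • f) = C (C c) * eval₂ (C.comp C) p f := by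
  rw [eval₂_smul]
  rfl

theorem bracketPoly_add_left (a a' b : Carrier) :
    bracketPoly (a + a') b = bracketPoly a b + bracketPoly a' b := by
  funext m
  simp only [bracketPoly, Pi.add_apply, eval₂_add, add_mul, Finset.sum_add_distrib]

theorem bracketPoly_add_right (a b b' : Carrier) :
    bracketPoly a (b + b') = bracketPoly a b + bracketPoly a b' := by
  funext m
  simp only [bracketPoly, Pi.add_apply, eval₂_add, mul_add, add_mul, Finset.sum_add_distrib]

theorem smul_eq_C_C_mul (c : ℂ) (p : ℂ[X][X]) : c • p = C (C c) * p := by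
  ext i j
  simp

theorem bracketPoly_smul_left (c : ℂ) (a b : Carrier) :
    bracketPoly (c • a) b = c • bracketPoly a b := by
  funext m
  simp only [bracketPoly, Pi.smul_apply, eval2_smul_comp, smul_eq_C_C_mul, Finset.mul_sum]
  refine Finset.sum_congr rfl fun g _ => Finset.sum_congr rfl fun h _ => ?_
  ring

theorem bracketPoly_smul_right (c : ℂ) (a b : Carrier) :
    bracketPoly a (c • b) = c • bracketPoly a b := by
  funext m
  simp only [bracketPoly, Pi.smul_apply, eval2_smul_comp, smul_eq_C_C_mul, Finset.mul_sum]
  refine Finset.sum_congr rfl fun g _ => Finset.sum_congr rfl fun h _ => ?_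
  ring

/-- The bilinear map `a, b ↦ [a_λ b]`. -/
def svBracket : Carrier →ₗ[ℂ] Carrier →ₗ[ℂ] (ℕ →₀ Carrier) :=
  LinearMap.mk₂ ℂ (fun a b => lambdaCoeffs (bracketPoly a b))
    (fun a a' b => by rw [bracketPoly_add_left, lambdaCoeffs_add])
    (fun c a b => by rw [bracketPoly_smul_left, lambdaCoeffs_smul])
    (fun a b b' => by rw [bracketPoly_add_right, lambdaCoeffs_add])
    (fun c a b => by rw [bracketPoly_smul_right, lambdaCoeffs_smul])

theorem evalAt_svBracket (a b : Carrier) (z : ℂ) :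
    LieConformal.evalAt z (svBracket a b) = fun m => ∑ g : Gen, ∑ h : Gen,
        (a g).comp (-C z) * (b h).comp (X + C z) * (brGen g h m).eval (C z) := by
  rw [svBracket, LinearMap.mk₂_apply, evalAt_lambdaCoeffs]
  funext m
  exact eval_bracketPoly a b (C z) m

/-- The explicit components of `[a_λ b]` at `λ = z`. -/
theorem evalAt_svBracket_L (a b : Carrier) (z : ℂ) :
    LieConformal.evalAt z (svBracket a b) L =
      (a L).comp (-C z) * (b L).comp (X + C z) * (X + 2 * C z) := by
  simp [evalAt_svBracket, sum_gen, brGen]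

theorem evalAt_svBracket_N (a b : Carrier) (z : ℂ) :
    LieConformal.evalAt z (svBracket a b) N =
      (a L).comp (-C z) * (b N).comp (X + C z) * (X + C z) +
        (a N).comp (-C z) * (b L).comp (X + C z) * C z := by
  simp [evalAt_svBracket, sum_gen, brGen]

theorem evalAt_svBracket_Y (a b : Carrier) (z : ℂ) :
    LieConformal.evalAt z (svBracket a b) Y =
      (a L).comp (-C z) * (b Y).comp (X + C z) * (X + C (3 / 2) * C z) +
        (a Y).comp (-C z) * (b L).comp (X + C z) * (C (1 / 2) * X + C (3 / 2) * C z) +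
        (a N).comp (-C z) * (b Y).comp (X + C z) -
        (a Y).comp (-C z) * (b N).comp (X + C z) := by
  simp [evalAt_svBracket, sum_gen, brGen]
  ring

theorem evalAt_svBracket_M (a b : Carrier) (z : ℂ) :
    LieConformal.evalAt z (svBracket a b) M =
      (a Y).comp (-C z) * (b Y).comp (X + C z) * (X + 2 * C z) +
        (a L).comp (-C z) * (b M).comp (X + C z) * (X + C z) +
        (a M).comp (-C z) * (b L).comp (X + C z) * C z +
        2 * (a N).comp (-C z) * (b M).comp (X + C z) -
        2 * (a M).comp (-C z) * (b N).comp (X + C z) := by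
  simp [evalAt_svBracket, sum_gen, brGen]
  ring

/-- The extended Schrödinger-Virasoro conformal algebra. -/
def extendedSV : LieConformalAlgebra Carrier where
  D := delEnd
  bracket := svBracket
  bracket_D_left z a b := by
    simp only [evalAt_svBracket]
    funext m
    simp only [delEnd, LinearMap.coe_mk, AddHom.coe_mk, mul_comp, X_comp, Pi.neg_apply,
      Pi.smul_apply, smul_eq_C_mul, Finset.mul_sum, ← Finset.sum_neg_distrib]
    refine Finset.sum_congr rfl fun g _ => Finset.sum_congr rfl fun h _ => ?_
    ring
  bracket_D_right z a b := by
    simp only [evalAt_svBracket]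
    funext m
    simp only [delEnd, LinearMap.coe_mk, AddHom.coe_mk, mul_comp, X_comp, Pi.add_apply,
      Pi.smul_apply, smul_eq_C_mul, Finset.mul_sum, ← Finset.sum_add_distrib]
    refine Finset.sum_congr rfl fun g _ => Finset.sum_congr rfl fun h _ => ?_
    ring
  skew z a b := by
    simp only [evalAt_svBracket, pow_apply_eq]
    rw [svBracket, LinearMap.mk₂_apply, lambdaCoeffs_sum]
    funext m
    have h1 : (3 / 2 : ℂ) = 1 + 1 / 2 := by norm_num
    have h2 : (C (1 / 2 : ℂ) : ℂ[X]) * 2 = 1 := by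
      rw [show (2 : ℂ[X]) = C 2 from rfl, ← C_mul]; norm_num
    rw [Pi.neg_apply, eval_bracketPoly, ← Finset.sum_neg_distrib, Finset.sum_comm]
    refine Finset.sum_congr rfl fun g _ => ?_
    rw [← Finset.sum_neg_distrib]
    refine Finset.sum_congr rfl fun h _ => ?_
    have e1 : -(-C z - X : ℂ[X]) = X + C z := by ring
    have e2 : (X + (-C z - X) : ℂ[X]) = -C z := by ring
    rw [e1, e2]
    have key : (brGen h g m).eval (C z) = -(brGen g h m).eval (-C z - X) := by
      cases g <;> cases h <;> cases m <;> simp [brGen, h1] <;> grind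
    rw [key]
    ring
  jacobi z w a b c := by
    have e1 : (X + C z : ℂ[X]).comp (X + C w) = X + C (z + w) := by simp; ring
    have e2 : (X + C w : ℂ[X]).comp (X + C z) = X + C (z + w) := by simp; ring
    have e3 : (X + C z : ℂ[X]).comp (-C (z + w)) = -C w := by simp
    have e4 : ∀ (x : ℂ) (y : ℂ[X]), (-C x : ℂ[X]).comp y = -C x := by intro x y; simp
    have e5 : ∀ y : ℂ[X], (2 : ℂ[X]).comp y = 2 := by intro y; simp
    have e6 : ∀ y : ℂ[X], (3 : ℂ[X]).comp y = 3 := by intro y; simp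
    have h1 : (C (3 / 2 : ℂ) : ℂ[X]) = 3 * C (1 / 2) := by
      rw [show (3 : ℂ[X]) = C 3 from rfl, ← C_mul]; norm_num
    have h2 : (2 : ℂ[X]) * C (1 / 2 : ℂ) = 1 := by
      rw [show (2 : ℂ[X]) = C 2 from rfl, ← C_mul]; norm_num
    funext m
    cases m <;>
    simp only [Pi.add_apply, evalAt_svBracket_L, evalAt_svBracket_N, evalAt_svBracket_Y,
      evalAt_svBracket_M, add_comp, sub_comp, mul_comp, comp_assoc, X_comp, C_comp, e1, e2, e3,
      e4, e5, e6, h1] <;>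
    simp only [C_add]
    · ring
    · ring
    · grind
    · grind

/-! ### The operator `τ` and the distinguished cochains -/

/-- `(τγ)_{λ₁,…,λ_q}(a₁, …, a_q) = (-1)^q ∂/∂λ γ_{λ₁,…,λ_q,λ}(a₁, …, a_q, L) |_{λ=0}`,
for a cochain `γ` of degree `q + 1`. -/
def tau {q : ℕ} (γ : LieConformal.PreCochain Carrier (q + 1)) :
    LieConformal.PreCochain Carrier q := fun a =>
  (-1) ^ q *
    MvPolynomial.aeval
      (Fin.snoc (fun i => MvPolynomial.X i) 0 : Fin (q + 1) → MvPolynomial (Fin q) ℂ)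
      (MvPolynomial.pderiv (Fin.last q) (γ (Fin.snoc a (gen L))))

/-- `X̂ = τ(∂X)`. -/
def hat {q : ℕ} (γ : LieConformal.PreCochain Carrier (q + 1)) :
    LieConformal.PreCochain Carrier q :=
  tau (LieConformal.del Carrier (q + 1) γ)

/-- The cochain whose value on the generators `g₁, …, gₙ` is `p(λ₁, …, λₙ)` and which vanishes on
all tuples of generators that are not a rearrangement of `g₁, …, gₙ`; here `p` is to be
skew-symmetric under the permutations that fix the tuple `g`. On general arguments
`aᵢ = ∑ₕ aᵢₕ(∂) h` it is obtained by skew-symmetrizing `p(λ) ∏ aᵢ_{gᵢ}(-λᵢ)`, normalized by the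
number of permutations that fix the tuple `g`. -/
def cochainOfValue {n : ℕ} (g : Fin n → Gen) (p : MvPolynomial (Fin n) ℂ) :
    LieConformal.PreCochain Carrier n := fun a =>
  ((Fintype.card {σ : Equiv.Perm (Fin n) // g ∘ σ = g} : ℂ)⁻¹) •
    ∑ σ : Equiv.Perm (Fin n), (Equiv.Perm.sign σ : ℤ) •
      MvPolynomial.rename σ
        (p * ∏ i : Fin n, aeval (-MvPolynomial.X i : MvPolynomial (Fin n) ℂ) (a (σ i) (g i)))

/-- `γ` is the cochain with value `p` on the generators `g₁, …, gₙ` that vanishes on all tuples of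
generators that are not a rearrangement of `g₁, …, gₙ`. By conformal antilinearity and
skew-symmetry, these conditions determine `γ`. -/
def IsDeterminedBy {n : ℕ} (γ : LieConformal.PreCochain Carrier n) (g : Fin n → Gen)
    (p : MvPolynomial (Fin n) ℂ) : Prop :=
  γ ∈ LieConformal.cochains extendedSV n ∧
    γ (fun i => gen (g i)) = p ∧
    ∀ h : Fin n → Gen, (∀ σ : Equiv.Perm (Fin n), h ≠ g ∘ σ) → γ (fun i => gen (h i)) = 0

section Distinguished

open MvPolynomial

/-- `Φ¹`, `Φ²`, `Φ³`. The variables `λ₁, λ₂, λ₃` are `X 0, X 1, X 2`. -/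
def Phi : Fin 3 → LieConformal.PreCochain Carrier 3 :=
  ![cochainOfValue ![L, N, N] (X 1 - X 2),
    cochainOfValue ![L, L, N] ((X 0 - X 1) * X 2),
    cochainOfValue ![L, L, L] ((X 0 - X 1) * (X 0 - X 2) * (X 1 - X 2))]

/-- `Ψ¹`, `Ψ²`. The variables `λ₁, λ₂, λ₃, λ₄` are `X 0, X 1, X 2, X 3`. -/
def Psi : Fin 2 → LieConformal.PreCochain Carrier 4 :=
  ![cochainOfValue ![L, L, N, N] ((X 0 - X 1) * (X 2 - X 3)),
    cochainOfValue ![L, L, L, N] ((X 0 - X 1) * (X 0 - X 2) * (X 1 - X 2))]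

end Distinguished

end ExtendedSV

end

/-! A cochain is determined by its values on generators. These are polynomials, hence determined by
their Taylor coefficients at 0. Reading the coefficient of λ^k/k! in a slot holding the generator g
as the value at a symbol (g, k) identifies C̃ⁿ with the finitely supported alternating functions of
n symbols. Under this identification d becomes the Chevalley–Eilenberg differential of the
annihilation Lie algebra, which has the symbols as a basis (`coeffs_d`, `exists_cochain`). Cartan's
formula (`contract_ce`) then gives d² = 0 and a contracting homotopy.

The Lie derivative along (L,1) - 5/2 (N,0) multiplies a function by the total weight of its
arguments, where (L,k), (N,k), (Y,k), (M,k) have weights k-1, k, k+2, k+5. By Cartan's formula every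
cocycle is cohomologous to its part of weight zero (`eq_scale_add_ce`). Only (L,0) has negative
weight, namely -1, and an alternating function sees it at most once. So weight zero involves only
(L,0), (L,1), (L,2), (N,0), (N,1). The weight-zero complex has dimensions 1, 2, 3, 4, 2 in degrees 0
to 4, and its differentials out of degrees 0 to 3 have ranks 0, 2, 1, 0. Hence the cohomology of C̃
has dimensions 1, 0, 0, 3, 2, with bases 1, the Φ and the Ψ.

For the quotient complex, ∂ is injective in positive degrees, so a reduced n-cocycle γ has dγ = ∂η
with η a cocycle of degree n+1. If X is one of the Φ or Ψ, the Lie derivative along (L,1) fixes ∂X,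
and Cartan's formula gives d(τ∂X) = ∂X (`d_hat`). Thus ∂ acts by zero on these classes and X̂ is a
reduced cocycle lying over X. The long exact sequence splits into short ones, and the reduced
cohomology in degree n has as basis the classes of degree n together with the X̂ for X of degree n+1
(`isReducedCohomologyBasis_of_basic`). -/

noncomputable section

open Matrix (vecCons)

/-! ### Cartan calculus for a Lie algebra with a monomial basis -/

/-- A Lie algebra structure on the free complex vector space on `S` for which the bracket of two
basis elements `x`, `y` is the multiple `c x y` of the basis element `s x y`. The axioms are tested
on the linear functionals given by functions `f : S → ℂ`. -/
structure MonomialLie (S : Type*) where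
  c : S → S → ℂ
  s : S → S → S
  skew : ∀ (x y : S) (f : S → ℂ), c x y * f (s x y) = -(c y x * f (s y x))
  jacobi : ∀ (x y z : S) (f : S → ℂ),
    c y z * (c x (s y z) * f (s x (s y z))) =
      c x y * (c (s x y) z * f (s (s x y) z)) + c x z * (c y (s x z) * f (s y (s x z)))

namespace MonomialLie

section Alternating

variable {S : Type*}

/-- Functions of `n` arguments that are skew-symmetric under permutations. -/
def alternating (S : Type*) (n : ℕ) : Submodule ℂ ((Fin n → S) → ℂ) where
  carrier := {F | ∀ (σ : Equiv.Perm (Fin n)) (x : Fin n → S),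
    F (x ∘ σ) = ((Equiv.Perm.sign σ : ℤ) : ℂ) * F x}
  add_mem' := by
    intro F G hF hG σ x
    simp only [Pi.add_apply, hF σ x, hG σ x, mul_add]
  zero_mem' := by intro σ x; simp
  smul_mem' := by
    intro r F hF σ x
    simp only [Pi.smul_apply, hF σ x, smul_eq_mul]
    ring

/-- Insertion of `x` as the first argument. -/
def contract {n : ℕ} (x : S) : ((Fin (n + 1) → S) → ℂ) →ₗ[ℂ] ((Fin n → S) → ℂ) :=
  LinearMap.funLeft ℂ ℂ (fun y => vecCons x y)

@[simp]
theorem contract_apply {n : ℕ} (x : S) (F : (Fin (n + 1) → S) → ℂ) (y : Fin n → S) :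
    contract x F y = F (vecCons x y) := rfl

theorem ext_contract {n : ℕ} {F G : (Fin (n + 1) → S) → ℂ}
    (h : ∀ x, contract x F = contract x G) : F = G := by
  funext y
  rw [← Fin.cons_self_tail y]
  exact congrFun (h (y 0)) (Fin.tail y)

theorem contract_mem {n : ℕ} {F : (Fin (n + 1) → S) → ℂ} (hF : F ∈ alternating S (n + 1)) (x : S) :
    contract x F ∈ alternating S n := by
  intro σ y
  have h := hF (Equiv.Perm.decomposeFin.symm (0, σ)) (vecCons x y)
  rw [Equiv.Perm.decomposeFin.symm_sign, if_pos rfl, one_mul] at h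
  rw [contract_apply, contract_apply, ← h]
  congr 1
  funext i
  refine Fin.cases ?_ (fun k => ?_) i <;> simp

theorem swap_first {n : ℕ} {F : (Fin (n + 2) → S) → ℂ} (hF : F ∈ alternating S (n + 2))
    (x y : S) (z : Fin n → S) : F (vecCons x (vecCons y z)) = -F (vecCons y (vecCons x z)) := by
  have h := hF (Equiv.swap 0 1) (vecCons y (vecCons x z))
  rw [Equiv.Perm.sign_swap (by simp)] at h
  have e : vecCons y (vecCons x z) ∘ Equiv.swap (0 : Fin (n + 2)) 1 =
      vecCons x (vecCons y z) := by
    funext i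
    refine Fin.cases ?_ (fun k => Fin.cases ?_ (fun l => ?_) k) i
    · simp
    · simp
    · rw [Function.comp_apply, Equiv.swap_apply_of_ne_of_ne (by simp)
        (by rw [← Fin.succ_zero_eq_one, Ne, Fin.succ_inj]; simp)]
      simp
  rw [e] at h
  simpa using h

/-- Adjacent transpositions generate the symmetric group. All but the first fix position 0 and are
covered by `h1`; the exchange of the first two positions is `h2`. -/
theorem mem_alternating_of_contract {n : ℕ} {F : (Fin (n + 2) → S) → ℂ}
    (h1 : ∀ x, contract x F ∈ alternating S (n + 1))
    (h2 : ∀ x y z, F (vecCons x (vecCons y z)) = -F (vecCons y (vecCons x z))) :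
    F ∈ alternating S (n + 2) := by
  let H : Submonoid (Equiv.Perm (Fin (n + 2))) :=
    { carrier := {σ | ∀ x : Fin (n + 2) → S, F (x ∘ σ) = ((Equiv.Perm.sign σ : ℤ) : ℂ) * F x}
      one_mem' := by intro x; simp
      mul_mem' := by
        intro σ τ hσ hτ x
        have := hτ (x ∘ σ)
        rw [Function.comp_assoc, ← Equiv.Perm.coe_mul, hσ x] at this
        rw [this]
        simp only [Equiv.Perm.sign_mul, Units.val_mul, Int.cast_mul]
        ring }
  have hH : H = ⊤ := by
    rw [eq_top_iff, ← Equiv.Perm.mclosure_swap_castSucc_succ, Submonoid.closure_le]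
    rintro _ ⟨i, rfl⟩ x
    rw [Equiv.Perm.sign_swap (ne_of_lt Fin.castSucc_lt_succ)]
    refine Fin.cases ?_ (fun k => ?_) i
    · have := h2 (x 1) (x 0) (fun l => x l.succ.succ)
      have e1 : vecCons (x 0) (vecCons (x 1) (fun l => x l.succ.succ)) = x := by
        funext i
        refine Fin.cases ?_ (fun k => Fin.cases ?_ (fun l => ?_) k) i <;> simp
      have e2 : x ∘ Equiv.swap (Fin.castSucc 0) (Fin.succ 0) =
          vecCons (x 1) (vecCons (x 0) (fun l => x l.succ.succ)) := by
        funext i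
        refine Fin.cases ?_ (fun k => Fin.cases ?_ (fun l => ?_) k) i
        · simp
        · simp
        · rw [Function.comp_apply, Equiv.swap_apply_of_ne_of_ne (by simp)
            (by rw [Ne, Fin.succ_inj]; simp)]
          simp
      rw [e2, this, e1]
      simp
    · have := h1 (x 0) (Equiv.swap k.castSucc k.succ) (Fin.tail x)
      rw [Equiv.Perm.sign_swap (ne_of_lt Fin.castSucc_lt_succ), contract_apply,
        contract_apply] at this
      have e1 : vecCons (x 0) (Fin.tail x) = x := Fin.cons_self_tail x
      have e2 : x ∘ Equiv.swap (k.succ.castSucc) (k.succ.succ) =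
          vecCons (x 0) (Fin.tail x ∘ Equiv.swap k.castSucc k.succ) := by
        funext i
        refine Fin.cases ?_ (fun l => ?_) i
        · rw [Function.comp_apply, Equiv.swap_apply_of_ne_of_ne (by simp [Fin.ext_iff])
            (by simp [Fin.ext_iff])]
          simp
        · rw [← Fin.succ_castSucc, Function.comp_apply,
            (Fin.succ_injective _).swap_apply]
          simp [Fin.tail]
      rw [e2, this, e1]
  intro σ
  have : σ ∈ H := hH ▸ Submonoid.mem_top σ
  exact this

theorem mem_alternating_of_subsingleton {n : ℕ} (hn : n ≤ 1) (F : (Fin n → S) → ℂ) :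
    F ∈ alternating S n := by
  intro σ x
  have : Subsingleton (Fin n) := Fin.subsingleton_iff_le_one.mpr hn
  rw [Subsingleton.elim σ 1]
  simp

theorem alternating_eq_zero {n : ℕ} {F : (Fin n → S) → ℂ} (hF : F ∈ alternating S n)
    {x : Fin n → S} (hx : ¬ Function.Injective x) : F x = 0 := by
  obtain ⟨i, j, hij, hne⟩ := Function.not_injective_iff.mp hx
  have h := hF (Equiv.swap i j) x
  rw [Equiv.Perm.sign_swap hne] at h
  have e : x ∘ Equiv.swap i j = x := by
    funext k
    rw [Function.comp_apply, Equiv.swap_apply_def]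
    split_ifs with h1 h2
    · rw [h1, hij]
    · rw [h2, hij]
    · rfl
  rw [e] at h
  simpa [CharZero.eq_neg_self_iff] using h

end Alternating

variable {S : Type*} (𝔞 : MonomialLie S)

/-- The Lie derivative along the basis element `x`. -/
def lieDer (x : S) {n : ℕ} : ((Fin n → S) → ℂ) →ₗ[ℂ] ((Fin n → S) → ℂ) where
  toFun F y := -∑ j, 𝔞.c x (y j) * F (Function.update y j (𝔞.s x (y j)))
  map_add' F G := by
    funext y
    simp [mul_add, Finset.sum_add_distrib]
    ring
  map_smul' r F := by
    funext y
    simp only [Pi.smul_apply, smul_eq_mul, RingHom.id_apply, mul_neg, Finset.mul_sum]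
    congr 1
    exact Finset.sum_congr rfl fun j _ => by ring

/-- The Chevalley–Eilenberg differential. -/
def ce : (n : ℕ) → ((Fin n → S) → ℂ) →ₗ[ℂ] ((Fin (n + 1) → S) → ℂ)
  | 0 => 0
  | m + 1 =>
    { toFun := fun F x => ∑ j : Fin (m + 2), ∑ i : Fin (m + 1),
        if i.castSucc < j then (-1) ^ ((i : ℕ) + (j : ℕ)) *
          (𝔞.c (x i.castSucc) (x j) *
            F (vecCons (𝔞.s (x i.castSucc) (x j)) fun l => x (LieConformal.skip i j l))) else 0
      map_add' := by
        intro F G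
        funext x
        simp only [Pi.add_apply, ← Finset.sum_add_distrib]
        refine Finset.sum_congr rfl fun j _ => Finset.sum_congr rfl fun i _ => ?_
        split_ifs
        · ring
        · simp
      map_smul' := by
        intro r F
        funext x
        simp only [Pi.smul_apply, smul_eq_mul, RingHom.id_apply, Finset.mul_sum]
        refine Finset.sum_congr rfl fun j _ => Finset.sum_congr rfl fun i _ => ?_
        split_ifs
        · ring
        · simp }

theorem ce_succ_apply {m : ℕ} (F : (Fin (m + 1) → S) → ℂ) (x : Fin (m + 2) → S) :
    𝔞.ce (m + 1) F x = ∑ j : Fin (m + 2), ∑ i : Fin (m + 1),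
        if i.castSucc < j then (-1) ^ ((i : ℕ) + (j : ℕ)) *
          (𝔞.c (x i.castSucc) (x j) *
            F (vecCons (𝔞.s (x i.castSucc) (x j)) fun l => x (LieConformal.skip i j l)))
        else 0 := rfl

/-- This is [ι_w, L_x] = -ι_{[x,w]}: the summand j = 0 of the Lie derivative is the one acting on w.
It drives the inductions on the degree below. -/
theorem contract_lieDer (x w : S) {n : ℕ} (F : (Fin (n + 1) → S) → ℂ) :
    contract w (𝔞.lieDer x F) =
      𝔞.lieDer x (contract w F) - 𝔞.c x w • contract (𝔞.s x w) F := by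
  funext y
  have e1 : ∀ z : S, Function.update (vecCons w y) 0 z = vecCons z y :=
    fun z => Fin.update_cons_zero (α := fun _ => S) _ _ _
  have e2 : ∀ (j : Fin n) (z : S), Function.update (vecCons w y) j.succ z =
      vecCons w (Function.update y j z) :=
    fun j z => (Fin.cons_update (α := fun _ => S) _ _ _ _).symm
  simp [lieDer, Fin.sum_univ_succ, e1, e2]
  ring

/-- Moving [x, y_j] from the front back to slot j costs (-1)^j, and the Lie derivative carries one
more minus sign. The left side is the part of `ce` made of the brackets with a first argument x. -/
theorem sum_cons_removeNth {n : ℕ} {F : (Fin (n + 1) → S) → ℂ} (hF : F ∈ alternating S (n + 1))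
    (x : S) (y : Fin (n + 1) → S) :
    ∑ j : Fin (n + 1), (-1) ^ ((j : ℕ) + 1) *
        (𝔞.c x (y j) * F (vecCons (𝔞.s x (y j)) fun l => y (j.succAbove l))) =
      𝔞.lieDer x F y := by
  induction n with
  | zero =>
    have e : Function.update y 0 (𝔞.s x (y 0)) =
        vecCons (𝔞.s x (y 0)) fun l => y (Fin.succAbove 0 l) := by
      funext i
      rw [Fin.fin_one_eq_zero i]
      simp
    simp [lieDer, e]
  | succ n ih =>
    obtain ⟨w, z, rfl⟩ : ∃ (w : S) (z : Fin (n + 1) → S), y = vecCons w z :=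
      ⟨y 0, Fin.tail y, (Fin.cons_self_tail y).symm⟩
    rw [← contract_apply w (𝔞.lieDer x F), contract_lieDer, Pi.sub_apply, ← ih (contract_mem hF w),
      Fin.sum_univ_succ, add_comm, sub_eq_add_neg]
    congr 1
    · refine Finset.sum_congr rfl fun j _ => ?_
      have e : (fun l => vecCons w z (j.succ.succAbove l)) =
          vecCons w (fun l => z (j.succAbove l)) := by
        funext l
        refine Fin.cases ?_ (fun k => ?_) l <;> simp [Fin.succ_succAbove_succ]
      simp only [Matrix.cons_val_succ, e, contract_apply, Fin.val_succ]
      rw [swap_first hF w]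
      ring
    · simp

/-- Cartan's formula. -/
theorem contract_ce {n : ℕ} {F : (Fin (n + 1) → S) → ℂ} (hF : F ∈ alternating S (n + 1)) (x : S) :
    contract x (𝔞.ce (n + 1) F) = 𝔞.lieDer x F - 𝔞.ce n (contract x F) := by
  funext y
  rw [contract_apply, ce_succ_apply, Fin.sum_univ_succ]
  simp only [Fin.not_lt_zero, if_false, Pi.sub_apply]
  rw [Finset.sum_const_zero, zero_add]
  -- The summands i = 0 bracket with x and form the Lie derivative. In the others both indices are
  -- shifted by one, which leaves the sign (-1)^(i+j) unchanged.
  refine (Finset.sum_congr rfl fun j _ => Fin.sum_univ_succ _).trans ?_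
  rw [Finset.sum_add_distrib, ← 𝔞.sum_cons_removeNth hF, sub_eq_add_neg]
  have hs : ∀ (j : Fin (n + 1)),
      (fun l => vecCons x y (LieConformal.skip 0 j.succ l)) = fun l => y (j.succAbove l) := by
    intro j
    funext l
    simp [LieConformal.skip, Fin.succ_succAbove_succ]
  congr 1
  · refine Finset.sum_congr rfl fun j _ => ?_
    simp [hs]
  · cases n with
    | zero => simp [ce]
    | succ m =>
      have hs2 : ∀ (i : Fin (m + 1)) (j : Fin (m + 2)),
          (fun l => vecCons x y (LieConformal.skip i.succ j.succ l)) =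
            vecCons x (fun l => y (LieConformal.skip i j l)) := by
        intro i j
        funext l
        refine Fin.cases ?_ (fun k => ?_) l <;>
          simp [LieConformal.skip, Fin.succ_succAbove_succ]
      rw [ce_succ_apply, ← Finset.sum_neg_distrib]
      refine Finset.sum_congr rfl fun j _ => ?_
      rw [← Finset.sum_neg_distrib]
      refine Finset.sum_congr rfl fun i _ => ?_
      simp only [← Fin.succ_castSucc, Fin.succ_lt_succ_iff, Matrix.cons_val_succ, hs2,
        contract_apply, Fin.val_succ]
      split_ifs
      -- Here the bracket precedes x; exchanging the two produces the minus sign in front of d ι_x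
      -- F.
      · rw [swap_first hF _ x]
        ring
      · simp

theorem lieDer_mem {n : ℕ} {F : (Fin n → S) → ℂ} (hF : F ∈ alternating S n) (x : S) :
    𝔞.lieDer x F ∈ alternating S n := by
  intro σ y
  simp only [lieDer, LinearMap.coe_mk, AddHom.coe_mk, mul_neg, Finset.mul_sum]
  congr 1
  refine Fintype.sum_equiv σ _ _ fun j => ?_
  have := hF σ (Function.update y (σ j) (𝔞.s x (y (σ j))))
  rw [Function.update_comp_eq_of_injective _ σ.injective] at this
  rw [Function.comp_apply, this]
  ring

/-- Induction on the degree: by `contract_lieDer` the only new terms are those in which both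
derivatives act on the inserted w, and these match by the Jacobi identity. -/
theorem lieDer_comm (x y : S) {n : ℕ} (F : (Fin n → S) → ℂ) :
    𝔞.lieDer x (𝔞.lieDer y F) - 𝔞.lieDer y (𝔞.lieDer x F) =
      𝔞.c x y • 𝔞.lieDer (𝔞.s x y) F := by
  induction n with
  | zero => funext z; simp [lieDer]
  | succ n ih =>
    refine ext_contract fun w => ?_
    have h := ih (contract w F)
    have j : 𝔞.c y w • 𝔞.c x (𝔞.s y w) • contract (𝔞.s x (𝔞.s y w)) F =
        𝔞.c x y • 𝔞.c (𝔞.s x y) w • contract (𝔞.s (𝔞.s x y) w) F +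
        𝔞.c x w • 𝔞.c y (𝔞.s x w) • contract (𝔞.s y (𝔞.s x w)) F := by
      funext z
      exact 𝔞.jacobi x y w fun t => contract t F z
    simp only [map_sub, map_smul, contract_lieDer, smul_sub]
    rw [← h, j]
    abel

/-- Applying Cartan's formula twice gives ι_y ι_x dF = L_x ι_y F - L_y ι_x F - ι_{[x,y]} F + d ι_y
ι_x F, which is visibly skew in x and y. Permutations fixing the first slot follow by induction. On
functions of one argument the last term and the Lie derivatives vanish. -/
theorem ce_mem {n : ℕ} {F : (Fin n → S) → ℂ} (hF : F ∈ alternating S n) :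
    𝔞.ce n F ∈ alternating S (n + 1) := by
  induction n with
  | zero => exact mem_alternating_of_subsingleton (by simp) _
  | succ n ih =>
    refine mem_alternating_of_contract (fun x => ?_) (fun x y z => ?_)
    · rw [𝔞.contract_ce hF]
      exact Submodule.sub_mem _ (𝔞.lieDer_mem hF x) (ih (contract_mem hF x))
    · have key : ∀ x y, contract y (contract x (𝔞.ce (n + 1) F)) =
          𝔞.lieDer x (contract y F) - 𝔞.c x y • contract (𝔞.s x y) F -
            contract y (𝔞.ce n (contract x F)) := by
        intro x y
        rw [𝔞.contract_ce hF, map_sub, contract_lieDer]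
      have hsk : ∀ G : S → ℂ, 𝔞.c x y * G (𝔞.s x y) = -(𝔞.c y x * G (𝔞.s y x)) := 𝔞.skew x y
      have k1 := congrFun (key x y) z
      have k2 := congrFun (key y x) z
      have h3 := hsk fun t => contract t F z
      simp only [contract_apply] at k1 k2 h3
      cases n with
      | zero =>
        rw [k1, k2]
        simp [lieDer, ce]
        rw [h3, neg_neg]
      | succ m =>
        have c1 := congrFun (𝔞.contract_ce (contract_mem hF x) y) z
        have c2 := congrFun (𝔞.contract_ce (contract_mem hF y) x) z
        have e : contract y (contract x F) = -contract x (contract y F) := by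
          funext z
          exact swap_first hF x y z
        rw [e, map_neg] at c1
        simp only [contract_apply, Pi.sub_apply, Pi.neg_apply, Pi.smul_apply, smul_eq_mul] at *
        rw [k1, k2, c1, c2, h3]
        ring

theorem ce_lieDer {n : ℕ} {F : (Fin n → S) → ℂ} (hF : F ∈ alternating S n) (x : S) :
    𝔞.ce n (𝔞.lieDer x F) = 𝔞.lieDer x (𝔞.ce n F) := by
  induction n with
  | zero => exact map_zero _ |>.symm
  | succ n ih =>
    refine ext_contract fun y => ?_
    have h1 := ih (contract_mem hF y)
    have h2 := 𝔞.lieDer_comm x y F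
    have h3 := 𝔞.contract_ce hF
    rw [𝔞.contract_ce (𝔞.lieDer_mem hF x), contract_lieDer, contract_lieDer, h3 y,
      h3 (𝔞.s x y), map_sub, map_sub, map_smul, h1, smul_sub, ← h2]
    abel

/-- By Cartan's formula ι_x d d F = L_x dF - d L_x F + d d ι_x F; the first two terms cancel by
`ce_lieDer` and the last vanishes by induction. -/
theorem ce_ce {n : ℕ} {F : (Fin n → S) → ℂ} (hF : F ∈ alternating S n) :
    𝔞.ce (n + 1) (𝔞.ce n F) = 0 := by
  induction n with
  | zero => exact (𝔞.ce 1).map_zero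
  | succ n ih =>
    refine ext_contract fun x => ?_
    rw [𝔞.contract_ce (𝔞.ce_mem hF), 𝔞.contract_ce hF, map_sub, ih (contract_mem hF x),
      𝔞.ce_lieDer hF, sub_zero, sub_self, map_zero]

end MonomialLie

/-! ### The annihilation algebra -/

namespace ExtendedSV

open Gen MonomialLie

/-- The structure constants of the annihilation algebra in the basis `(g, k)`, where `(g, k)` is
dual to `λ ^ k / k!`. -/
def annCoeff : Gen × ℕ → Gen × ℕ → ℂ
  | (L, a), (L, b) => a - b
  | (L, a), (Y, b) => 1 / 2 * a - b
  | (Y, a), (L, b) => a - 1 / 2 * b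
  | (Y, a), (Y, b) => a - b
  | (L, _), (M, b) => -b
  | (M, a), (L, _) => a
  | (L, _), (N, b) => -b
  | (N, a), (L, _) => a
  | (N, _), (Y, _) => 1
  | (Y, _), (N, _) => -1
  | (N, _), (M, _) => 2
  | (M, _), (N, _) => -2
  | _, _ => 0

/-- The generator occurring in the bracket of two generators. -/
def genMul : Gen → Gen → Gen
  | L, g => g
  | g, L => g
  | N, g => g
  | g, N => g
  | _, _ => M

/-- The power of `λ` lost in the bracket of two generators. -/
def genLoss : Gen → Gen → ℕ
  | L, _ => 1
  | _, L => 1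
  | Y, Y => 1
  | _, _ => 0

/-- The basis element occurring in the bracket of two basis elements. -/
def annMul (x y : Gen × ℕ) : Gen × ℕ :=
  (genMul x.1 y.1, x.2 + y.2 - genLoss x.1 y.1)

theorem annCoeff_skew (x y : Gen × ℕ) (f : Gen × ℕ → ℂ) :
    annCoeff x y * f (annMul x y) = -(annCoeff y x * f (annMul y x)) := by
  obtain ⟨g, a⟩ := x
  obtain ⟨h, b⟩ := y
  cases g <;> cases h <;> simp [annCoeff, annMul, genMul, genLoss, add_comm b a] <;> ring

/-- The extension by zero to negative indices of a function on the basis. -/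
def intExtend (f : Gen × ℕ → ℂ) (g : Gen) (n : ℤ) : ℂ :=
  if 0 ≤ n then f (g, n.toNat) else 0

/-- The structure constants as functions of complex indices. -/
def annCoeffAux : Gen → Gen → ℂ → ℂ → ℂ
  | L, L, a, b => a - b
  | L, Y, a, b => 1 / 2 * a - b
  | Y, L, a, b => a - 1 / 2 * b
  | Y, Y, a, b => a - b
  | L, M, _, b => -b
  | M, L, a, _ => a
  | L, N, _, b => -b
  | N, L, a, _ => a
  | N, Y, _, _ => 1
  | Y, N, _, _ => -1
  | N, M, _, _ => 2
  | M, N, _, _ => -2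
  | _, _, _, _ => 0

theorem annCoeff_eq (g h : Gen) (a b : ℕ) : annCoeff (g, a) (h, b) = annCoeffAux g h a b := by
  cases g <;> cases h <;> rfl

/-- This makes the truncated subtraction in `annMul` harmless: the index could become negative only
for a = b = 0 with loss 1, and there the structure constant is zero. -/
theorem annCoeff_eq_zero {g h : Gen} {a b : ℕ} (h0 : ¬ genLoss g h ≤ a + b) :
    annCoeff (g, a) (h, b) = 0 := by
  have hl : genLoss g h ≤ 1 := by cases g <;> cases h <;> simp [genLoss]
  obtain rfl : a = 0 := by omega
  obtain rfl : b = 0 := by omega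
  revert h0
  cases g <;> cases h <;> simp [annCoeff, genLoss]

/-- Passing to integer indices, with extension by zero, removes the truncated subtraction. The
Jacobi identity then becomes a polynomial identity in complex indices, checked for each triple of
generators in `annCoeffAux_jacobi`. -/
theorem annCoeff_mul (g h : Gen) (a b : ℕ) (f : Gen × ℕ → ℂ) :
    annCoeff (g, a) (h, b) * f (annMul (g, a) (h, b)) =
      annCoeffAux g h a b * intExtend f (genMul g h) ((a : ℤ) + b - genLoss g h) := by
  by_cases h0 : genLoss g h ≤ a + b
  · rw [annCoeff_eq, annMul, intExtend, if_pos (by omega)]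
    congr 3
    simp only
    omega
  · rw [← annCoeff_eq, annCoeff_eq_zero h0, zero_mul, zero_mul]

theorem annCoeff_mul_right (g h k : Gen) (a b c : ℕ) (f : Gen × ℕ → ℂ) :
    annCoeff (h, b) (k, c) * (annCoeff (g, a) (annMul (h, b) (k, c)) *
        f (annMul (g, a) (annMul (h, b) (k, c)))) =
      annCoeffAux h k b c * (annCoeffAux g (genMul h k) a (b + c - genLoss h k) *
        intExtend f (genMul g (genMul h k))
          ((a : ℤ) + b + c - genLoss h k - genLoss g (genMul h k))) := by
  by_cases h0 : genLoss h k ≤ b + c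
  · rw [annCoeff_eq h, annMul, annCoeff_mul]
    push_cast [h0]
    congr 3
    ring
  · rw [← annCoeff_eq, annCoeff_eq_zero h0, zero_mul, zero_mul]

theorem annCoeff_mul_left (g h k : Gen) (a b c : ℕ) (f : Gen × ℕ → ℂ) :
    annCoeff (g, a) (h, b) * (annCoeff (annMul (g, a) (h, b)) (k, c) *
        f (annMul (annMul (g, a) (h, b)) (k, c))) =
      annCoeffAux g h a b * (annCoeffAux (genMul g h) k (a + b - genLoss g h) c *
        intExtend f (genMul (genMul g h) k)
          ((a : ℤ) + b + c - genLoss g h - genLoss (genMul g h) k)) := by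
  by_cases h0 : genLoss g h ≤ a + b
  · rw [annCoeff_eq g, annMul, annCoeff_mul]
    push_cast [h0]
    congr 3
    ring
  · rw [← annCoeff_eq, annCoeff_eq_zero h0, zero_mul, zero_mul]

theorem annCoeffAux_jacobi (g h k : Gen) (a b c : ℂ) (n : ℤ) (φ : Gen → ℤ → ℂ) :
    annCoeffAux h k b c * (annCoeffAux g (genMul h k) a (b + c - genLoss h k) *
        φ (genMul g (genMul h k)) (n - genLoss h k - genLoss g (genMul h k))) =
      annCoeffAux g h a b * (annCoeffAux (genMul g h) k (a + b - genLoss g h) c *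
        φ (genMul (genMul g h) k) (n - genLoss g h - genLoss (genMul g h) k)) +
      annCoeffAux g k a c * (annCoeffAux h (genMul g k) b (a + c - genLoss g k) *
        φ (genMul h (genMul g k)) (n - genLoss g k - genLoss h (genMul g k))) := by
  cases g <;> cases h <;> cases k <;>
    simp only [annCoeffAux, genMul, genLoss, zero_mul, mul_zero, add_zero] <;> push_cast <;> ring_nf

theorem annCoeff_jacobi (x y z : Gen × ℕ) (f : Gen × ℕ → ℂ) :
    annCoeff y z * (annCoeff x (annMul y z) * f (annMul x (annMul y z))) =
      annCoeff x y * (annCoeff (annMul x y) z * f (annMul (annMul x y) z)) +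
        annCoeff x z * (annCoeff y (annMul x z) * f (annMul y (annMul x z))) := by
  obtain ⟨g, a⟩ := x
  obtain ⟨h, b⟩ := y
  obtain ⟨k, c⟩ := z
  rw [annCoeff_mul_right, annCoeff_mul_left, annCoeff_mul_right, annCoeffAux_jacobi,
    add_comm (b : ℤ) a]

/-- The annihilation algebra of the extended Schrödinger–Virasoro conformal algebra. -/
def ann : MonomialLie (Gen × ℕ) where
  c := annCoeff
  s := annMul
  skew := annCoeff_skew
  jacobi := annCoeff_jacobi

/-! ### The weight grading and the homotopy onto weight zero -/

/-- The eigenvalues of `ad (L, 1) + 5 / 2 • ad (N, 0)`, up to sign. -/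
def weight : Gen × ℕ → ℤ
  | (L, k) => k - 1
  | (N, k) => k
  | (Y, k) => k + 2
  | (M, k) => k + 5

/-- The nonvanishing of the coefficient is needed: for example `annMul` sends ((L,0), (L,0)) to
(L,0), of weight -1 instead of -2. -/
theorem weight_annMul {x y : Gen × ℕ} (h : annCoeff x y ≠ 0) :
    weight (annMul x y) = weight x + weight y := by
  obtain ⟨g, a⟩ := x
  obtain ⟨k, b⟩ := y
  by_cases h0 : genLoss g k ≤ a + b
  · rw [annMul]
    revert h h0
    cases g <;> cases k <;> simp [annCoeff, genLoss, genMul, weight] <;> omega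
  · exact absurd (annCoeff_eq_zero h0) h

theorem _root_.Fin.sum_eq_add_sum_skip {R : Type*} [AddCommMonoid R] {m : ℕ} {i : Fin (m + 1)}
    {j : Fin (m + 2)} (hij : i.castSucc < j) (f : Fin (m + 2) → R) :
    ∑ l, f l = f i.castSucc + f j + ∑ l, f (LieConformal.skip i j l) := by
  rw [Fin.sum_univ_succAbove f j, Fin.sum_univ_succAbove _ i, Fin.succAbove_of_castSucc_lt _ _ hij,
    ← add_assoc, add_comm (f j)]
  rfl

/-- Multiplication of a function of `n` basis elements by a function of the total weight. -/
def scale {n : ℕ} (f : ℤ → ℂ) : ((Fin n → Gen × ℕ) → ℂ) →ₗ[ℂ] ((Fin n → Gen × ℕ) → ℂ) where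
  toFun F x := f (∑ i, weight (x i)) * F x
  map_add' F G := by funext x; simp [mul_add]
  map_smul' r F := by funext x; simp; ring

theorem scale_apply {n : ℕ} (f : ℤ → ℂ) (F : (Fin n → Gen × ℕ) → ℂ) (x : Fin n → Gen × ℕ) :
    scale f F x = f (∑ i, weight (x i)) * F x := rfl

theorem scale_mem {n : ℕ} (f : ℤ → ℂ) {F : (Fin n → Gen × ℕ) → ℂ}
    (hF : F ∈ alternating (Gen × ℕ) n) : scale f F ∈ alternating (Gen × ℕ) n := by
  intro σ x
  rw [scale_apply, scale_apply, hF σ x]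
  simp only [Function.comp_apply]
  rw [Equiv.sum_comp σ fun i => weight (x i)]
  ring

theorem ce_scale {n : ℕ} (f : ℤ → ℂ) (F : (Fin n → Gen × ℕ) → ℂ) :
    ann.ce n (scale f F) = scale f (ann.ce n F) := by
  cases n with
  | zero => exact (map_zero (scale f)).symm
  | succ m =>
    funext x
    rw [scale_apply, ce_succ_apply, ce_succ_apply, Finset.mul_sum]
    refine Finset.sum_congr rfl fun j _ => ?_
    rw [Finset.mul_sum]
    refine Finset.sum_congr rfl fun i _ => ?_
    split_ifs with hij
    · by_cases h : annCoeff (x i.castSucc) (x j) = 0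
      · simp [ann, h]
      · rw [scale_apply, Fin.sum_eq_add_sum_skip hij]
        simp only [Fin.sum_univ_succ (n := m), Matrix.cons_val_zero, Matrix.cons_val_succ, ann,
          weight_annMul h]
        ring
    · simp

theorem lieDer_L_apply {n : ℕ} (F : (Fin n → Gen × ℕ) → ℂ) (x : Fin n → Gen × ℕ) :
    ann.lieDer (L, 1) F x = -(∑ i, annCoeff (L, 1) (x i)) * F x := by
  simp only [lieDer, LinearMap.coe_mk, AddHom.coe_mk, neg_mul, Finset.sum_mul, ann]
  congr 1
  refine Finset.sum_congr rfl fun i _ => ?_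
  have e : annMul (L, 1) (x i) = x i := by simp [annMul, genMul, genLoss]
  rw [e, Function.update_eq_self]

theorem lieDer_N_apply {n : ℕ} (F : (Fin n → Gen × ℕ) → ℂ) (x : Fin n → Gen × ℕ) :
    ann.lieDer (N, 0) F x = -(∑ i, annCoeff (N, 0) (x i)) * F x := by
  simp only [lieDer, LinearMap.coe_mk, AddHom.coe_mk, neg_mul, Finset.sum_mul, ann]
  congr 1
  refine Finset.sum_congr rfl fun i _ => ?_
  rcases hx : x i with ⟨g, k⟩
  by_cases h : annCoeff (N, 0) (g, k) = 0
  · rw [h, zero_mul, zero_mul]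
  -- A nonzero coefficient forces g to be Y or M, and these are eigenvectors. For g = L the product
  -- would be another basis element.
  · have e : annMul (N, 0) (g, k) = x i := by
      rw [hx]
      revert h
      cases g <;> simp [annCoeff, annMul, genMul, genLoss]
    rw [e, Function.update_eq_self]

/-- The multiple 5/2 of (N,0), which has charge 1 on Y and 2 on M, lifts the weights of all (Y,k)
and (M,k) to integers at least 2. Neither can then occur in an injective tuple of weight zero. -/
theorem annCoeff_weight (x : Gen × ℕ) :
    -annCoeff (L, 1) x + 5 / 2 * annCoeff (N, 0) x = weight x := by
  obtain ⟨g, k⟩ := x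
  cases g <;> (simp [annCoeff, weight]; try ring)

theorem lieDer_sub_smul_lieDer {n : ℕ} (F : (Fin n → Gen × ℕ) → ℂ) :
    ann.lieDer (L, 1) F - (5 / 2 : ℂ) • ann.lieDer (N, 0) F = scale (fun w => (w : ℂ)) F := by
  funext x
  simp only [Pi.sub_apply, Pi.smul_apply, smul_eq_mul, lieDer_L_apply, lieDer_N_apply, scale_apply,
    Int.cast_sum, ← annCoeff_weight, Finset.sum_add_distrib, Finset.sum_neg_distrib,
    ← Finset.mul_sum]
  ring

/-- A cocycle is the sum of its component of weight zero and a coboundary. -/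
theorem eq_scale_add_ce {n : ℕ} {F : (Fin (n + 1) → Gen × ℕ) → ℂ}
    (hF : F ∈ alternating (Gen × ℕ) (n + 1)) (hd : ann.ce (n + 1) F = 0) :
    F = scale (fun w => if w = 0 then 1 else 0) F +
      ann.ce n (contract (L, 1) (scale (fun w => (w : ℂ)⁻¹) F) -
        (5 / 2 : ℂ) • contract (N, 0) (scale (fun w => (w : ℂ)⁻¹) F)) := by
  -- Dividing by the weight inverts the Lie derivative away from weight zero. The convention 0⁻¹ = 0
  -- discards the part of weight zero.
  have hG := scale_mem (fun w => (w : ℂ)⁻¹) hF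
  have hdG : ann.ce (n + 1) (scale (fun w => (w : ℂ)⁻¹) F) = 0 := by
    rw [ce_scale, hd, map_zero]
  have h1 := ann.contract_ce hG (L, 1)
  have h2 := ann.contract_ce hG (N, 0)
  rw [hdG, map_zero, eq_comm, sub_eq_zero, eq_comm] at h1 h2
  rw [map_sub, map_smul, h1, h2, lieDer_sub_smul_lieDer]
  funext x
  simp only [Pi.add_apply, scale_apply]
  by_cases h : ∑ i, weight (x i) = 0
  · simp [h]
  · simp only [h, if_false]
    rw [mul_inv_cancel_left₀ (Int.cast_ne_zero.mpr h)]
    ring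

end ExtendedSV

/-! ### Taylor coefficients and substitutions -/

namespace MvPolynomial

/-- The value at `0` of the iterated partial derivative of multi-order `κ`. -/
def taylor {n : ℕ} (κ : Fin n → ℕ) : MvPolynomial (Fin n) ℂ →ₗ[ℂ] ℂ where
  toFun p := (∏ i, ((κ i).factorial : ℂ)) * coeff (Finsupp.equivFunOnFinite.symm κ) p
  map_add' p q := by simp [mul_add]
  map_smul' r p := by simp; ring

theorem taylor_apply {n : ℕ} (κ : Fin n → ℕ) (p : MvPolynomial (Fin n) ℂ) :
    taylor κ p = (∏ i, ((κ i).factorial : ℂ)) * coeff (Finsupp.equivFunOnFinite.symm κ) p := rfl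

theorem taylor_ext {n : ℕ} {p q : MvPolynomial (Fin n) ℂ} (h : ∀ κ, taylor κ p = taylor κ q) :
    p = q := by
  ext m
  have := h m
  rw [taylor_apply, taylor_apply] at this
  have e : Finsupp.equivFunOnFinite.symm (m : Fin n → ℕ) = m := by ext; simp
  rw [e] at this
  refine mul_left_cancel₀ (Finset.prod_ne_zero_iff.mpr fun i _ => ?_) this
  exact_mod_cast Nat.factorial_ne_zero _

theorem taylor_monomial {n : ℕ} (κ : Fin n → ℕ) (m : Fin n → ℕ) (r : ℂ) :
    taylor κ (monomial (Finsupp.equivFunOnFinite.symm m) r) =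
      if m = κ then (∏ i, ((κ i).factorial : ℂ)) * r else 0 := by
  rw [taylor_apply, coeff_monomial]
  simp only [EmbeddingLike.apply_eq_iff_eq]
  split_ifs <;> simp

theorem taylor_C {n : ℕ} (κ : Fin n → ℕ) (r : ℂ) :
    taylor κ (C r) = if κ = 0 then r else 0 := by
  have := taylor_monomial κ 0 r
  rw [show Finsupp.equivFunOnFinite.symm (0 : Fin n → ℕ) = 0 by ext; simp] at this
  rw [← monomial_zero', this]
  by_cases h : κ = 0
  · simp [h]
  · simp [h, Ne.symm h]

/-- Leibniz rule at the origin. If κ i = 0, the factor κ i makes the truncated κ i - 1 irrelevant.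
-/
theorem taylor_X_mul {n : ℕ} (κ : Fin n → ℕ) (i : Fin n) (p : MvPolynomial (Fin n) ℂ) :
    taylor κ (X i * p) = κ i * taylor (Function.update κ i (κ i - 1)) p := by
  rw [taylor_apply, taylor_apply, coeff_X_mul']
  simp only [Finsupp.mem_support_iff, Finsupp.equivFunOnFinite_symm_apply_apply]
  rcases hk : κ i with _ | k
  · simp
  · rw [if_pos (by simp)]
    have e : Finsupp.equivFunOnFinite.symm κ - Finsupp.single i 1 =
        Finsupp.equivFunOnFinite.symm (Function.update κ i k) := by
      ext l
      by_cases hl : l = i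
      · subst hl; simp [hk]
      · simp [hl]
    rw [e, Nat.add_sub_cancel, ← mul_assoc]
    congr 1
    rw [← Finset.mul_prod_erase _ _ (Finset.mem_univ i),
      ← Finset.mul_prod_erase _ _ (Finset.mem_univ i), hk, Function.update_self,
      Nat.factorial_succ]
    push_cast
    rw [mul_assoc]
    congr 2
    refine Finset.prod_congr rfl fun l hl => ?_
    rw [Function.update_of_ne (Finset.ne_of_mem_erase hl)]

/-- Taylor coefficients after the substitution that replaces the variables by sums over disjoint
sets of variables. -/
theorem taylor_aeval_sum {m n : ℕ} (s : Fin m → Finset (Fin n))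
    (hd : ∀ i l l', i ∈ s l → i ∈ s l' → l = l') (hc : ∀ i, ∃ l, i ∈ s l)
    (p : MvPolynomial (Fin m) ℂ) (κ : Fin n → ℕ) :
    taylor κ (aeval (fun l => ∑ i ∈ s l, (X i : MvPolynomial (Fin n) ℂ)) p) =
      taylor (fun l => ∑ i ∈ s l, κ i) p := by
  induction p using MvPolynomial.induction_on generalizing κ with
  | C r =>
    rw [aeval_C, algebraMap_eq, taylor_C, taylor_C]
    -- Constants use that every variable lies in some block: otherwise κ could be nonzero with all
    -- block sums zero.
    have e : κ = 0 ↔ (fun l => ∑ i ∈ s l, κ i) = 0 := by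
      refine ⟨fun h => _root_.funext fun l => by simp [h], fun h => _root_.funext fun i => ?_⟩
      obtain ⟨l, hl⟩ := hc i
      exact Finset.sum_eq_zero_iff.mp (congrFun h l) i hl
    simp only [e]
  | add p q hp hq => simp only [map_add, hp, hq]
  | mul_X p l hp =>
    rw [map_mul, aeval_X, mul_comm, mul_comm p, taylor_X_mul, Finset.sum_mul, map_sum,
      Nat.cast_sum, Finset.sum_mul]
    refine Finset.sum_congr rfl fun i hi => ?_
    rw [taylor_X_mul, hp]
    by_cases h0 : κ i = 0
    · simp [h0]
    congr 3
    funext l'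
    by_cases hl : l' = l
    -- A derivative in any variable of the block s l acts as a derivative in slot l, so lowering κ i
    -- lowers the block sum by one.
    · subst hl
      rw [Function.update_self, Finset.sum_update_of_mem hi,
        ← Finset.add_sum_erase _ _ hi, Finset.sdiff_singleton_eq_erase]
      omega
    · rw [Function.update_of_ne hl]
      refine Finset.sum_congr rfl fun k hk => ?_
      rw [Function.update_of_ne]
      rintro rfl
      exact hl (hd _ _ _ hk hi)

theorem taylor_rename {n : ℕ} (σ : Equiv.Perm (Fin n)) (p : MvPolynomial (Fin n) ℂ)
    (κ : Fin n → ℕ) : taylor κ (rename σ p) = taylor (κ ∘ σ) p := by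
  have := taylor_aeval_sum (fun l => {σ l}) (by simp +contextual) (fun i => ⟨σ.symm i, by simp⟩) p κ
  simp only [Finset.sum_singleton] at this
  rw [← aeval_X_left_apply (rename σ p), aeval_rename]
  exact this

end MvPolynomial

namespace LieConformal

theorem skip_cases {m : ℕ} (i : Fin (m + 1)) (j l : Fin (m + 2)) (hij : i.castSucc < j) :
    l = i.castSucc ∨ l = j ∨ ∃ k, l = skip i j k := by
  rcases Fin.eq_self_or_eq_succAbove j l with h | ⟨k, rfl⟩
  · exact Or.inr (Or.inl h)
  · rcases Fin.eq_self_or_eq_succAbove i k with h | ⟨k, rfl⟩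
    · exact Or.inl (by rw [h, Fin.succAbove_of_castSucc_lt _ _ hij])
    · exact Or.inr (Or.inr ⟨k, rfl⟩)

theorem skip_injective {m : ℕ} (i : Fin (m + 1)) (j : Fin (m + 2)) :
    Function.Injective (skip i j) :=
  (Fin.succAbove_right_injective).comp Fin.succAbove_right_injective

theorem skip_ne_right {m : ℕ} (i : Fin (m + 1)) (j : Fin (m + 2)) (k : Fin m) : skip i j k ≠ j :=
  Fin.succAbove_ne _ _

theorem skip_ne_left {m : ℕ} {i : Fin (m + 1)} {j : Fin (m + 2)} (hij : i.castSucc < j)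
    (k : Fin m) : skip i j k ≠ i.castSucc := by
  rw [← Fin.succAbove_of_castSucc_lt _ _ hij]
  exact fun h => Fin.succAbove_ne _ _ (Fin.succAbove_right_injective h)

end LieConformal

namespace MvPolynomial

open LieConformal

theorem taylor_aeval_skip {m : ℕ} {i : Fin (m + 1)} {j : Fin (m + 2)} (hij : i.castSucc < j)
    (p : MvPolynomial (Fin (m + 1)) ℂ) (κ : Fin (m + 2) → ℕ) :
    taylor κ (aeval (Fin.cons (X i.castSucc + X j) (fun l => X (skip i j l)) :
      Fin (m + 1) → MvPolynomial (Fin (m + 2)) ℂ) p) =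
      taylor (vecCons (κ i.castSucc + κ j) fun l => κ (skip i j l)) p := by
  have h := taylor_aeval_sum
    (vecCons {i.castSucc, j} (fun l => {skip i j l}) : Fin (m + 1) → Finset (Fin (m + 2)))
    ?_ ?_ p κ
  · have e : ∀ {R : Type} [AddCommMonoid R] (f : Fin (m + 2) → R),
        (Fin.cons (f i.castSucc + f j) fun l => f (skip i j l)) = fun l : Fin (m + 1) =>
          ∑ k ∈ (vecCons {i.castSucc, j} (fun l => {skip i j l}) :
            Fin (m + 1) → Finset (Fin (m + 2))) l, f k := by
      intro R _ f
      funext l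
      refine Fin.cases ?_ (fun k => ?_) l <;> simp [Finset.sum_pair hij.ne]
    rw [e, h, ← e]
    rfl
  · intro l
    refine Fin.cases (Fin.cases (fun _ _ => rfl) fun k => ?_)
      (fun k => Fin.cases ?_ fun k' => ?_)
    · simp only [Matrix.cons_val_zero, Matrix.cons_val_succ, Finset.mem_insert,
        Finset.mem_singleton]
      rintro (rfl | rfl) h
      · exact absurd h.symm (skip_ne_left hij k)
      · exact absurd h.symm (skip_ne_right i _ k)
    · simp only [Matrix.cons_val_zero, Matrix.cons_val_succ, Finset.mem_insert,
        Finset.mem_singleton]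
      rintro h (rfl | rfl)
      · exact absurd h.symm (skip_ne_left hij k)
      · exact absurd h.symm (skip_ne_right i _ k)
    · simp only [Matrix.cons_val_succ, Finset.mem_singleton]
      rintro rfl h
      rw [skip_injective i j h]
  · intro l
    rcases skip_cases i j l hij with rfl | rfl | ⟨k, rfl⟩
    · exact ⟨0, by simp⟩
    · exact ⟨0, by simp⟩
    · exact ⟨k.succ, by simp⟩

/-- Substituting 0 for the last variable is substituting the sum over the empty block. -/
theorem taylor_aeval_snoc {q : ℕ} (p : MvPolynomial (Fin (q + 1)) ℂ) (κ : Fin q → ℕ) :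
    taylor κ (aeval (Fin.snoc (fun i => X i) 0 : Fin (q + 1) → MvPolynomial (Fin q) ℂ) p) =
      taylor (Fin.snoc κ 0 : Fin (q + 1) → ℕ) p := by
  have h := taylor_aeval_sum
    (Fin.snoc (fun i => {i}) ∅ : Fin (q + 1) → Finset (Fin q)) ?_ ?_ p κ
  · have e : ∀ {R : Type} [AddCommMonoid R] (f : Fin q → R),
        (Fin.snoc f 0 : Fin (q + 1) → R) = fun l =>
          ∑ k ∈ (Fin.snoc (fun i => {i}) ∅ : Fin (q + 1) → Finset (Fin q)) l, f k := by
      intro R _ f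
      funext l
      refine Fin.lastCases ?_ (fun k => ?_) l <;> simp
    rw [e, h, ← e]
  · intro l
    refine Fin.lastCases (by simp) (fun k => Fin.lastCases (by simp) fun k' => ?_)
    simp +contextual
  · exact fun i => ⟨i.castSucc, by simp⟩

theorem taylor_aeval_snoc_pderiv {q : ℕ} (p : MvPolynomial (Fin (q + 1)) ℂ) (κ : Fin q → ℕ) :
    taylor κ (aeval (Fin.snoc (fun i => X i) 0 : Fin (q + 1) → MvPolynomial (Fin q) ℂ)
        (pderiv (Fin.last q) p)) =
      taylor (Fin.snoc κ 1 : Fin (q + 1) → ℕ) p := by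
  rw [taylor_aeval_snoc]
  induction p using MvPolynomial.induction_on generalizing κ with
  | C r =>
    rw [pderiv_C, map_zero, taylor_C, if_neg]
    intro h
    simpa using congrFun h (Fin.last q)
  | add p q hp hq => simp only [map_add, hp, hq]
  | mul_X p l hp =>
    rw [mul_comm p, Derivation.leibniz, map_add, smul_eq_mul, smul_eq_mul, taylor_X_mul,
      taylor_X_mul]
    refine Fin.lastCases ?_ (fun k => ?_) l
    · have e : Function.update (Fin.snoc κ 1 : Fin (q + 1) → ℕ) (Fin.last q) 0 = Fin.snoc κ 0 := by
        rw [Fin.update_snoc_last]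
      simp [e]
    · rw [pderiv_X_of_ne (Fin.castSucc_lt_last k).ne, mul_zero, map_zero, add_zero]
      simp only [Fin.snoc_castSucc, ← Fin.snoc_update]
      rw [hp]

end MvPolynomial

/-! ### Expansion of λ-brackets on generators -/

namespace ExtendedSV

open Gen MonomialLie LieConformal

section Expansion

variable {Q : Type*} [CommRing Q] [Algebra ℂ Q]

/-- A linear map on which `∂` acts as `-t` is determined by its values on the generators. -/
theorem linear_expansion (φ : Carrier →ₗ[ℂ] Q) (t : Q) (hφ : ∀ c, φ (delEnd c) = -(t * φ c))
    (c : Carrier) : φ c = ∑ m, aeval (-t) (c m) * φ (gen m) := by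
  have key : ∀ (m : Gen) (f : ℂ[X]), φ (Pi.single m f) = aeval (-t) f * φ (gen m) := by
    intro m f
    induction f using Polynomial.induction_on' with
    | add f g hf hg => rw [Pi.single_add, map_add, hf, hg, map_add, add_mul]
    | monomial n r =>
      induction n with
      | zero =>
        have e : (Pi.single m (monomial 0 r) : Carrier) = r • gen m := by
          rw [gen, ← Pi.single_smul, smul_eq_C_mul, mul_one, monomial_zero_left]
        rw [e, map_smul, monomial_zero_left, aeval_C, Algebra.smul_def]
      | succ n ih =>
        have e : (Pi.single m (monomial (n + 1) r) : Carrier) =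
            delEnd (Pi.single m (monomial n r)) := by
          funext k
          by_cases hk : k = m
          · subst hk
            simp [delEnd, X_mul_monomial]
          · simp [delEnd, hk]
        rw [e, hφ, ih, ← X_mul_monomial, map_mul, aeval_X]
        ring
  conv_lhs => rw [← Finset.univ_sum_single c]
  rw [map_sum]
  exact Finset.sum_congr rfl fun m _ => key m _

/-- The value of `brGen g h m` at `λ = u`, `∂ = -u - v`. -/
def brVal (g h m : Gen) (u v : Q) : Q :=
  eval₂ (aeval (-(u + v))).toRingHom u (brGen g h m)

/-- The left side is φ([a_λ b]) at λ = u. Since φ turns ∂ into -(u+v), the factors f(-λ) and h(∂+λ)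
coming from sesquilinearity become f(-u) and h(-v). -/
theorem sum_svBracket (φ : Carrier →ₗ[ℂ] Q) (u v : Q)
    (hφ : ∀ c, φ (delEnd c) = -((u + v) * φ c)) (a b : Carrier) :
    ((svBracket a b).sum fun k c => u ^ k * φ c) =
      ∑ m, (∑ g, ∑ h, aeval (-u) (a g) * aeval (-v) (b h) * brVal g h m u v) * φ (gen m) := by
  have h1 : ∀ p : Gen → ℂ[X][X], ((lambdaCoeffs p).sum fun k c => u ^ k * φ c) =
      ∑ m, eval₂ (aeval (-(u + v))).toRingHom u (p m) * φ (gen m) := by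
    intro p
    rw [lambdaCoeffs, Finsupp.onFinset_sum _ (fun k => by rw [map_zero, mul_zero])]
    refine (Finset.sum_congr rfl fun k _ => by
      rw [linear_expansion φ (u + v) hφ, Finset.mul_sum]).trans ?_
    rw [Finset.sum_comm]
    refine Finset.sum_congr rfl fun m _ => ?_
    rw [eval₂_eq_sum, Polynomial.sum, Finset.sum_mul]
    symm
    refine (Finset.sum_subset (Finset.subset_biUnion_of_mem (fun m => (p m).support)
      (Finset.mem_univ m)) ?_).trans (Finset.sum_congr rfl fun k _ => ?_)
    · intro k _ hk
      rw [notMem_support_iff.mp hk]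
      simp
    · simp only [AlgHom.toRingHom_eq_coe, RingHom.coe_coe]
      ring
  have h2 : ∀ (f : ℂ[X]) (p : ℂ[X][X]),
      eval₂ (aeval (-(u + v))).toRingHom u (eval₂ (C.comp C) p f) =
        aeval (eval₂ (aeval (-(u + v))).toRingHom u p) f := by
    intro f p
    induction f using Polynomial.induction_on' with
    | add f g hf hg => simp only [eval₂_add, map_add, hf, hg]
    | monomial n r =>
      rw [eval₂_monomial, eval₂_mul, eval₂_pow, aeval_monomial]
      simp
  rw [svBracket, LinearMap.mk₂_apply, h1]
  refine Finset.sum_congr rfl fun m _ => ?_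
  congr 1
  rw [bracketPoly, eval₂_finsetSum]
  refine Finset.sum_congr rfl fun g _ => ?_
  rw [eval₂_finsetSum]
  refine Finset.sum_congr rfl fun h _ => ?_
  rw [eval₂_mul, eval₂_mul, h2, h2, brVal]
  simp

/-- The polynomial in `u = λ_i`, `v = λ_j` whose Taylor coefficients are the structure constants. -/
def brLin : Gen → Gen → Q → Q → Q
  | L, L, u, v => u - v
  | L, Y, u, v => algebraMap ℂ Q (1 / 2) * u - v
  | Y, L, u, v => u - algebraMap ℂ Q (1 / 2) * v
  | Y, Y, u, v => u - v
  | L, M, _, v => -v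
  | M, L, u, _ => u
  | L, N, _, v => -v
  | N, L, u, _ => u
  | N, Y, _, _ => 1
  | Y, N, _, _ => -1
  | N, M, _, _ => 2
  | M, N, _, _ => -2
  | _, _, _, _ => 0

/-- At λ = u, ∂ = -(u+v) one finds ∂+2λ = u-v, ∂+λ = -v, ∂+3λ/2 = u/2-v and ∂/2+3λ/2 = u-v/2. -/
theorem brVal_eq (g h m : Gen) (u v : Q) :
    brVal g h m u v = if m = genMul g h then brLin g h u v else 0 := by
  have h3 : algebraMap ℂ Q (3 / 2) = 1 + algebraMap ℂ Q (1 / 2) := by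
    rw [← map_one (algebraMap ℂ Q), ← map_add]
    norm_num
  cases g <;> cases h <;> cases m <;>
    simp [brVal, brGen, genMul, brLin, eval₂_add, eval₂_mul, -one_div, -map_div₀,
      -map_inv₀, eval₂_ofNat, h3] <;>
    ring

end Expansion

/-! ### Sesquilinear cochains -/

/-- The maps that are multilinear and conformally antilinear in each argument. -/
def sesquilinear (n : ℕ) : Submodule ℂ (PreCochain Carrier n) where
  carrier := {γ |
    (∀ (a : Fin n → Carrier) (i : Fin n) (x y : Carrier),
      γ (Function.update a i (x + y)) =
        γ (Function.update a i x) + γ (Function.update a i y)) ∧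
    (∀ (a : Fin n → Carrier) (i : Fin n) (c : ℂ) (x : Carrier),
      γ (Function.update a i (c • x)) = c • γ (Function.update a i x)) ∧
    (∀ (a : Fin n → Carrier) (i : Fin n),
      γ (Function.update a i (delEnd (a i))) = -(MvPolynomial.X i * γ a))}
  add_mem' := by
    rintro γ η ⟨h1, h2, h3⟩ ⟨k1, k2, k3⟩
    refine ⟨fun a i x y => ?_, fun a i c x => ?_, fun a i => ?_⟩
    · simp only [Pi.add_apply, h1, k1]; abel
    · simp only [Pi.add_apply, h2, k2, smul_add]
    · simp only [Pi.add_apply, h3, k3]; ring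
  zero_mem' := by
    refine ⟨fun a i x y => ?_, fun a i c x => ?_, fun a i => ?_⟩ <;> simp
  smul_mem' := by
    rintro r γ ⟨h1, h2, h3⟩
    refine ⟨fun a i x y => ?_, fun a i c x => ?_, fun a i => ?_⟩
    · simp only [Pi.smul_apply, h1, smul_add]
    · simp only [Pi.smul_apply, h2, smul_comm r c]
    · simp only [Pi.smul_apply, h3, smul_neg, mul_smul_comm]

theorem mem_cochains_iff {n : ℕ} {γ : PreCochain Carrier n} :
    γ ∈ cochains extendedSV n ↔ γ ∈ sesquilinear n ∧
      ∀ (σ : Equiv.Perm (Fin n)) (a : Fin n → Carrier),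
        MvPolynomial.rename σ (γ (a ∘ σ)) = (Equiv.Perm.sign σ : ℤ) • γ a :=
  ⟨fun h => ⟨⟨h.1, h.2.1, h.2.2.1⟩, h.2.2.2⟩, fun h => ⟨h.1.1, h.1.2.1, h.1.2.2, h.2⟩⟩

theorem cochains_le_sesquilinear (n : ℕ) : cochains extendedSV n ≤ sesquilinear n :=
  fun _ h => (mem_cochains_iff.mp h).1

/-- A sesquilinear map as a linear function of its `i`-th argument. -/
def sesquilinearArg {n : ℕ} {γ : PreCochain Carrier n} (hγ : γ ∈ sesquilinear n)
    (a : Fin n → Carrier) (i : Fin n) : Carrier →ₗ[ℂ] MvPolynomial (Fin n) ℂ where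
  toFun x := γ (Function.update a i x)
  map_add' := hγ.1 a i
  map_smul' := hγ.2.1 a i

theorem sesquilinearArg_delEnd {n : ℕ} {γ : PreCochain Carrier n} (hγ : γ ∈ sesquilinear n)
    (a : Fin n → Carrier) (i : Fin n) (c : Carrier) :
    sesquilinearArg hγ a i (delEnd c) = -(MvPolynomial.X i * sesquilinearArg hγ a i c) := by
  have h := hγ.2.2 (Function.update a i c) i
  rw [Function.update_self, Function.update_idem] at h
  exact h

/-- A sesquilinear map that vanishes on generators is zero. -/
theorem sesquilinear_eq_zero {n : ℕ} {γ : PreCochain Carrier n} (hγ : γ ∈ sesquilinear n)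
    (h0 : ∀ h : Fin n → Gen, γ (fun i => gen (h i)) = 0) : γ = 0 := by
  have key : ∀ (s : Finset (Fin n)) (a : Fin n → Carrier),
      (∀ i ∉ s, ∃ g, a i = gen g) → γ a = 0 := by
    intro s
    induction s using Finset.induction_on with
    | empty =>
      intro a ha
      choose h hh using fun i => ha i (Finset.notMem_empty i)
      rw [funext hh]
      exact h0 h
    | insert i s _ ih =>
      intro a ha
      have e : γ a = sesquilinearArg hγ a i (a i) := by
        simp [sesquilinearArg]
      rw [e, linear_expansion _ _ (sesquilinearArg_delEnd hγ a i)]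
      refine Finset.sum_eq_zero fun m _ => ?_
      have : sesquilinearArg hγ a i (gen m) = 0 := by
        refine ih _ fun k hk => ?_
        by_cases hki : k = i
        · subst hki
          exact ⟨m, by simp⟩
        · rw [Function.update_of_ne hki]
          exact ha k (by simp [hki, hk])
      rw [this, mul_zero]
  funext a
  exact key Finset.univ a (by simp)

theorem sesquilinear_ext {n : ℕ} {γ η : PreCochain Carrier n} (hγ : γ ∈ sesquilinear n)
    (hη : η ∈ sesquilinear n)
    (h0 : ∀ h : Fin n → Gen, γ (fun i => gen (h i)) = η (fun i => gen (h i))) : γ = η := by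
  rw [← sub_eq_zero]
  exact sesquilinear_eq_zero (Submodule.sub_mem _ hγ hη) fun h => by
    rw [Pi.sub_apply, h0, sub_self]

/-! ### The differential on sesquilinear cochains -/

/-- The substitution `λ ↦ (λ_i + λ_j, λ_1, …, λ̂_i, …, λ̂_j, …)`. -/
def substSkip {m : ℕ} (i : Fin (m + 1)) (j : Fin (m + 2)) :
    MvPolynomial (Fin (m + 1)) ℂ →ₐ[ℂ] MvPolynomial (Fin (m + 2)) ℂ :=
  MvPolynomial.aeval (Fin.cons (MvPolynomial.X i.castSucc + MvPolynomial.X j)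
    (fun l => MvPolynomial.X (skip i j l)))

/-- The first slot of γ carries the variable λ_i + λ_j after substitution, so ∂ acts there by -(λ_i
+ λ_j) and `sum_svBracket` applies with u = λ_i, v = λ_j. -/
theorem bracketTerm_eq {m : ℕ} {γ : PreCochain Carrier (m + 1)} (hγ : γ ∈ sesquilinear (m + 1))
    (a : Fin (m + 2) → Carrier) (i : Fin (m + 1)) (j : Fin (m + 2)) :
    bracketTerm extendedSV γ a i j =
      ∑ k, (∑ g, ∑ h, aeval (-MvPolynomial.X i.castSucc : MvPolynomial (Fin (m + 2)) ℂ)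
          (a i.castSucc g) * aeval (-MvPolynomial.X j : MvPolynomial (Fin (m + 2)) ℂ) (a j h) *
          brVal g h k (MvPolynomial.X i.castSucc) (MvPolynomial.X j)) *
        substSkip i j (γ (vecCons (gen k) fun l => a (skip i j l))) := by
  have e : ∀ x, Function.update (vecCons 0 fun l => a (skip i j l)) 0 x =
      vecCons x fun l => a (skip i j l) :=
    fun x => Fin.update_cons_zero (α := fun _ => Carrier) _ _ _
  have h := sum_svBracket ((substSkip i j).toLinearMap.comp
    (sesquilinearArg hγ (vecCons 0 fun l => a (skip i j l)) 0))
    (MvPolynomial.X i.castSucc) (MvPolynomial.X j) ?_ (a i.castSucc) (a j)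
  · simp only [LinearMap.comp_apply, AlgHom.toLinearMap_apply, sesquilinearArg, LinearMap.coe_mk,
      AddHom.coe_mk, e] at h
    exact h
  · intro c
    rw [LinearMap.comp_apply, sesquilinearArg_delEnd, map_neg, AlgHom.toLinearMap_apply, map_mul]
    congr 2
    simp [substSkip]

/-- Since i < j, the indices i, j and `skip i j k` are distinct and exhaust all slots. In slots i
and j sesquilinearity is read off the expansion over generators; in the remaining ones it is
inherited from γ. -/
theorem bracketTerm_mem {m : ℕ} {γ : PreCochain Carrier (m + 1)} (hγ : γ ∈ sesquilinear (m + 1))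
    {i : Fin (m + 1)} {j : Fin (m + 2)} (hij : i.castSucc < j) :
    (fun a => bracketTerm extendedSV γ a i j) ∈ sesquilinear (m + 2) := by
  have hj : ∀ k, j ≠ skip i j k := fun k => (skip_ne_right i j k).symm
  have hi : ∀ k, i.castSucc ≠ skip i j k := fun k => (skip_ne_left hij k).symm
  have hs : ∀ (a : Fin (m + 2) → Carrier) (k : Fin m) (x y : Carrier),
      (vecCons y fun l => Function.update a (skip i j k) x (skip i j l)) =
        Function.update (vecCons y fun l => a (skip i j l)) k.succ x := by
    intro a k x y
    change vecCons y (Function.update a (skip i j k) x ∘ skip i j) = _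
    rw [Function.update_comp_eq_of_injective a (skip_injective i j)]
    exact Fin.cons_update (α := fun _ => Carrier) _ _ _ _
  refine ⟨fun a l x y => ?_, fun a l c x => ?_, fun a l => ?_⟩
  · simp only [bracketTerm_eq hγ]
    rcases skip_cases i j l hij with rfl | rfl | ⟨k, rfl⟩
    · simp only [Function.update_self, Function.update_of_ne hij.ne',
        Function.update_of_ne (hi _).symm, Pi.add_apply, map_add, add_mul, Finset.sum_add_distrib]
    · simp only [Function.update_self, Function.update_of_ne hij.ne,
        Function.update_of_ne (hj _).symm, Pi.add_apply, map_add, add_mul, mul_add,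
        Finset.sum_add_distrib]
    · simp only [Function.update_of_ne (hi k), Function.update_of_ne (hj k), hs, hγ.1, map_add,
        mul_add, Finset.sum_add_distrib]
  · simp only [bracketTerm_eq hγ]
    rcases skip_cases i j l hij with rfl | rfl | ⟨k, rfl⟩
    · simp only [Function.update_self, Function.update_of_ne hij.ne',
        Function.update_of_ne (hi _).symm, Pi.smul_apply, map_smul, smul_mul_assoc,
        ← Finset.smul_sum]
    · simp only [Function.update_self, Function.update_of_ne hij.ne,
        Function.update_of_ne (hj _).symm, Pi.smul_apply, map_smul, smul_mul_assoc, mul_smul_comm,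
        ← Finset.smul_sum]
    · simp only [Function.update_of_ne (hi k), Function.update_of_ne (hj k), hs, hγ.2.1, map_smul,
        mul_smul_comm, Finset.smul_sum]
  · simp only [bracketTerm_eq hγ]
    rcases skip_cases i j l hij with rfl | rfl | ⟨k, rfl⟩
    · simp only [Function.update_self, Function.update_of_ne hij.ne',
        Function.update_of_ne (hi _).symm, delEnd, LinearMap.coe_mk, AddHom.coe_mk, map_mul,
        aeval_X, Finset.mul_sum, Finset.sum_mul, ← Finset.sum_neg_distrib]
      refine Finset.sum_congr rfl fun _ _ => Finset.sum_congr rfl fun _ _ =>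
        Finset.sum_congr rfl fun _ _ => ?_
      ring
    · simp only [Function.update_self, Function.update_of_ne hij.ne,
        Function.update_of_ne (hj _).symm, delEnd, LinearMap.coe_mk, AddHom.coe_mk, map_mul,
        aeval_X, Finset.mul_sum, Finset.sum_mul, ← Finset.sum_neg_distrib]
      refine Finset.sum_congr rfl fun _ _ => Finset.sum_congr rfl fun _ _ =>
        Finset.sum_congr rfl fun _ _ => ?_
      ring
    · have h3 : ∀ y : Carrier, γ (Function.update (vecCons y fun l => a (skip i j l)) k.succ
          (delEnd (a (skip i j k)))) =
          -(MvPolynomial.X k.succ * γ (vecCons y fun l => a (skip i j l))) := fun y =>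
        hγ.2.2 (vecCons y fun l => a (skip i j l)) k.succ
      have h4 : substSkip i j (MvPolynomial.X k.succ) = MvPolynomial.X (skip i j k) := by
        simp [substSkip]
      simp only [Function.update_of_ne (hi k), Function.update_of_ne (hj k), hs, h3, map_neg,
        map_mul, h4, Finset.mul_sum, ← Finset.sum_neg_distrib]
      refine Finset.sum_congr rfl fun _ _ => ?_
      ring

theorem d_mem_sesquilinear {n : ℕ} {γ : PreCochain Carrier n} (hγ : γ ∈ sesquilinear n) :
    d extendedSV n γ ∈ sesquilinear (n + 1) := by
  cases n with
  | zero => exact Submodule.zero_mem _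
  | succ m =>
    have e : d extendedSV (m + 1) γ = ∑ j : Fin (m + 2), ∑ i : Fin (m + 1),
        if i.castSucc < j then
          ((-1 : ℂ) ^ ((i : ℕ) + (j : ℕ))) • (fun a => bracketTerm extendedSV γ a i j) else 0 := by
      funext a
      simp only [d, LinearMap.coe_mk, AddHom.coe_mk, Finset.sum_apply]
      refine Finset.sum_congr rfl fun j _ => Finset.sum_congr rfl fun i _ => ?_
      split_ifs
      · rw [Pi.smul_apply, MvPolynomial.smul_eq_C_mul]
        simp
      · rfl
    rw [e]
    refine Submodule.sum_mem _ fun j _ => Submodule.sum_mem _ fun i _ => ?_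
    split_ifs with hij
    · exact Submodule.smul_mem _ _ (bracketTerm_mem hγ hij)
    · exact Submodule.zero_mem _

/-! ### Taylor coefficients of cochains -/

/-- The Taylor coefficients of the values of a cochain on generators. -/
def coeffs (n : ℕ) : PreCochain Carrier n →ₗ[ℂ] ((Fin n → Gen × ℕ) → ℂ) where
  toFun γ x := MvPolynomial.taylor (fun i => (x i).2) (γ fun i => gen (x i).1)
  map_add' γ η := by funext x; simp
  map_smul' r γ := by funext x; simp

theorem coeffs_apply {n : ℕ} (γ : PreCochain Carrier n) (x : Fin n → Gen × ℕ) :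
    coeffs n γ x = MvPolynomial.taylor (fun i => (x i).2) (γ fun i => gen (x i).1) := rfl

theorem coeffs_injOn {n : ℕ} {γ η : PreCochain Carrier n} (hγ : γ ∈ sesquilinear n)
    (hη : η ∈ sesquilinear n) (h : coeffs n γ = coeffs n η) : γ = η :=
  sesquilinear_ext hγ hη fun g => MvPolynomial.taylor_ext fun κ =>
    congrFun h fun i => (g i, κ i)

theorem coeffs_mem {n : ℕ} {γ : PreCochain Carrier n} (hγ : γ ∈ cochains extendedSV n) :
    coeffs n γ ∈ alternating (Gen × ℕ) n := by
  intro σ x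
  have h := congrArg (MvPolynomial.taylor fun i => (x i).2)
    ((mem_cochains_iff.mp hγ).2 σ fun i => gen (x i).1)
  rw [MvPolynomial.taylor_rename, map_zsmul, zsmul_eq_mul] at h
  exact h

theorem aeval_gen {Q : Type*} [CommRing Q] [Algebra ℂ Q] (t : Q) (g h : Gen) :
    aeval t (gen g h) = if h = g then 1 else 0 := by
  by_cases e : h = g
  · subst e
    simp [gen]
  · simp [gen, e]

/-- The substitution λ_i + λ_j adds the two indices. A factor λ_i or λ_j first lowers its own index
and multiplies by it, so the merged index is κ_i + κ_j - 1, whichever factor is used. Linear forms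
such as u - v thus become constants such as κ_i - κ_j. -/
theorem taylor_brLin {m : ℕ} {i : Fin (m + 1)} {j : Fin (m + 2)} (hij : i.castSucc < j)
    (p : MvPolynomial (Fin (m + 1)) ℂ) (g h : Gen) (κ : Fin (m + 2) → ℕ) :
    MvPolynomial.taylor κ
        (brLin g h (MvPolynomial.X i.castSucc) (MvPolynomial.X j) * substSkip i j p) =
      annCoeff (g, κ i.castSucc) (h, κ j) *
        MvPolynomial.taylor (vecCons (κ i.castSucc + κ j - genLoss g h)
          fun l => κ (skip i j l)) p := by
  have h0 : MvPolynomial.taylor κ (substSkip i j p) =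
      MvPolynomial.taylor (vecCons (κ i.castSucc + κ j) fun l => κ (skip i j l)) p :=
    MvPolynomial.taylor_aeval_skip hij p κ
  have hu : MvPolynomial.taylor κ (MvPolynomial.X i.castSucc * substSkip i j p) =
      κ i.castSucc * MvPolynomial.taylor
        (vecCons (κ i.castSucc + κ j - 1) fun l => κ (skip i j l)) p := by
    rw [MvPolynomial.taylor_X_mul, substSkip, MvPolynomial.taylor_aeval_skip hij]
    simp only [Function.update_self, Function.update_of_ne hij.ne',
      Function.update_of_ne (skip_ne_left hij _)]
    rcases κ i.castSucc with _ | k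
    · simp
    · rw [Nat.add_sub_cancel, show k + 1 + κ j - 1 = k + κ j by omega]
  have hv : MvPolynomial.taylor κ (MvPolynomial.X j * substSkip i j p) =
      κ j * MvPolynomial.taylor
        (vecCons (κ i.castSucc + κ j - 1) fun l => κ (skip i j l)) p := by
    rw [MvPolynomial.taylor_X_mul, substSkip, MvPolynomial.taylor_aeval_skip hij]
    simp only [Function.update_self, Function.update_of_ne hij.ne,
      Function.update_of_ne (skip_ne_right i j _)]
    rcases κ j with _ | k
    · simp
    · rw [Nat.add_sub_cancel, ← add_assoc, Nat.add_sub_cancel]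
  have hr : ∀ (r : ℂ) (q : MvPolynomial (Fin (m + 2)) ℂ),
      MvPolynomial.taylor κ (algebraMap ℂ _ r * q) = r * MvPolynomial.taylor κ q := by
    intro r q
    rw [← Algebra.smul_def, map_smul, smul_eq_mul]
  have h2 : MvPolynomial.taylor κ (2 * substSkip i j p) =
      2 * MvPolynomial.taylor κ (substSkip i j p) := by
    rw [← hr, map_ofNat]
  cases g <;> cases h <;>
    simp only [brLin, annCoeff, genLoss, sub_mul, neg_mul, map_sub, map_neg, mul_assoc, hr, hu, hv,
      h0, h2, one_mul, zero_mul, map_zero, tsub_zero]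

/-- The differential in terms of Taylor coefficients. -/
theorem coeffs_d {n : ℕ} {γ : PreCochain Carrier n} (hγ : γ ∈ sesquilinear n) :
    coeffs (n + 1) (d extendedSV n γ) = ann.ce n (coeffs n γ) := by
  cases n with
  | zero => exact (coeffs 1).map_zero
  | succ m =>
    funext x
    rw [coeffs_apply, ce_succ_apply]
    simp only [d, LinearMap.coe_mk, AddHom.coe_mk, map_sum]
    refine Finset.sum_congr rfl fun j _ => Finset.sum_congr rfl fun i _ => ?_
    split_ifs with hij
    · have hs : ∀ (k : ℕ) (p : MvPolynomial (Fin (m + 2)) ℂ) (κ : Fin (m + 2) → ℕ),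
          MvPolynomial.taylor κ ((-1) ^ k * p) = (-1) ^ k * MvPolynomial.taylor κ p := by
        intro k p κ
        rcases neg_one_pow_eq_or (MvPolynomial (Fin (m + 2)) ℂ) k with h | h <;>
          rcases Nat.even_or_odd k with h' | h' <;> simp [h'.neg_one_pow]
      rw [hs, bracketTerm_eq hγ]
      congr 1
      -- On generators the double sum collapses to one pair, and `brVal_eq` leaves one generator in
      -- the bracket.
      simp only [aeval_gen, mul_ite, ite_mul, zero_mul, one_mul, mul_zero, Finset.sum_ite_eq',
        Finset.mem_univ, if_true]
      simp only [brVal_eq, ite_mul, zero_mul, Finset.sum_ite_eq', Finset.mem_univ, if_true]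
      rw [taylor_brLin hij, coeffs_apply]
      congr 2
      · congr 1
        funext l
        refine Fin.cases ?_ (fun k => ?_) l <;> simp [ann, annMul]
      · congr 1
        funext l
        refine Fin.cases ?_ (fun k => ?_) l <;> simp [ann, annMul]
    · simp

/-- The action of permutations by simultaneous permutation of arguments and variables. -/
def permAct {n : ℕ} (σ : Equiv.Perm (Fin n)) : PreCochain Carrier n →ₗ[ℂ] PreCochain Carrier n where
  toFun γ a := MvPolynomial.rename σ (γ (a ∘ σ))
  map_add' γ η := by funext a; simp
  map_smul' r γ := by funext a; simp

theorem permAct_apply {n : ℕ} (σ : Equiv.Perm (Fin n)) (γ : PreCochain Carrier n)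
    (a : Fin n → Carrier) : permAct σ γ a = MvPolynomial.rename σ (γ (a ∘ σ)) := rfl

theorem permAct_permAct {n : ℕ} (σ τ : Equiv.Perm (Fin n)) (γ : PreCochain Carrier n) :
    permAct σ (permAct τ γ) = permAct (σ * τ) γ := by
  funext a
  simp only [permAct_apply, MvPolynomial.rename_rename, Equiv.Perm.coe_mul, Function.comp_assoc]

theorem permAct_mem {n : ℕ} {γ : PreCochain Carrier n} (hγ : γ ∈ sesquilinear n)
    (σ : Equiv.Perm (Fin n)) : permAct σ γ ∈ sesquilinear n := by
  have hu : ∀ (a : Fin n → Carrier) (i : Fin n) (x : Carrier),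
      Function.update a i x ∘ σ = Function.update (a ∘ σ) (σ.symm i) x := by
    intro a i x
    conv_lhs => rw [← σ.apply_symm_apply i]
    exact Function.update_comp_eq_of_injective a σ.injective _ _
  refine ⟨fun a i x y => ?_, fun a i c x => ?_, fun a i => ?_⟩
  · simp only [permAct_apply, hu, hγ.1, map_add]
  · simp only [permAct_apply, hu, hγ.2.1, map_smul]
  · have := hγ.2.2 (a ∘ σ) (σ.symm i)
    rw [Function.comp_apply, σ.apply_symm_apply] at this
    simp only [permAct_apply, hu, this, map_neg, map_mul, MvPolynomial.rename_X,
      σ.apply_symm_apply]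

theorem mem_cochains_iff_permAct {n : ℕ} {γ : PreCochain Carrier n} :
    γ ∈ cochains extendedSV n ↔ γ ∈ sesquilinear n ∧
      ∀ σ : Equiv.Perm (Fin n), permAct σ γ = (Equiv.Perm.sign σ : ℤ) • γ := by
  rw [mem_cochains_iff]
  exact and_congr_right fun _ => forall_congr' fun σ =>
    ⟨fun h => funext h, fun h a => congrFun h a⟩

/-- Both sides of the symmetry condition are sesquilinear in the arguments, so it suffices to
compare Taylor coefficients on generators. -/
theorem mem_cochains_iff_coeffs {n : ℕ} {γ : PreCochain Carrier n} :
    γ ∈ cochains extendedSV n ↔ γ ∈ sesquilinear n ∧ coeffs n γ ∈ alternating (Gen × ℕ) n := by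
  refine ⟨fun h => ⟨cochains_le_sesquilinear n h, coeffs_mem h⟩, fun ⟨h1, h2⟩ =>
    mem_cochains_iff_permAct.mpr ⟨h1, fun σ => ?_⟩⟩
  refine coeffs_injOn (permAct_mem h1 σ) (zsmul_mem h1 _) (funext fun x => ?_)
  have := h2 σ x
  rw [map_zsmul, Pi.smul_apply, zsmul_eq_mul, ← this, coeffs_apply, permAct_apply,
    MvPolynomial.taylor_rename]
  rfl

theorem d_mem {n : ℕ} {γ : PreCochain Carrier n} (hγ : γ ∈ cochains extendedSV n) :
    d extendedSV n γ ∈ cochains extendedSV (n + 1) := by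
  have h := mem_cochains_iff_coeffs.mp hγ
  refine mem_cochains_iff_coeffs.mpr ⟨d_mem_sesquilinear h.1, ?_⟩
  rw [coeffs_d h.1]
  exact ann.ce_mem h.2

theorem d_d {n : ℕ} {γ : PreCochain Carrier n} (hγ : γ ∈ cochains extendedSV n) :
    d extendedSV (n + 1) (d extendedSV n γ) = 0 := by
  have h := mem_cochains_iff_coeffs.mp hγ
  have h1 := d_mem_sesquilinear h.1
  refine coeffs_injOn (d_mem_sesquilinear h1) (Submodule.zero_mem _) ?_
  rw [coeffs_d h1, coeffs_d h.1, ann.ce_ce h.2, map_zero]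

/-! ### Construction of cochains -/

/-- The sesquilinear map with value `p` on the generators `g` that vanishes on all other tuples of
generators. -/
def elementary {n : ℕ} (g : Fin n → Gen) (p : MvPolynomial (Fin n) ℂ) : PreCochain Carrier n :=
  fun a => p * ∏ i, aeval (-MvPolynomial.X i : MvPolynomial (Fin n) ℂ) (a i (g i))

theorem elementary_mem {n : ℕ} (g : Fin n → Gen) (p : MvPolynomial (Fin n) ℂ) :
    elementary g p ∈ sesquilinear n := by
  have h : ∀ (a : Fin n → Carrier) (i : Fin n) (x : Carrier),
      elementary g p (Function.update a i x) = p * (aeval (-MvPolynomial.X i :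
        MvPolynomial (Fin n) ℂ) (x (g i)) * ∏ k ∈ Finset.univ.erase i,
        aeval (-MvPolynomial.X k : MvPolynomial (Fin n) ℂ) (a k (g k))) := by
    intro a i x
    rw [elementary, ← Finset.mul_prod_erase _ _ (Finset.mem_univ i), Function.update_self]
    congr 2
    refine Finset.prod_congr rfl fun k hk => ?_
    rw [Function.update_of_ne (Finset.ne_of_mem_erase hk)]
  refine ⟨fun a i x y => ?_, fun a i c x => ?_, fun a i => ?_⟩
  · simp only [h, Pi.add_apply, map_add]
    ring
  · simp only [h, Pi.smul_apply, map_smul, smul_mul_assoc, mul_smul_comm]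
  · have := h a i (a i)
    rw [Function.update_eq_self] at this
    rw [h, this]
    simp only [delEnd, LinearMap.coe_mk, AddHom.coe_mk, map_mul, aeval_X]
    ring

theorem elementary_gen {n : ℕ} (g h : Fin n → Gen) (p : MvPolynomial (Fin n) ℂ) :
    elementary g p (fun i => gen (h i)) = if g = h then p else 0 := by
  simp only [elementary, aeval_gen]
  split_ifs with hg
  · subst hg
    simp
  · obtain ⟨i, hi⟩ := Function.ne_iff.mp hg
    rw [Finset.prod_eq_zero (Finset.mem_univ i) (if_neg hi), mul_zero]

/-- Finite support is what makes the values polynomials: each point of the support contributes one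
monomial, divided by the factorials built into `taylor`. -/
theorem exists_cochain {n : ℕ} {F : (Fin n → Gen × ℕ) → ℂ} (hF : F ∈ alternating (Gen × ℕ) n)
    (hfin : (Function.support F).Finite) :
    ∃ ζ ∈ cochains extendedSV n, coeffs n ζ = F := by
  let P : PreCochain Carrier n := ∑ x ∈ hfin.toFinset, elementary (fun i => (x i).1)
    (MvPolynomial.monomial (Finsupp.equivFunOnFinite.symm fun i => (x i).2)
      ((∏ i, (((x i).2).factorial : ℂ))⁻¹ * F x))
  have hP : P ∈ sesquilinear n := Submodule.sum_mem _ fun x _ => elementary_mem _ _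
  have hc : coeffs n P = F := by
    funext y
    have hx : ∀ x : Fin n → Gen × ℕ, coeffs n (elementary (fun i => (x i).1)
        (MvPolynomial.monomial (Finsupp.equivFunOnFinite.symm fun i => (x i).2)
          ((∏ i, (((x i).2).factorial : ℂ))⁻¹ * F x))) y = if x = y then F y else 0 := by
      intro x
      rw [coeffs_apply, elementary_gen]
      by_cases hxy : x = y
      · subst hxy
        rw [if_pos rfl, if_pos rfl, MvPolynomial.taylor_monomial, if_pos rfl, mul_inv_cancel_left₀]
        exact Finset.prod_ne_zero_iff.mpr fun i _ => by exact_mod_cast Nat.factorial_ne_zero _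
      · rw [if_neg hxy]
        split_ifs with h1
        · rw [MvPolynomial.taylor_monomial, if_neg]
          exact fun h2 => hxy (funext fun i => Prod.ext (congrFun h1 i) (congrFun h2 i))
        · exact map_zero _
    simp only [P, map_sum, Finset.sum_apply, hx, Finset.sum_ite_eq', Set.Finite.mem_toFinset,
      Function.mem_support, ne_eq, ite_not]
    split_ifs with h
    · exact h.symm
    · rfl
  exact ⟨P, mem_cochains_iff_coeffs.mpr ⟨hP, hc ▸ hF⟩, hc⟩

theorem coeffs_support_finite {n : ℕ} (γ : PreCochain Carrier n) :
    (Function.support (coeffs n γ)).Finite := by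
  refine (Set.finite_iUnion fun h : Fin n → Gen =>
    ((γ fun i => gen (h i)).support.finite_toSet.image fun m i => (h i, m i))).subset ?_
  intro x hx
  rw [Set.mem_iUnion]
  refine ⟨fun i => (x i).1, Finsupp.equivFunOnFinite.symm fun i => (x i).2, ?_, ?_⟩
  · rw [Finset.mem_coe, MvPolynomial.mem_support_iff]
    intro h0
    rw [Function.mem_support, coeffs_apply, MvPolynomial.taylor_apply, h0, mul_zero] at hx
    exact hx rfl
  · funext i
    simp

/-! ### The action of `∂` -/

theorem del_apply {n : ℕ} (γ : PreCochain Carrier n) (a : Fin n → Carrier) :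
    del Carrier n γ a = (∑ i : Fin n, MvPolynomial.X i) * γ a := rfl

theorem del_mem {n : ℕ} {γ : PreCochain Carrier n} (hγ : γ ∈ cochains extendedSV n) :
    del Carrier n γ ∈ cochains extendedSV n := by
  obtain ⟨h, h4⟩ := mem_cochains_iff.mp hγ
  refine mem_cochains_iff.mpr ⟨⟨fun a i x y => ?_, fun a i c x => ?_, fun a i => ?_⟩,
    fun σ a => ?_⟩
  · simp only [del_apply, h.1, mul_add]
  · simp only [del_apply, h.2.1, mul_smul_comm]
  · simp only [del_apply, h.2.2]
    ring
  · simp only [del_apply, map_mul, h4, map_sum, MvPolynomial.rename_X, mul_smul_comm]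
    rw [Equiv.sum_comp σ fun i => (MvPolynomial.X i : MvPolynomial (Fin n) ℂ)]

/-- The substitution in the differential preserves the sum of all variables, since λ_i + λ_j takes
the place of λ_i and λ_j. -/
theorem d_del {n : ℕ} (γ : PreCochain Carrier n) :
    d extendedSV n (del Carrier n γ) = del Carrier (n + 1) (d extendedSV n γ) := by
  cases n with
  | zero => exact (map_zero (del Carrier 1)).symm
  | succ m =>
    funext a
    simp only [d, LinearMap.coe_mk, AddHom.coe_mk, del_apply, Finset.mul_sum]
    refine Finset.sum_congr rfl fun j _ => Finset.sum_congr rfl fun i _ => ?_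
    split_ifs with hij
    · have e : MvPolynomial.aeval (Fin.cons (MvPolynomial.X i.castSucc + MvPolynomial.X j)
          (fun l => MvPolynomial.X (skip i j l)) : Fin (m + 1) → MvPolynomial (Fin (m + 2)) ℂ)
          (∑ i : Fin (m + 1), (MvPolynomial.X i : MvPolynomial (Fin (m + 1)) ℂ)) =
          ∑ i : Fin (m + 2), MvPolynomial.X i := by
        rw [Fin.sum_eq_add_sum_skip hij]
        simp [Fin.sum_univ_succ (n := m)]
      simp only [bracketTerm, Finsupp.sum, del_apply, map_mul, e, Finset.mul_sum]
      refine Finset.sum_congr rfl fun k _ => ?_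
      ring
    · rw [mul_zero]

theorem del_injective (n : ℕ) : Function.Injective (del Carrier (n + 1)) := by
  rw [← LinearMap.ker_eq_bot, LinearMap.ker_eq_bot']
  intro γ h
  funext a
  refine (mul_eq_zero.mp (congrFun h a)).resolve_left fun h0 => ?_
  -- At the point (1, 0, …, 0) the sum of the variables is 1; this needs at least one variable.
  have := congrArg (MvPolynomial.eval (Pi.single 0 1)) h0
  simp at this

theorem coeffs_del {n : ℕ} (γ : PreCochain Carrier n) (x : Fin n → Gen × ℕ) :
    coeffs n (del Carrier n γ) x =
      ∑ i, (x i).2 * coeffs n γ (Function.update x i ((x i).1, (x i).2 - 1)) := by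
  rw [coeffs_apply, del_apply, Finset.sum_mul, map_sum]
  refine Finset.sum_congr rfl fun i _ => ?_
  rw [MvPolynomial.taylor_X_mul, coeffs_apply]
  congr 2
  · congr 1
    funext k
    by_cases hk : k = i
    · subst hk; simp
    · simp [hk]
  · congr 1
    funext k
    by_cases hk : k = i
    · subst hk; simp
    · simp [hk]

/-! ### The operator `τ` -/

theorem tau_mem_sesquilinear {q : ℕ} {γ : PreCochain Carrier (q + 1)}
    (hγ : γ ∈ sesquilinear (q + 1)) : tau γ ∈ sesquilinear q := by
  have hs : ∀ (a : Fin q → Carrier) (i : Fin q) (x : Carrier),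
      (Fin.snoc (Function.update a i x) (gen L) : Fin (q + 1) → Carrier) =
        Function.update (Fin.snoc a (gen L)) i.castSucc x :=
    fun a i x => Fin.snoc_update (α := fun _ => Carrier) _ _ _ _
  let T : MvPolynomial (Fin (q + 1)) ℂ →ₗ[ℂ] MvPolynomial (Fin q) ℂ :=
    (MvPolynomial.aeval (Fin.snoc (fun i => MvPolynomial.X i) 0 :
      Fin (q + 1) → MvPolynomial (Fin q) ℂ)).toLinearMap.comp
        (MvPolynomial.pderiv (Fin.last q)).toLinearMap
  have ht : ∀ a, tau γ a = (-1) ^ q * T (γ (Fin.snoc a (gen L))) := fun a => rfl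
  have hX : ∀ (i : Fin q) p, T (MvPolynomial.X i.castSucc * p) = MvPolynomial.X i * T p := by
    intro i p
    simp only [T, LinearMap.comp_apply, Derivation.coeFn_coe, AlgHom.toLinearMap_apply,
      Derivation.leibniz, MvPolynomial.pderiv_X_of_ne (Fin.castSucc_lt_last i).ne, smul_eq_mul,
      mul_zero, add_zero, map_mul, MvPolynomial.aeval_X, Fin.snoc_castSucc]
  refine ⟨fun a i x y => ?_, fun a i c x => ?_, fun a i => ?_⟩
  · simp only [ht, hs, hγ.1, map_add, mul_add]
  · simp only [ht, hs, hγ.2.1, map_smul, mul_smul_comm]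
  · have := hγ.2.2 (Fin.snoc a (gen L) : Fin (q + 1) → Carrier) i.castSucc
    rw [Fin.snoc_castSucc (α := fun _ => Carrier)] at this
    simp only [ht, hs, this, map_neg, hX]
    ring

/-- The derivative at λ = 0 in a last slot L is evaluation at the symbol (L,1) there. Rotating that
slot to the front costs (-1)^q, which the sign in τ cancels. So τ is the contraction in Cartan's
formula. -/
theorem coeffs_tau {q : ℕ} {γ : PreCochain Carrier (q + 1)}
    (hγ : γ ∈ cochains extendedSV (q + 1)) :
    coeffs q (tau γ) = contract (L, 1) (coeffs (q + 1) γ) := by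
  funext x
  have hs : ∀ p : MvPolynomial (Fin q) ℂ, ∀ κ, MvPolynomial.taylor κ ((-1) ^ q * p) =
      (-1) ^ q * MvPolynomial.taylor κ p := by
    intro p κ
    rcases Nat.even_or_odd q with h' | h' <;> simp [h'.neg_one_pow]
  have h := coeffs_mem hγ (finRotate (q + 1)) (vecCons (L, 1) x)
  have e : vecCons (L, 1) x ∘ finRotate (q + 1) = (Fin.snoc x (L, 1) : Fin (q + 1) → Gen × ℕ) := by
    funext i
    refine Fin.lastCases ?_ (fun k => ?_) i
    · simp
    · simp
  rw [e, sign_finRotate] at h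
  have h1 : coeffs q (tau γ) x = (-1) ^ q * coeffs (q + 1) γ (Fin.snoc x (L, 1)) := by
    rw [coeffs_apply, tau, hs, MvPolynomial.taylor_aeval_snoc_pderiv, coeffs_apply]
    congr 3
    · funext i
      refine Fin.lastCases ?_ (fun k => ?_) i <;> simp
    · funext i
      refine Fin.lastCases ?_ (fun k => ?_) i <;> simp
  rw [h1, h, contract_apply]
  push_cast
  rw [← mul_assoc, ← mul_pow]
  simp

theorem tau_mem {q : ℕ} {γ : PreCochain Carrier (q + 1)} (hγ : γ ∈ cochains extendedSV (q + 1)) :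
    tau γ ∈ cochains extendedSV q := by
  refine mem_cochains_iff_coeffs.mpr
    ⟨tau_mem_sesquilinear (cochains_le_sesquilinear _ hγ), ?_⟩
  rw [coeffs_tau hγ]
  exact contract_mem (coeffs_mem hγ) _

/-! ### Cochains with prescribed values on generators -/

theorem cochainOfValue_eq {n : ℕ} (g : Fin n → Gen) (p : MvPolynomial (Fin n) ℂ) :
    cochainOfValue g p = ((Fintype.card {σ : Equiv.Perm (Fin n) // g ∘ σ = g} : ℂ)⁻¹) •
      ∑ σ : Equiv.Perm (Fin n), (Equiv.Perm.sign σ : ℤ) • permAct σ (elementary g p) := by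
  funext a
  rw [Pi.smul_apply, Finset.sum_apply]
  rfl

theorem cochainOfValue_mem {n : ℕ} (g : Fin n → Gen) (p : MvPolynomial (Fin n) ℂ) :
    cochainOfValue g p ∈ cochains extendedSV n := by
  rw [cochainOfValue_eq]
  refine Submodule.smul_mem _ _ (mem_cochains_iff_permAct.mpr ⟨Submodule.sum_mem _ fun σ _ =>
    zsmul_mem (permAct_mem (elementary_mem g p) σ) _, fun τ => ?_⟩)
  rw [map_sum, Finset.smul_sum]
  refine Fintype.sum_equiv (Equiv.mulLeft τ) _ _ fun σ => ?_
  rw [map_zsmul, permAct_permAct, smul_smul, Equiv.coe_mulLeft, Equiv.Perm.sign_mul]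
  congr 1
  rcases Int.units_eq_one_or (Equiv.Perm.sign τ) with h | h <;> simp [h]

/-- Evaluated on the tuple g, only the permutations stabilizing g contribute to the
skew-symmetrization. By `hp` each contributes p, and the normalization divides by their number. -/
theorem isDeterminedBy_cochainOfValue {n : ℕ} (g : Fin n → Gen) (p : MvPolynomial (Fin n) ℂ)
    (hp : ∀ σ : Equiv.Perm (Fin n), g ∘ σ = g →
      MvPolynomial.rename σ p = (Equiv.Perm.sign σ : ℤ) • p) :
    IsDeterminedBy (cochainOfValue g p) g p := by
  have hval : ∀ (h : Fin n → Gen) (σ : Equiv.Perm (Fin n)),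
      permAct σ (elementary g p) (fun i => gen (h i)) =
        if g = h ∘ σ then MvPolynomial.rename σ p else 0 := by
    intro h σ
    rw [permAct_apply]
    change MvPolynomial.rename σ (elementary g p fun i => gen ((h ∘ σ) i)) = _
    rw [elementary_gen]
    split_ifs
    · rfl
    · exact map_zero _
  refine ⟨cochainOfValue_mem g p, ?_, fun h hh => ?_⟩
  · rw [cochainOfValue_eq, Pi.smul_apply, Finset.sum_apply]
    have : ∀ σ : Equiv.Perm (Fin n), ((Equiv.Perm.sign σ : ℤ) • permAct σ (elementary g p))
        (fun i => gen (g i)) = if g ∘ σ = g then p else 0 := by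
      intro σ
      rw [Pi.smul_apply, hval]
      by_cases hσ : g ∘ σ = g
      · rw [if_pos hσ, if_pos hσ.symm, hp σ hσ, smul_smul]
        rcases Int.units_eq_one_or (Equiv.Perm.sign σ) with h | h <;> simp [h]
      · rw [if_neg hσ, if_neg (Ne.symm hσ), smul_zero]
    rw [Finset.sum_congr rfl fun σ _ => this σ, Finset.sum_ite, Finset.sum_const_zero, add_zero,
      Finset.sum_const, ← Fintype.card_subtype, ← Nat.cast_smul_eq_nsmul ℂ, smul_smul,
      inv_mul_cancel₀, one_smul]
    have : Nonempty {σ : Equiv.Perm (Fin n) // g ∘ σ = g} := ⟨⟨1, rfl⟩⟩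
    exact_mod_cast Fintype.card_ne_zero
  · rw [cochainOfValue_eq, Pi.smul_apply, Finset.sum_apply, Finset.sum_eq_zero, smul_zero]
    intro σ _
    rw [Pi.smul_apply, hval, if_neg, smul_zero]
    intro e
    exact hh σ.symm (by rw [e, Function.comp_assoc, Equiv.self_comp_symm, Function.comp_id])

namespace IsDeterminedBy

variable {n : ℕ} {γ : PreCochain Carrier n} {g : Fin n → Gen} {p : MvPolynomial (Fin n) ℂ}

theorem apply_comp (h : IsDeterminedBy γ g p) (σ : Equiv.Perm (Fin n)) :
    γ (fun i => gen (g (σ i))) = (Equiv.Perm.sign σ : ℤ) • MvPolynomial.rename σ.symm p := by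
  have h1 := congrArg (MvPolynomial.rename σ.symm)
    ((mem_cochains_iff.mp h.1).2 σ fun i => gen (g i))
  rw [MvPolynomial.rename_rename, Equiv.symm_comp_self, MvPolynomial.rename_id_apply, map_zsmul,
    h.2.1] at h1
  exact h1

theorem coeffs_eq_zero (h : IsDeterminedBy γ g p) (x : Fin n → Gen × ℕ)
    (hx : ∀ σ : Equiv.Perm (Fin n), (fun i => (x i).1) ≠ g ∘ σ) : coeffs n γ x = 0 := by
  rw [coeffs_apply, h.2.2 _ hx, map_zero]

/-- The weights on which a cochain is supported. -/
theorem weight_eq (h : IsDeterminedBy γ g p) {k : ℕ} (hp : p.IsHomogeneous k)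
    {x : Fin n → Gen × ℕ} (hx : coeffs n γ x ≠ 0) :
    ∑ i, weight (x i) = k + ∑ i, weight (g i, 0) ∧ ∀ i, ∃ l, (x i).1 = g l := by
  have h1 : ∃ σ : Equiv.Perm (Fin n), (fun i => (x i).1) = g ∘ σ := by
    by_contra hc
    exact hx (h.coeffs_eq_zero x (not_exists.mp hc))
  obtain ⟨σ, hσ⟩ := h1
  refine ⟨?_, fun i => ⟨σ i, congrFun hσ i⟩⟩
  -- A nonzero Taylor coefficient of a homogeneous polynomial of degree k has total order k.
  have hk : ∑ i, (x i).2 = k := by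
    rw [coeffs_apply, show (fun i => gen (x i).1) = fun i => gen (g (σ i)) from
      funext fun i => congrArg gen (congrFun hσ i), h.apply_comp, map_zsmul,
      MvPolynomial.taylor_apply, smul_ne_zero_iff, mul_ne_zero_iff] at hx
    have := (MvPolynomial.IsHomogeneous.rename_isHomogeneous (f := σ.symm) hp) hx.2.2
    rw [← this, Finsupp.weight_apply, Finsupp.sum_fintype _ _ (by simp)]
    simp
  have hw : ∀ y : Gen × ℕ, weight y = y.2 + weight (y.1, 0) := by
    rintro ⟨g, k⟩
    cases g <;> simp [weight]
    ring
  rw [Finset.sum_congr rfl fun i _ => hw (x i), Finset.sum_add_distrib, ← hk, Nat.cast_sum]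
  congr 1
  rw [← Equiv.sum_comp σ fun i => weight (g i, 0)]
  exact Finset.sum_congr rfl fun i _ => by rw [congrFun hσ i]; rfl

end IsDeterminedBy

/-! ### Cochains of weight zero and the primitive of ∂γ -/

/-- The cochains of weight zero involving only the generators `L` and `N`. -/
def IsWeightZero {n : ℕ} (γ : PreCochain Carrier n) : Prop :=
  γ ∈ cochains extendedSV n ∧ ∀ x, coeffs n γ x ≠ 0 →
    ∑ i, weight (x i) = 0 ∧ ∀ i, (x i).1 = L ∨ (x i).1 = N

theorem IsDeterminedBy.isWeightZero {n : ℕ} {γ : PreCochain Carrier n} {g : Fin n → Gen}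
    {p : MvPolynomial (Fin n) ℂ} (h : IsDeterminedBy γ g p) {k : ℕ} (hp : p.IsHomogeneous k)
    (hk : k + ∑ i, weight (g i, 0) = 0) (hg : ∀ i, g i = L ∨ g i = N) : IsWeightZero γ := by
  refine ⟨h.1, fun x hx => ?_⟩
  obtain ⟨h1, h2⟩ := h.weight_eq hp hx
  refine ⟨h1.trans hk, fun i => ?_⟩
  obtain ⟨l, hl⟩ := h2 i
  rw [hl]
  exact hg l

/-- Multiplication by the sum of the variables raises the total index, hence the weight, by one. On
L and N the element (N,0) acts by zero, so (L,1) alone already measures the weight, which is 1. -/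
theorem IsWeightZero.lieDer_coeffs_del {n : ℕ} {γ : PreCochain Carrier n} (h : IsWeightZero γ) :
    ann.lieDer (L, 1) (coeffs n (del Carrier n γ)) = coeffs n (del Carrier n γ) := by
  funext x
  rw [lieDer_L_apply]
  by_cases hx : coeffs n (del Carrier n γ) x = 0
  · rw [hx, mul_zero]
  rw [coeffs_del] at hx
  obtain ⟨i, _, hi⟩ := Finset.exists_ne_zero_of_sum_ne_zero hx
  rw [mul_ne_zero_iff] at hi
  obtain ⟨h1, h2⟩ := h.2 _ hi.2
  have hx : ∀ k, (x k).1 = L ∨ (x k).1 = N := by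
    intro k
    have := h2 k
    by_cases hk : k = i
    · subst hk
      simpa using this
    · simpa [hk] using this
  have hw : ∀ k, -annCoeff (L, 1) (x k) = weight (x k) := by
    intro k
    rcases hy : x k with ⟨g, m⟩
    have := hx k
    rw [hy] at this
    rcases this with rfl | rfl <;> simp [annCoeff, weight]
  have hs : ∑ k, weight (x k) = 1 := by
    have : ∀ k, weight (x k) = weight (Function.update x i ((x i).1, (x i).2 - 1) k) +
        if k = i then 1 else 0 := by
      intro k
      by_cases hk : k = i
      · subst hk
        rcases hy : x k with ⟨g, _ | m⟩
        · exact absurd (by simp [hy]) hi.1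
        · have := hx k
          rw [hy] at this
          rcases this with rfl | rfl <;> simp [weight]
      · simp [hk]
    rw [Finset.sum_congr rfl fun k _ => this k, Finset.sum_add_distrib, h1]
    simp
  rw [← Finset.sum_neg_distrib, Finset.sum_congr rfl fun k _ => hw k, ← Int.cast_sum, hs]
  simp

/-- Cartan's formula for the closed cochain ∂γ reads d ι ∂γ = L ∂γ along (L,1), and the right side
is ∂γ by the preceding lemma. This makes the hat of γ a reduced cocycle and shows that ∂ kills the
class of γ. -/
theorem d_hat {n : ℕ} {γ : PreCochain Carrier (n + 1)} (h : IsWeightZero γ)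
    (hd : d extendedSV (n + 1) γ = 0) :
    d extendedSV n (hat γ) = del Carrier (n + 1) γ := by
  have h1 := del_mem h.1
  have h2 := tau_mem h1
  refine coeffs_injOn (d_mem_sesquilinear (cochains_le_sesquilinear _ h2))
    (cochains_le_sesquilinear _ h1) ?_
  have h3 := ann.contract_ce (coeffs_mem h1) (L, 1)
  rw [← coeffs_d (cochains_le_sesquilinear _ h1), d_del, hd, map_zero, map_zero, map_zero,
    h.lieDer_coeffs_del, ← coeffs_tau h1, ← coeffs_d (cochains_le_sesquilinear _ h2), eq_comm,
    sub_eq_zero] at h3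
  exact h3.symm

/-! ### Tuples of weight zero -/

/-- Representatives of the injective tuples of weight zero up to permutation. -/
def weightZeroTuples : (n : ℕ) → List (Fin n → Gen × ℕ)
  | 0 => [![]]
  | 1 => [![(L, 1)], ![(N, 0)]]
  | 2 => [![(L, 1), (N, 0)], ![(L, 0), (L, 2)], ![(L, 0), (N, 1)]]
  | 3 => [![(L, 1), (L, 0), (L, 2)], ![(L, 0), (L, 2), (N, 0)], ![(L, 1), (L, 0), (N, 1)],
      ![(L, 0), (N, 1), (N, 0)]]
  | 4 => [![(L, 1), (L, 0), (L, 2), (N, 0)], ![(L, 1), (L, 0), (N, 1), (N, 0)]]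
  | _ => []

theorem exists_weightZeroTuples {n : ℕ} (X : Finset (Gen × ℕ)) (hn : X.card = n)
    (h0 : ∑ x ∈ X, weight x = 0) :
    ∃ y ∈ weightZeroTuples n, Function.Injective y ∧ Finset.univ.image y = X := by
  have hX : X ∈ ({(L, 0), (L, 1), (L, 2), (N, 0), (N, 1)} : Finset (Gen × ℕ)).powerset := by
    have hneg : ∀ y : Gen × ℕ, y ≠ (L, 0) → 0 ≤ weight y := by
      rintro ⟨g, k⟩ h
      cases g
      · have : k ≠ 0 := by rintro rfl; exact h rfl
        simp only [weight]
        omega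
      all_goals simp only [weight]; omega
    rw [Finset.mem_powerset]
    intro x hx
    have hle : weight x ≤ 1 := by
      by_contra hc
      rw [← Finset.add_sum_erase _ _ hx] at h0
      have h1 : -1 ≤ ∑ y ∈ X.erase x, weight y := by
        by_cases hL : (L, 0) ∈ X.erase x
        · rw [← Finset.add_sum_erase _ _ hL]
          have : 0 ≤ ∑ y ∈ (X.erase x).erase (L, 0), weight y :=
            Finset.sum_nonneg fun y hy => hneg y (Finset.ne_of_mem_erase hy)
          have : weight (L, 0) = -1 := rfl
          omega
        · have : 0 ≤ ∑ y ∈ X.erase x, weight y :=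
            Finset.sum_nonneg fun y hy => hneg y fun h => hL (h ▸ hy)
          omega
      omega
    obtain ⟨g, k⟩ := x
    cases g <;> simp only [weight] at hle
    · obtain h | h | h : k = 0 ∨ k = 1 ∨ k = 2 := by omega
      all_goals simp [h]
    · obtain h | h : k = 0 ∨ k = 1 := by omega
      all_goals simp [h]
    all_goals omega
  match n with
  | 0 => revert hn h0; revert hX; revert X; decide
  | 1 => revert hn h0; revert hX; revert X; decide
  | 2 => revert hn h0; revert hX; revert X; decide
  | 3 => revert hn h0; revert hX; revert X; decide
  | 4 => revert hn h0; revert hX; revert X; decide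
  | n + 5 =>
    exfalso
    -- The full set of five symbols has weight 1, so it is excluded.
    have : ∀ X ∈ ({(L, 0), (L, 1), (L, 2), (N, 0), (N, 1)} : Finset (Gen × ℕ)).powerset,
      ∑ x ∈ X, weight x = 0 → X.card ≤ 4 := by decide
    have := this X hX h0
    omega

/-- An alternating function vanishes on tuples with a repetition, and on injective tuples it
depends, up to sign, only on the underlying set. -/
theorem eq_zero_of_weightZeroTuples {n : ℕ} {F : (Fin n → Gen × ℕ) → ℂ}
    (hF : F ∈ alternating (Gen × ℕ) n) (hw : ∀ x, F x ≠ 0 → ∑ i, weight (x i) = 0)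
    (h0 : ∀ y ∈ weightZeroTuples n, F y = 0) : F = 0 := by
  funext x
  by_contra hx
  have hinj : Function.Injective x := by
    by_contra hc
    exact hx (alternating_eq_zero hF hc)
  obtain ⟨y, hy, hyi, hxy⟩ := exists_weightZeroTuples (Finset.univ.image x)
    (by rw [Finset.card_image_of_injective _ hinj, Finset.card_univ, Fintype.card_fin])
    (by rw [Finset.sum_image fun a _ b _ h => hinj h]; exact hw x hx)
  have hr : Set.range x = Set.range y := by
    have := congrArg (fun s : Finset (Gen × ℕ) => (s : Set (Gen × ℕ))) hxy
    simpa using this.symm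
  let σ : Equiv.Perm (Fin n) := (Equiv.ofInjective x hinj).trans
    ((Equiv.setCongr hr).trans (Equiv.ofInjective y hyi).symm)
  have hσ : x = y ∘ σ := by
    funext i
    simp [σ, Equiv.apply_ofInjective_symm]
  rw [hσ, hF, h0 y hy] at hx
  simp at hx

/-! ### The distinguished cochains -/

section Distinguished

open MvPolynomial

theorem isDeterminedBy_Phi_zero : IsDeterminedBy (Phi 0) ![L, N, N] (X 1 - X 2) := by
  refine isDeterminedBy_cochainOfValue _ _ fun σ hσ => ?_
  have : σ = 1 ∨ σ = Equiv.swap 1 2 := by revert σ; decide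
  rcases this with rfl | rfl
  · simp
  · simp

theorem isDeterminedBy_Phi_one : IsDeterminedBy (Phi 1) ![L, L, N] ((X 0 - X 1) * X 2) := by
  refine isDeterminedBy_cochainOfValue _ _ fun σ hσ => ?_
  have : σ = 1 ∨ σ = Equiv.swap 0 1 := by revert σ; decide
  rcases this with rfl | rfl
  · simp
  · simp [Equiv.swap_apply_def]
    ring

theorem isDeterminedBy_Phi_two :
    IsDeterminedBy (Phi 2) ![L, L, L] ((X 0 - X 1) * (X 0 - X 2) * (X 1 - X 2)) := by
  refine isDeterminedBy_cochainOfValue _ _ fun σ hσ => ?_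
  have : σ = 1 ∨ σ = Equiv.swap 0 1 ∨ σ = Equiv.swap 0 2 ∨ σ = Equiv.swap 1 2 ∨
      σ = Equiv.swap 0 1 * Equiv.swap 1 2 ∨ σ = Equiv.swap 1 2 * Equiv.swap 0 1 := by
    revert σ; decide
  rcases this with rfl | rfl | rfl | rfl | rfl | rfl
  · simp
  all_goals
    simp [Equiv.swap_apply_def, Equiv.Perm.sign_swap']
    try ring

theorem isDeterminedBy_Psi_zero :
    IsDeterminedBy (Psi 0) ![L, L, N, N] ((X 0 - X 1) * (X 2 - X 3)) := by
  refine isDeterminedBy_cochainOfValue _ _ fun σ hσ => ?_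
  have : σ = 1 ∨ σ = Equiv.swap 0 1 ∨ σ = Equiv.swap 2 3 ∨
      σ = Equiv.swap 0 1 * Equiv.swap 2 3 := by
    revert σ; decide
  rcases this with rfl | rfl | rfl | rfl
  · simp
  all_goals
    simp [Equiv.swap_apply_def, Equiv.Perm.sign_swap']
    try ring

theorem isDeterminedBy_Psi_one :
    IsDeterminedBy (Psi 1) ![L, L, L, N] ((X 0 - X 1) * (X 0 - X 2) * (X 1 - X 2)) := by
  refine isDeterminedBy_cochainOfValue _ _ fun σ hσ => ?_
  have : σ = 1 ∨ σ = Equiv.swap 0 1 ∨ σ = Equiv.swap 0 2 ∨ σ = Equiv.swap 1 2 ∨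
      σ = Equiv.swap 0 1 * Equiv.swap 1 2 ∨ σ = Equiv.swap 1 2 * Equiv.swap 0 1 := by
    revert σ; decide
  rcases this with rfl | rfl | rfl | rfl | rfl | rfl
  · simp
  all_goals
    simp [Equiv.swap_apply_def, Equiv.Perm.sign_swap']
    try ring

/-- The permutation ρ brings an L of the original tuple to the last slot, where τ evaluates. The
condition `hg` says that removing an L from a rearrangement of g' leaves a rearrangement of g, so
the hat vanishes on all other tuples. -/
theorem isDeterminedBy_hat {q : ℕ} {γ : PreCochain Carrier (q + 1)} {g' : Fin (q + 1) → Gen}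
    {p' : MvPolynomial (Fin (q + 1)) ℂ} (h : IsDeterminedBy γ g' p') (g : Fin q → Gen)
    (p : MvPolynomial (Fin q) ℂ) (ρ : Equiv.Perm (Fin (q + 1)))
    (hρ : ∀ i, (Fin.snoc g L : Fin (q + 1) → Gen) i = g' (ρ i))
    (hp : p = (-1) ^ q * aeval (Fin.snoc (fun i => X i) 0 : Fin (q + 1) → MvPolynomial (Fin q) ℂ)
      (pderiv (Fin.last q) ((∑ i, X i) *
        ((Equiv.Perm.sign ρ : ℤ) • rename ρ.symm p'))))
    (hg : ∀ (k : Fin q → Gen) (σ : Equiv.Perm (Fin (q + 1))),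
      (Fin.snoc k L : Fin (q + 1) → Gen) = g' ∘ σ → ∃ τ : Equiv.Perm (Fin q), k = g ∘ τ) :
    IsDeterminedBy (hat γ) g p := by
  have hs : ∀ k : Fin q → Gen, (Fin.snoc (fun i => gen (k i)) (gen L) : Fin (q + 1) → Carrier) =
      fun i => gen ((Fin.snoc k L : Fin (q + 1) → Gen) i) := by
    intro k
    funext i
    refine Fin.lastCases ?_ (fun l => ?_) i <;> simp
  refine ⟨tau_mem (del_mem h.1), ?_, fun k hk => ?_⟩
  · rw [hp, hat, tau, hs, del_apply]
    simp only [hρ]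
    rw [h.apply_comp]
  · rw [hat, tau, hs, del_apply, h.2.2]
    · simp
    · intro σ hσ
      obtain ⟨τ, hτ⟩ := hg k σ hσ
      exact hk τ hτ

/-- The evaluation of the last variable at zero. -/
theorem snoc_X_zero (q : ℕ) (i : Fin (q + 1)) :
    (Fin.snoc (fun i => X i) 0 : Fin (q + 1) → MvPolynomial (Fin q) ℂ) i =
      if h : (i : ℕ) < q then X ⟨i, h⟩ else 0 := by
  rw [Fin.snoc]
  rfl

theorem isDeterminedBy_hat_Phi_zero : IsDeterminedBy (hat (Phi 0)) ![N, N] (X 0 - X 1) := by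
  refine isDeterminedBy_hat isDeterminedBy_Phi_zero _ _
    -- The cycle 0 ↦ 1 ↦ 2 ↦ 0, which matches (N, N, L) with (L, N, N).
    (Equiv.swap 0 1 * Equiv.swap 1 2) (by decide) ?_ (by decide +kernel)
  simp [Fin.sum_univ_succ, Equiv.Perm.sign_swap', Equiv.swap_apply_def, pderiv_X, snoc_X_zero,
    ← Equiv.Perm.inv_def]
  try ring

theorem isDeterminedBy_hat_Phi_one : IsDeterminedBy (hat (Phi 1)) ![L, N] (X 1 ^ 2) := by
  refine isDeterminedBy_hat isDeterminedBy_Phi_one _ _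
    (Equiv.swap 1 2) (by decide) ?_ (by decide +kernel)
  simp [Fin.sum_univ_succ, Equiv.Perm.sign_swap', Equiv.swap_apply_def, pderiv_X, snoc_X_zero,
    ← Equiv.Perm.inv_def]
  try ring

theorem isDeterminedBy_hat_Phi_two :
    IsDeterminedBy (hat (Phi 2)) ![L, L] (-X 0 ^ 3 + X 1 ^ 3) := by
  refine isDeterminedBy_hat isDeterminedBy_Phi_two _ _ 1 (by decide) ?_ (by decide +kernel)
  simp [Fin.sum_univ_succ, pderiv_X, snoc_X_zero, ← Equiv.Perm.inv_def]
  try ring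

theorem isDeterminedBy_hat_Psi_zero :
    IsDeterminedBy (hat (Psi 0)) ![L, N, N] (X 1 ^ 2 - X 2 ^ 2) := by
  refine isDeterminedBy_hat isDeterminedBy_Psi_zero _ _
    (Equiv.swap 1 2 * Equiv.swap 2 3) (by decide) ?_ (by decide +kernel)
  simp [Fin.sum_univ_succ, Equiv.Perm.sign_swap', Equiv.swap_apply_def, pderiv_X, snoc_X_zero,
    ← Equiv.Perm.inv_def]
  try ring

theorem isDeterminedBy_hat_Psi_one : IsDeterminedBy (hat (Psi 1)) ![L, L, N]
    (-X 0 ^ 3 - X 0 ^ 2 * X 2 + X 1 ^ 3 + X 1 ^ 2 * X 2) := by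
  refine isDeterminedBy_hat isDeterminedBy_Psi_one _ _
    (Equiv.swap 2 3) (by decide) ?_ (by decide +kernel)
  simp [Fin.sum_univ_succ, Equiv.Perm.sign_swap', Equiv.swap_apply_def, pderiv_X, snoc_X_zero,
    ← Equiv.Perm.inv_def]
  try ring

end Distinguished

section Distinguished

open MvPolynomial

theorem isWeightZero_Phi (i : Fin 3) : IsWeightZero (Phi i) := by
  have h : ∀ {n : ℕ} (i j : Fin n), (X i - X j : MvPolynomial (Fin n) ℂ).IsHomogeneous 1 :=
    fun i j => (isHomogeneous_X _ _).sub (isHomogeneous_X _ _)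
  fin_cases i
  · refine isDeterminedBy_Phi_zero.isWeightZero (h _ _) ?_ (by decide)
    simp [Fin.sum_univ_succ, weight]
  · refine isDeterminedBy_Phi_one.isWeightZero ((h _ _).mul (isHomogeneous_X _ _)) ?_ (by decide)
    simp [Fin.sum_univ_succ, weight]
  · refine isDeterminedBy_Phi_two.isWeightZero (((h _ _).mul (h _ _)).mul (h _ _)) ?_ (by decide)
    simp [Fin.sum_univ_succ, weight]

theorem isWeightZero_Psi (i : Fin 2) : IsWeightZero (Psi i) := by
  have h : ∀ {n : ℕ} (i j : Fin n), (X i - X j : MvPolynomial (Fin n) ℂ).IsHomogeneous 1 :=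
    fun i j => (isHomogeneous_X _ _).sub (isHomogeneous_X _ _)
  fin_cases i
  · refine isDeterminedBy_Psi_zero.isWeightZero ((h _ _).mul (h _ _)) ?_ (by decide)
    simp [Fin.sum_univ_succ, weight]
  · refine isDeterminedBy_Psi_one.isWeightZero (((h _ _).mul (h _ _)).mul (h _ _)) ?_ (by decide)
    simp [Fin.sum_univ_succ, weight]

theorem isDeterminedBy_L : IsDeterminedBy (cochainOfValue ![L] (X 0)) ![L] (X 0) :=
  isDeterminedBy_cochainOfValue _ _ fun σ _ => by simp [Subsingleton.elim σ 1]

theorem isDeterminedBy_N : IsDeterminedBy (cochainOfValue ![N] 1) ![N] 1 :=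
  isDeterminedBy_cochainOfValue _ _ fun σ _ => by simp [Subsingleton.elim σ 1]

/-- This 2-cochain of weight zero is not closed; its coboundary is the one relation among
weight-zero classes in degree 3. -/
theorem isDeterminedBy_LN : IsDeterminedBy (cochainOfValue ![L, N] (X 0)) ![L, N] (X 0) :=
  isDeterminedBy_cochainOfValue _ _ fun σ hσ => by
    obtain rfl : σ = 1 := by revert σ; decide
    simp

theorem isWeightZero_L : IsWeightZero (cochainOfValue ![L] (X 0)) :=
  isDeterminedBy_L.isWeightZero (isHomogeneous_X _ _) (by simp [weight]) (by decide)

theorem isWeightZero_N : IsWeightZero (cochainOfValue ![N] 1) :=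
  isDeterminedBy_N.isWeightZero (isHomogeneous_one _ _) (by simp [weight]) (by decide)

theorem isWeightZero_LN : IsWeightZero (cochainOfValue ![L, N] (X 0)) :=
  isDeterminedBy_LN.isWeightZero (isHomogeneous_X _ _) (by simp [weight]) (by decide)

end Distinguished

/-- The value of the Taylor coefficients of a distinguished cochain on a tuple with the
indicated generators. -/
theorem IsDeterminedBy.coeffs_of_fst {n : ℕ} {γ : PreCochain Carrier n} {g : Fin n → Gen}
    {p : MvPolynomial (Fin n) ℂ} (h : IsDeterminedBy γ g p) {x : Fin n → Gen × ℕ}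
    (hx : ∀ i, (x i).1 = g i) : coeffs n γ x = MvPolynomial.taylor (fun i => (x i).2) p := by
  rw [coeffs_apply, ← h.2.1]
  simp only [hx]

theorem taylor_one {n : ℕ} (κ : Fin n → ℕ) :
    MvPolynomial.taylor κ 1 = if κ = 0 then 1 else 0 := by
  rw [← MvPolynomial.C_1, MvPolynomial.taylor_C]

theorem taylor_X {n : ℕ} (κ : Fin n → ℕ) (i : Fin n) : MvPolynomial.taylor κ (MvPolynomial.X i) =
    κ i * if Function.update κ i (κ i - 1) = 0 then 1 else 0 := by
  rw [← mul_one (MvPolynomial.X i), MvPolynomial.taylor_X_mul, taylor_one]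

theorem coeffs_LN : coeffs 2 (cochainOfValue ![L, N] (MvPolynomial.X 0)) ![(L, 1), (N, 0)] = 1 := by
  rw [isDeterminedBy_LN.coeffs_of_fst (by decide), taylor_X, if_pos (by decide)]
  simp

/-- Each of the Φ, and likewise each of the Ψ, is nonzero on exactly one representative tuple, so
the basis statements reduce to elementary linear algebra. -/
theorem coeffs_Phi_zero (y : Fin 3 → Gen × ℕ) (hy : y ∈ weightZeroTuples 3) :
    coeffs 3 (Phi 0) y = if y = ![(L, 0), (N, 1), (N, 0)] then 1 else 0 := by
  simp only [weightZeroTuples, List.mem_cons, List.not_mem_nil, or_false] at hy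
  rcases hy with rfl | rfl | rfl | rfl
  · rw [if_neg (by decide), isDeterminedBy_Phi_zero.coeffs_eq_zero _ (by decide)]
  · rw [if_neg (by decide), isDeterminedBy_Phi_zero.coeffs_eq_zero _ (by decide)]
  · rw [if_neg (by decide), isDeterminedBy_Phi_zero.coeffs_eq_zero _ (by decide)]
  · rw [if_pos rfl, isDeterminedBy_Phi_zero.coeffs_of_fst (by decide), map_sub, taylor_X, taylor_X,
      if_pos (by decide), if_neg (by decide)]
    simp

theorem coeffs_Phi_two (y : Fin 3 → Gen × ℕ) (hy : y ∈ weightZeroTuples 3) :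
    coeffs 3 (Phi 2) y = if y = ![(L, 1), (L, 0), (L, 2)] then 2 else 0 := by
  simp only [weightZeroTuples, List.mem_cons, List.not_mem_nil, or_false] at hy
  rcases hy with rfl | rfl | rfl | rfl
  · rw [if_pos rfl, isDeterminedBy_Phi_two.coeffs_of_fst (by decide)]
    simp only [sub_mul, mul_sub, map_sub, mul_assoc, MvPolynomial.taylor_X_mul, taylor_X]
    simp [Function.update_apply, funext_iff, Fin.forall_fin_succ]
  · rw [if_neg (by decide), isDeterminedBy_Phi_two.coeffs_eq_zero _ (by decide)]
  · rw [if_neg (by decide), isDeterminedBy_Phi_two.coeffs_eq_zero _ (by decide)]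
  · rw [if_neg (by decide), isDeterminedBy_Phi_two.coeffs_eq_zero _ (by decide)]

theorem coeffs_Phi_one (y : Fin 3 → Gen × ℕ) (hy : y ∈ weightZeroTuples 3) :
    coeffs 3 (Phi 1) y = if y = ![(L, 1), (L, 0), (N, 1)] then 1 else 0 := by
  simp only [weightZeroTuples, List.mem_cons, List.not_mem_nil, or_false] at hy
  rcases hy with rfl | rfl | rfl | rfl
  · rw [if_neg (by decide), isDeterminedBy_Phi_one.coeffs_eq_zero _ (by decide)]
  · rw [if_neg (by decide), isDeterminedBy_Phi_one.coeffs_of_fst (by decide)]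
    simp only [sub_mul, map_sub, MvPolynomial.taylor_X_mul, taylor_X]
    simp [Function.update_apply, funext_iff, Fin.forall_fin_succ]
  · rw [if_pos rfl, isDeterminedBy_Phi_one.coeffs_of_fst (by decide)]
    simp only [sub_mul, map_sub, MvPolynomial.taylor_X_mul, taylor_X]
    simp [Function.update_apply, funext_iff, Fin.forall_fin_succ]
  · rw [if_neg (by decide), isDeterminedBy_Phi_one.coeffs_eq_zero _ (by decide)]

theorem coeffs_Psi_zero (y : Fin 4 → Gen × ℕ) (hy : y ∈ weightZeroTuples 4) :
    coeffs 4 (Psi 0) y = if y = ![(L, 1), (L, 0), (N, 1), (N, 0)] then 1 else 0 := by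
  simp only [weightZeroTuples, List.mem_cons, List.not_mem_nil, or_false] at hy
  rcases hy with rfl | rfl
  · rw [if_neg (by decide), isDeterminedBy_Psi_zero.coeffs_eq_zero _ (by decide)]
  · rw [if_pos rfl, isDeterminedBy_Psi_zero.coeffs_of_fst (by decide)]
    simp only [sub_mul, mul_sub, map_sub, MvPolynomial.taylor_X_mul, taylor_X]
    simp [Function.update_apply, funext_iff, Fin.forall_fin_succ]

theorem coeffs_Psi_one (y : Fin 4 → Gen × ℕ) (hy : y ∈ weightZeroTuples 4) :
    coeffs 4 (Psi 1) y = if y = ![(L, 1), (L, 0), (L, 2), (N, 0)] then 2 else 0 := by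
  simp only [weightZeroTuples, List.mem_cons, List.not_mem_nil, or_false] at hy
  rcases hy with rfl | rfl
  · rw [if_pos rfl, isDeterminedBy_Psi_one.coeffs_of_fst (by decide)]
    simp only [sub_mul, mul_sub, map_sub, mul_assoc, MvPolynomial.taylor_X_mul, taylor_X]
    simp [Function.update_apply, funext_iff, Fin.forall_fin_succ]
  · rw [if_neg (by decide), isDeterminedBy_Psi_one.coeffs_eq_zero _ (by decide)]

/-! ### The differential in low degrees -/

theorem _root_.MonomialLie.ce_one_apply {S : Type*} (𝔞 : MonomialLie S) (F : (Fin 1 → S) → ℂ)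
    (x y : S) : 𝔞.ce 1 F ![x, y] = -(𝔞.c x y * F ![𝔞.s x y]) := by
  rw [ce_succ_apply]
  have : ∀ f : Fin 0 → S, vecCons (𝔞.s x y) f = ![𝔞.s x y] := fun f => by
    rw [Subsingleton.elim f ![]]
  simp [Fin.sum_univ_succ, this]

theorem _root_.MonomialLie.ce_two_apply {S : Type*} (𝔞 : MonomialLie S) (F : (Fin 2 → S) → ℂ)
    (x y z : S) : 𝔞.ce 2 F ![x, y, z] =
      -(𝔞.c x y * F ![𝔞.s x y, z]) + 𝔞.c x z * F ![𝔞.s x z, y] - 𝔞.c y z * F ![𝔞.s y z, x] := by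
  rw [ce_succ_apply]
  have h1 : (fun l => ![x, y, z] (skip (0 : Fin 2) 1 l)) = ![z] := by
    funext l; fin_cases l; rfl
  have h2 : (fun l => ![x, y, z] (skip (0 : Fin 2) 2 l)) = ![y] := by
    funext l; fin_cases l; rfl
  have h3 : (fun l => ![x, y, z] (skip (1 : Fin 2) 2 l)) = ![x] := by
    funext l; fin_cases l; rfl
  simp [Fin.sum_univ_succ, h1, h2, h3]
  ring

theorem _root_.MonomialLie.ce_three_apply {S : Type*} (𝔞 : MonomialLie S) (F : (Fin 3 → S) → ℂ)
    (x y z w : S) : 𝔞.ce 3 F ![x, y, z, w] =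
      -(𝔞.c x y * F ![𝔞.s x y, z, w]) + 𝔞.c x z * F ![𝔞.s x z, y, w] -
        𝔞.c x w * F ![𝔞.s x w, y, z] - 𝔞.c y z * F ![𝔞.s y z, x, w] +
        𝔞.c y w * F ![𝔞.s y w, x, z] - 𝔞.c z w * F ![𝔞.s z w, x, y] := by
  rw [ce_succ_apply]
  have h1 : (fun l => ![x, y, z, w] (skip (0 : Fin 3) 1 l)) = ![z, w] := by
    funext l; fin_cases l <;> rfl
  have h2 : (fun l => ![x, y, z, w] (skip (0 : Fin 3) 2 l)) = ![y, w] := by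
    funext l; fin_cases l <;> rfl
  have h3 : (fun l => ![x, y, z, w] (skip (0 : Fin 3) 3 l)) = ![y, z] := by
    funext l; fin_cases l <;> rfl
  have h4 : (fun l => ![x, y, z, w] (skip (1 : Fin 3) 2 l)) = ![x, w] := by
    funext l; fin_cases l <;> rfl
  have h5 : (fun l => ![x, y, z, w] (skip (1 : Fin 3) 3 l)) = ![x, z] := by
    funext l; fin_cases l <;> rfl
  have h6 : (fun l => ![x, y, z, w] (skip (2 : Fin 3) 3 l)) = ![x, y] := by
    funext l; fin_cases l <;> rfl
  simp [Fin.sum_univ_succ, h1, h2, h3, h4, h5, h6]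
  ring

section LowDegree

variable {F₁ : (Fin 1 → Gen × ℕ) → ℂ} {F₂ : (Fin 2 → Gen × ℕ) → ℂ} {F₃ : (Fin 3 → Gen × ℕ) → ℂ}

theorem ce_one_LL : ann.ce 1 F₁ ![(L, 0), (L, 2)] = 2 * F₁ ![(L, 1)] := by
  rw [ce_one_apply]
  simp [ann, annCoeff, annMul, genMul, genLoss]

theorem ce_one_LN : ann.ce 1 F₁ ![(L, 0), (N, 1)] = F₁ ![(N, 0)] := by
  rw [ce_one_apply]
  simp [ann, annCoeff, annMul, genMul, genLoss]

theorem ce_one_LN' : ann.ce 1 F₁ ![(L, 1), (N, 0)] = 0 := by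
  rw [ce_one_apply]
  simp [ann, annCoeff]

/-- In weight zero the differential out of degree 2 has rank one: it sees only the coefficient at
((L,1), (N,0)), through [(L,0),(L,2)] = -2 (L,1) and [(L,0),(N,1)] = -(N,0). All other terms cancel
or have a repeated argument. -/
theorem ce_two_apply_of_mem (hF : F₂ ∈ alternating (Gen × ℕ) 2) (y : Fin 3 → Gen × ℕ)
    (hy : y ∈ weightZeroTuples 3) : ann.ce 2 F₂ y =
      (if y = ![(L, 0), (L, 2), (N, 0)] then 2 * F₂ ![(L, 1), (N, 0)] else 0) -
        if y = ![(L, 1), (L, 0), (N, 1)] then F₂ ![(L, 1), (N, 0)] else 0 := by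
  have hz : ∀ a, F₂ ![a, a] = 0 := fun a => alternating_eq_zero hF fun h => by
    simpa using @h 0 1 rfl
  have hs : ∀ a b, F₂ ![a, b] = -F₂ ![b, a] := fun a b => swap_first hF a b ![]
  have hs1 := hs (L, 0) (L, 2)
  have hs2 := hs (N, 1) (L, 0)
  have hs3 := hs (N, 0) (L, 1)
  simp only [weightZeroTuples, List.mem_cons, List.not_mem_nil, or_false] at hy
  rcases hy with rfl | rfl | rfl | rfl <;> rw [ce_two_apply] <;>
    simp [ann, annCoeff, annMul, genMul, genLoss, hz, hs1, hs2, hs3]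
  ring

/-- The brackets with (L,1) contribute the total weight of the other three arguments, which is zero;
each remaining term vanishes or repeats an argument. -/
theorem ce_three_apply_of_mem (hF : F₃ ∈ alternating (Gen × ℕ) 3) (y : Fin 4 → Gen × ℕ)
    (hy : y ∈ weightZeroTuples 4) : ann.ce 3 F₃ y = 0 := by
  have hz : ∀ a b, F₃ ![a, a, b] = 0 := fun a b => alternating_eq_zero hF fun h => by
    simpa using @h 0 1 rfl
  have hz' : ∀ a b, F₃ ![a, b, a] = 0 := fun a b => alternating_eq_zero hF fun h => by
    simpa using @h 0 2 rfl
  have hs : ∀ a b c, F₃ ![a, b, c] = -F₃ ![b, a, c] := fun a b c => swap_first hF a b ![c]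
  have hs1 := hs (L, 0) (L, 2) (N, 0)
  have hs2 := hs (N, 1) (L, 0) (N, 0)
  simp only [weightZeroTuples, List.mem_cons, List.not_mem_nil, or_false] at hy
  rcases hy with rfl | rfl <;> rw [ce_three_apply] <;>
    simp [ann, annCoeff, annMul, genMul, genLoss, hz, hz', hs1, hs2]
  ring

end LowDegree

/-! ### The basic cohomology -/

/-- The coboundaries of the basic complex. -/
def basicCoboundaries : (n : ℕ) → Submodule ℂ (PreCochain Carrier n)
  | 0 => ⊥
  | n + 1 => (cochains extendedSV n).map (d extendedSV n)

theorem d_eq_zero_of_mem_basicCoboundaries {n : ℕ} {γ : PreCochain Carrier n}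
    (h : γ ∈ basicCoboundaries n) : d extendedSV n γ = 0 := by
  cases n with
  | zero => rfl
  | succ n =>
    obtain ⟨ζ, hζ, rfl⟩ := h
    exact d_d hζ

theorem del_mem_basicCoboundaries {n : ℕ} {γ : PreCochain Carrier n}
    (h : γ ∈ basicCoboundaries n) : del Carrier n γ ∈ basicCoboundaries n := by
  cases n with
  | zero =>
    rw [(Submodule.mem_bot ℂ).mp h, map_zero]
    exact Submodule.zero_mem _
  | succ n =>
    obtain ⟨ζ, hζ, rfl⟩ := h
    exact ⟨_, del_mem hζ, d_del ζ⟩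

theorem reducedCoboundaries_eq (n : ℕ) :
    reducedCoboundaries extendedSV n = delCochains extendedSV n ⊔ basicCoboundaries n := by
  cases n with
  | zero => exact sup_bot_eq _ |>.symm
  | succ n => rfl

/-- The family `B` consists of cocycles of the basic complex whose classes form a basis of the
cohomology. -/
structure IsBasicCohomologyBasis (n : ℕ) {ι : Type} [Fintype ι] (B : ι → PreCochain Carrier n) :
    Prop where
  mem : ∀ i, B i ∈ cochains extendedSV n
  d_eq_zero : ∀ i, d extendedSV n (B i) = 0
  span : ∀ γ ∈ cochains extendedSV n, d extendedSV n γ = 0 →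
    ∃ c : ι → ℂ, γ - ∑ i, c i • B i ∈ basicCoboundaries n
  indep : ∀ c : ι → ℂ, ∑ i, c i • B i ∈ basicCoboundaries n → c = 0

/-- The long exact sequence of `0 → ∂C̃ → C̃ → C̃ / ∂C̃ → 0`, on which `∂` acts by zero in
cohomology. -/
theorem isReducedCohomologyBasis_of_basic {n : ℕ} {ι κ : Type} [Fintype ι] [Fintype κ]
    {B : ι → PreCochain Carrier n} {B' : κ → PreCochain Carrier (n + 1)}
    {H : κ → PreCochain Carrier n} (hB : IsBasicCohomologyBasis n B)
    (hB' : IsBasicCohomologyBasis (n + 1) B') (hH : ∀ j, H j ∈ cochains extendedSV n)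
    (hdH : ∀ j, d extendedSV n (H j) = del Carrier (n + 1) (B' j))
    (hdel : ∀ i, del Carrier n (B i) ∈ basicCoboundaries n) :
    IsReducedCohomologyBasis extendedSV n (Sum.elim B H) := by
  have hmem : ∀ i, Sum.elim B H i ∈ cochains extendedSV n := by
    rintro (i | j)
    · exact hB.mem i
    · exact hH j
  have hv : ∀ i, Sum.elim B H i ∈ reducedCocycles extendedSV n := by
    rintro (i | j)
    · refine ⟨hB.mem i, ?_⟩
      rw [SetLike.mem_coe, Submodule.mem_comap, Sum.elim_inl, hB.d_eq_zero]
      exact Submodule.zero_mem _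
    · exact ⟨hH j, B' j, hB'.mem j, (hdH j).symm⟩
  have hspan : ∀ γ ∈ reducedCocycles extendedSV n, ∃ c : ι ⊕ κ → ℂ,
      γ - ∑ i, c i • Sum.elim B H i ∈ reducedCoboundaries extendedSV n := by
    rintro γ ⟨hγ, η, hη, hdγ⟩
    -- From ∂dη = d∂η = d dγ = 0 and injectivity of ∂ in positive degree.
    have hdη : d extendedSV (n + 1) η = 0 := by
      apply del_injective (n + 1)
      rw [← d_del, hdγ, d_d hγ, map_zero]
    obtain ⟨b, ζ, hζ, hb⟩ := hB'.span η hη hdη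
    -- With η = ∑ b_j B'_j + dζ, this correction of γ is a genuine cocycle: the subtracted terms
    -- have differential ∂η. Its last summand ∂ζ vanishes in the quotient.
    have hγ' : γ - ∑ j, b j • H j - del Carrier n ζ ∈ cochains extendedSV n :=
      Submodule.sub_mem _ (Submodule.sub_mem _ hγ
        (Submodule.sum_mem _ fun j _ => Submodule.smul_mem _ _ (hH j))) (del_mem hζ)
    have hd' : d extendedSV n (γ - ∑ j, b j • H j - del Carrier n ζ) = 0 := by
      simp only [map_sub, map_sum, map_smul, hdH, d_del, hb, ← hdγ]
      abel
    obtain ⟨a, ha⟩ := hB.span _ hγ' hd'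
    refine ⟨Sum.elim a b, ?_⟩
    rw [reducedCoboundaries_eq]
    have e : γ - ∑ i, Sum.elim a b i • Sum.elim B H i = del Carrier n ζ +
        (γ - ∑ j, b j • H j - del Carrier n ζ - ∑ i, a i • B i) := by
      simp only [Fintype.sum_sum_type, Sum.elim_inl, Sum.elim_inr]
      abel
    rw [e]
    exact Submodule.add_mem_sup ⟨ζ, hζ, rfl⟩ ha
  have hindep : ∀ c : ι ⊕ κ → ℂ,
      ∑ i, c i • Sum.elim B H i ∈ reducedCoboundaries extendedSV n → ∀ i, c i = 0 := by
    intro c hc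
    rw [reducedCoboundaries_eq] at hc
    obtain ⟨_, ⟨α, hα, rfl⟩, β, hβ, hc⟩ := Submodule.mem_sup.mp hc
    simp only [Fintype.sum_sum_type, Sum.elim_inl, Sum.elim_inr] at hc
    -- Applying d to the relation kills B and the coboundary β, leaving ∂dα = ∑ c_j ∂B'_j. Thus ∑
    -- c_j B'_j is exact, and the c_j vanish.
    have h1 : d extendedSV n α = ∑ j, c (Sum.inr j) • B' j := by
      apply del_injective n
      have := congrArg (d extendedSV n) hc
      simp only [map_add, map_sum, map_smul, hB.d_eq_zero, hdH, d_del,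
        d_eq_zero_of_mem_basicCoboundaries hβ, smul_zero, Finset.sum_const_zero, zero_add,
        add_zero] at this
      simp only [this, map_sum, map_smul]
    have h2 : (fun j => c (Sum.inr j)) = 0 := hB'.indep _ (h1 ▸ ⟨α, hα, rfl⟩)
    have h3 : ∀ j, c (Sum.inr j) = 0 := congrFun h2
    simp only [h3, zero_smul, Finset.sum_const_zero, add_zero] at h1 hc
    obtain ⟨a, ha⟩ := hB.span α hα h1
    -- Now α is closed, so ∂α is exact because ∂ acts by zero on cohomology.
    have h4 : del Carrier n α ∈ basicCoboundaries n := by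
      have := del_mem_basicCoboundaries ha
      rw [map_sub, map_sum] at this
      refine (Submodule.sub_mem_iff_left _ (Submodule.sum_mem _ fun i _ => ?_)).mp this
      rw [map_smul]
      exact Submodule.smul_mem _ _ (hdel i)
    have h5 : (fun i => c (Sum.inl i)) = 0 := hB.indep _ (hc ▸ Submodule.add_mem _ h4 hβ)
    rintro (i | j)
    · exact congrFun h5 i
    · exact h3 j
  refine ⟨hv, ?_⟩
  let w : ι ⊕ κ → ReducedCohomology extendedSV n := fun i => Submodule.Quotient.mk ⟨_, hv i⟩
  have hw : ∀ c : ι ⊕ κ → ℂ, ∑ i, c i • w i =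
      Submodule.Quotient.mk (∑ i, c i • (⟨_, hv i⟩ : reducedCocycles extendedSV n)) := by
    intro c
    exact (map_sum (Submodule.mkQ _) _ _).symm
  have hli : LinearIndependent ℂ w := by
    rw [Fintype.linearIndependent_iff]
    intro c hc
    rw [hw, Submodule.Quotient.mk_eq_zero, Submodule.submoduleOf, Submodule.mem_comap] at hc
    refine hindep c ?_
    simpa using hc
  have hsp : ⊤ ≤ Submodule.span ℂ (Set.range w) := by
    rintro x -
    obtain ⟨⟨γ, hγ⟩, rfl⟩ := Submodule.Quotient.mk_surjective _ x
    obtain ⟨c, hc⟩ := hspan γ hγ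
    have : Submodule.Quotient.mk ⟨γ, hγ⟩ = ∑ i, c i • w i := by
      rw [hw, Submodule.Quotient.eq, Submodule.submoduleOf, Submodule.mem_comap]
      simpa using hc
    rw [this]
    exact Submodule.sum_mem _ fun i _ =>
      Submodule.smul_mem _ _ (Submodule.subset_span ⟨i, rfl⟩)
  exact ⟨Module.Basis.mk hli hsp, fun i => Module.Basis.mk_apply hli hsp i⟩

theorem isReducedCohomologyBasis_reindex {n : ℕ} {ι κ : Type} {v : ι → PreCochain Carrier n}
    (h : IsReducedCohomologyBasis extendedSV n v) (e : κ ≃ ι) :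
    IsReducedCohomologyBasis extendedSV n (v ∘ e) := by
  obtain ⟨hv, b, hb⟩ := h
  exact ⟨fun i => hv (e i), b.reindex e.symm, fun i => by simp [hb]⟩

theorem subsingleton_of_isReducedCohomologyBasis {n : ℕ} {ι : Type} [IsEmpty ι]
    {v : ι → PreCochain Carrier n} (h : IsReducedCohomologyBasis extendedSV n v) :
    Subsingleton (ReducedCohomology extendedSV n) := by
  obtain ⟨_, b, _⟩ := h
  exact b.repr.toEquiv.subsingleton

/-! ### Reduction to weight zero -/

/-- The functions supported on tuples of weight zero. -/
def weightZero (n : ℕ) : Submodule ℂ ((Fin n → Gen × ℕ) → ℂ) :=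
  LinearMap.ker (LinearMap.id - scale (fun w => if w = 0 then 1 else 0))

theorem mem_weightZero {n : ℕ} {F : (Fin n → Gen × ℕ) → ℂ} :
    F ∈ weightZero n ↔ ∀ x, F x ≠ 0 → ∑ i, weight (x i) = 0 := by
  rw [weightZero, LinearMap.mem_ker, funext_iff]
  refine forall_congr' fun x => ?_
  simp only [LinearMap.sub_apply, LinearMap.id_apply, Pi.sub_apply, scale_apply, Pi.zero_apply]
  by_cases h : ∑ i, weight (x i) = 0 <;> simp [h]

theorem ce_mem_weightZero {n : ℕ} {F : (Fin n → Gen × ℕ) → ℂ} (hF : F ∈ weightZero n) :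
    ann.ce n F ∈ weightZero (n + 1) := by
  rw [weightZero, LinearMap.mem_ker, LinearMap.sub_apply, LinearMap.id_apply, sub_eq_zero] at *
  rw [← ce_scale, ← hF]

theorem scale_mem_weightZero {n : ℕ} (F : (Fin n → Gen × ℕ) → ℂ) :
    scale (fun w => if w = 0 then 1 else 0) F ∈ weightZero n := by
  rw [mem_weightZero]
  intro x hx
  by_contra h
  simp [scale_apply, h] at hx

theorem IsWeightZero.coeffs_mem {n : ℕ} {γ : PreCochain Carrier n} (h : IsWeightZero γ) :
    coeffs n γ ∈ weightZero n := mem_weightZero.mpr fun x hx => (h.2 x hx).1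

/-- A cochain of weight zero is determined by its coefficients on the representatives. -/
theorem eq_of_weightZeroTuples {n : ℕ} {γ η : PreCochain Carrier n}
    (hγ : γ ∈ cochains extendedSV n) (hη : η ∈ cochains extendedSV n)
    (hwγ : coeffs n γ ∈ weightZero n) (hwη : coeffs n η ∈ weightZero n)
    (h : ∀ y ∈ weightZeroTuples n, coeffs n γ y = coeffs n η y) : γ = η := by
  rw [← sub_eq_zero]
  have hm := Submodule.sub_mem _ hγ hη
  refine coeffs_injOn (cochains_le_sesquilinear _ hm) (Submodule.zero_mem _) ?_
  rw [map_zero]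
  refine eq_zero_of_weightZeroTuples (ExtendedSV.coeffs_mem hm) (mem_weightZero.mp ?_)
    fun y hy => ?_
  · rw [map_sub]
    exact Submodule.sub_mem _ hwγ hwη
  · rw [map_sub, Pi.sub_apply, h y hy, sub_self]

/-- The primitive supplied by the homotopy is a contraction of a rescaled finitely supported
function. It is therefore finitely supported too, hence comes from an honest cochain with polynomial
values. -/
theorem exists_weightZero {n : ℕ} {γ : PreCochain Carrier (n + 1)}
    (hγ : γ ∈ cochains extendedSV (n + 1)) (hd : d extendedSV (n + 1) γ = 0) :
    ∃ ζ ∈ cochains extendedSV n,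
      coeffs (n + 1) (γ - d extendedSV n ζ) ∈ weightZero (n + 1) := by
  have hF := coeffs_mem hγ
  have hdF : ann.ce (n + 1) (coeffs (n + 1) γ) = 0 := by
    rw [← coeffs_d (cochains_le_sesquilinear _ hγ), hd, map_zero]
  have h := eq_scale_add_ce hF hdF
  have hG := scale_mem (fun w => (w : ℂ)⁻¹) hF
  have hfin : ∀ x, (Function.support
      (contract x (scale (fun w => (w : ℂ)⁻¹) (coeffs (n + 1) γ)))).Finite := by
    intro x
    refine ((coeffs_support_finite γ).preimage
      (f := fun y : Fin n → Gen × ℕ => (vecCons x y : Fin (n + 1) → Gen × ℕ))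
      (fun a _ b _ hab => (Fin.cons_right_injective (α := fun _ => Gen × ℕ) x) hab)).subset ?_
    intro y hy h0
    exact hy (by rw [contract_apply, scale_apply, h0, mul_zero])
  obtain ⟨ζ, hζ, hc⟩ := exists_cochain
    (Submodule.sub_mem _ (contract_mem hG (L, 1))
      (Submodule.smul_mem _ (5 / 2 : ℂ) (contract_mem hG (N, 0))))
    (((hfin (L, 1)).union (hfin (N, 0))).subset fun x hx => by
      by_contra hc
      rw [Set.mem_union, not_or, Function.mem_support, Function.mem_support, not_not, not_not] at hc
      exact hx (by simp [hc.1, hc.2]))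
  refine ⟨ζ, hζ, ?_⟩
  rw [map_sub, coeffs_d (cochains_le_sesquilinear _ hζ), hc]
  nth_rw 1 [h]
  rw [add_sub_cancel_right]
  exact scale_mem_weightZero _

/-- A family of cocycles of weight zero is a basis of the basic cohomology as soon as it is one
in weight zero. -/
theorem isBasicCohomologyBasis_of_weightZero {n : ℕ} {ι : Type} [Fintype ι]
    {B : ι → PreCochain Carrier (n + 1)} (hB : ∀ i, IsWeightZero (B i))
    (hd : ∀ i, d extendedSV (n + 1) (B i) = 0)
    (hspan : ∀ γ ∈ cochains extendedSV (n + 1), d extendedSV (n + 1) γ = 0 →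
      coeffs (n + 1) γ ∈ weightZero (n + 1) →
      ∃ c : ι → ℂ, ∃ ζ ∈ cochains extendedSV n, coeffs n ζ ∈ weightZero n ∧
        ∀ y ∈ weightZeroTuples (n + 1), coeffs (n + 1) γ y =
          ∑ i, c i * coeffs (n + 1) (B i) y + ann.ce n (coeffs n ζ) y)
    (hindep : ∀ c : ι → ℂ, ∀ ζ ∈ cochains extendedSV n,
      (∀ y ∈ weightZeroTuples (n + 1), ∑ i, c i * coeffs (n + 1) (B i) y =
        ann.ce n (coeffs n ζ) y) → c = 0) :
    IsBasicCohomologyBasis (n + 1) B := by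
  have hsum : ∀ (c : ι → ℂ) y, coeffs (n + 1) (∑ i, c i • B i) y =
      ∑ i, c i * coeffs (n + 1) (B i) y := by
    intro c y
    simp
  refine ⟨fun i => (hB i).1, hd, fun γ hγ hdγ => ?_, fun c => ?_⟩
  · obtain ⟨ζ₁, hζ₁, hw⟩ := exists_weightZero hγ hdγ
    have hγ₁ := Submodule.sub_mem _ hγ (d_mem hζ₁)
    obtain ⟨c, ζ, hζ, hwζ, hy⟩ := hspan _ hγ₁ (by rw [map_sub, hdγ, d_d hζ₁, sub_zero]) hw
    refine ⟨c, ζ + ζ₁, Submodule.add_mem _ hζ hζ₁, ?_⟩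
    have hBm : ∑ i, c i • B i ∈ cochains extendedSV (n + 1) :=
      Submodule.sum_mem _ fun i _ => Submodule.smul_mem _ _ (hB i).1
    have := eq_of_weightZeroTuples hγ₁ (Submodule.add_mem _ hBm (d_mem hζ)) hw ?_ ?_
    · rw [map_add, eq_sub_iff_add_eq, add_right_comm, add_comm _ (∑ i, c i • B i), ← this,
        sub_add_cancel]
    · rw [map_add, map_sum, coeffs_d (cochains_le_sesquilinear _ hζ)]
      refine Submodule.add_mem _ (Submodule.sum_mem _ fun i _ => ?_) (ce_mem_weightZero hwζ)
      rw [map_smul]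
      exact Submodule.smul_mem _ _ (hB i).coeffs_mem
    · intro y hy'
      rw [hy y hy', map_add, Pi.add_apply, hsum, coeffs_d (cochains_le_sesquilinear _ hζ)]
  · rintro ⟨ζ, hζ, h⟩
    refine hindep c ζ hζ fun y _ => ?_
    rw [← hsum, ← h, coeffs_d (cochains_le_sesquilinear _ hζ)]

/-- In degrees at least three, cochains of weight zero are cocycles. -/
theorem d_eq_zero_of_weightZero {n : ℕ} {γ : PreCochain Carrier (n + 3)}
    (h : IsWeightZero γ) : d extendedSV (n + 3) γ = 0 := by
  have hs := cochains_le_sesquilinear _ h.1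
  have hd : coeffs (n + 4) (d extendedSV (n + 3) γ) = ann.ce (n + 3) (coeffs (n + 3) γ) :=
    coeffs_d hs
  refine eq_of_weightZeroTuples (d_mem h.1) (Submodule.zero_mem _) ?_ ?_ ?_
  · rw [hd]
    exact ce_mem_weightZero h.coeffs_mem
  · rw [map_zero]
    exact Submodule.zero_mem _
  · intro y hy
    rw [hd, map_zero]
    -- From degree 4 on the target contains no tuples of weight zero, so only degree 3 needs a
    -- computation.
    cases n with
    | zero => exact ce_three_apply_of_mem (ExtendedSV.coeffs_mem h.1) y hy
    | succ n => simp [weightZeroTuples] at hy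

/-! ### Bases of the basic cohomology -/

theorem isBasicCohomologyBasis_zero :
    IsBasicCohomologyBasis 0 (fun _ : Fin 1 => fun _ => (1 : MvPolynomial (Fin 0) ℂ)) where
  mem _ := by
    refine mem_cochains_iff.mpr ⟨⟨fun a i => i.elim0, fun a i => i.elim0, fun a i => i.elim0⟩,
      fun σ a => ?_⟩
    rw [Subsingleton.elim σ 1]
    simp
  d_eq_zero _ := rfl
  span γ _ _ := by
    refine ⟨fun _ => MvPolynomial.coeff 0 (γ ![]), (Submodule.mem_bot ℂ).mpr ?_⟩
    funext a
    rw [Subsingleton.elim a ![], Pi.sub_apply, Finset.sum_apply, Pi.zero_apply, sub_eq_zero]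
    conv_lhs => rw [MvPolynomial.eq_C_of_isEmpty (γ ![])]
    simp [MvPolynomial.smul_eq_C_mul]
  indep c h := by
    have := congrFun ((Submodule.mem_bot ℂ).mp h) ![]
    funext i
    rw [Subsingleton.elim i 0]
    simpa [MvPolynomial.smul_eq_C_mul] using this

/-- The two coefficients of weight zero are recovered from the differential, at ((L,0), (L,2)) and
((L,0), (N,1)), so no nonzero cocycle of weight zero exists. -/
theorem isBasicCohomologyBasis_one :
    IsBasicCohomologyBasis 1 (fun i : Empty => (i.elim : PreCochain Carrier 1)) := by
  refine isBasicCohomologyBasis_of_weightZero (fun i => i.elim) (fun i => i.elim)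
    (fun γ hγ hd _ => ?_) (fun c _ _ _ => Subsingleton.elim _ _)
  have hdF : ann.ce 1 (coeffs 1 γ) = 0 := by
    rw [← coeffs_d (cochains_le_sesquilinear _ hγ), hd, map_zero]
  have h1 := ce_one_LL (F₁ := coeffs 1 γ)
  have h2 := ce_one_LN (F₁ := coeffs 1 γ)
  rw [hdF] at h1 h2
  refine ⟨0, 0, Submodule.zero_mem _, by rw [map_zero]; exact Submodule.zero_mem _, ?_⟩
  intro y hy
  simp only [weightZeroTuples, List.mem_cons, List.not_mem_nil, or_false] at hy
  rcases hy with rfl | rfl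
  · simpa using h1.symm
  · simpa using h2.symm

theorem isBasicCohomologyBasis_two :
    IsBasicCohomologyBasis 2 (fun i : Empty => (i.elim : PreCochain Carrier 2)) := by
  refine isBasicCohomologyBasis_of_weightZero (fun i => i.elim) (fun i => i.elim)
    (fun γ hγ hd _ => ?_) (fun c _ _ _ => Subsingleton.elim _ _)
  have hdF : ann.ce 2 (coeffs 2 γ) = 0 := by
    rw [← coeffs_d (cochains_le_sesquilinear _ hγ), hd, map_zero]
  -- Closedness kills the coefficient at ((L,1), (N,0)). The other two are hit by the coboundaries
  -- of the 1-cochains below.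
  have h1 := ce_two_apply_of_mem (coeffs_mem hγ) ![(L, 1), (L, 0), (N, 1)]
    (by simp [weightZeroTuples])
  rw [hdF, if_neg (by decide), if_pos rfl] at h1
  have hL : ∀ k, coeffs 1 (cochainOfValue ![L] (MvPolynomial.X 0)) ![(L, k)] =
      if k = 1 then 1 else 0 := by
    intro k
    rw [isDeterminedBy_L.coeffs_of_fst (by simp), taylor_X]
    rcases k with _ | _ | k <;> simp [funext_iff]
  have hL' : coeffs 1 (cochainOfValue ![L] (MvPolynomial.X 0)) ![(N, 0)] = 0 :=
    isDeterminedBy_L.coeffs_eq_zero _ (by decide)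
  have hN : coeffs 1 (cochainOfValue ![N] 1) ![(N, 0)] = 1 := by
    rw [isDeterminedBy_N.coeffs_of_fst (by decide), taylor_one, if_pos (by decide)]
  have hN' : ∀ k, coeffs 1 (cochainOfValue ![N] 1) ![(L, k)] = 0 := fun k =>
    isDeterminedBy_N.coeffs_eq_zero _ fun σ h => by simpa using congrFun h 0
  -- The division by 2 compensates the factor 2 in `ce_one_LL`.
  refine ⟨0, (coeffs 2 γ ![(L, 0), (L, 2)] / 2) • cochainOfValue ![L] (MvPolynomial.X 0) +
    coeffs 2 γ ![(L, 0), (N, 1)] • cochainOfValue ![N] 1, ?_, ?_, ?_⟩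
  · exact Submodule.add_mem _ (Submodule.smul_mem _ _ isWeightZero_L.1)
      (Submodule.smul_mem _ _ isWeightZero_N.1)
  · rw [map_add, map_smul, map_smul]
    exact Submodule.add_mem _ (Submodule.smul_mem _ _ isWeightZero_L.coeffs_mem)
      (Submodule.smul_mem _ _ isWeightZero_N.coeffs_mem)
  · intro y hy
    simp only [weightZeroTuples, List.mem_cons, List.not_mem_nil, or_false] at hy
    rcases hy with rfl | rfl | rfl
    · rw [ce_one_LN']
      simpa using h1.symm
    · rw [ce_one_LL]
      simp [hL, hN', mul_div_cancel₀]
    · rw [ce_one_LN]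
      simp [hL', hN]

theorem isBasicCohomologyBasis_three : IsBasicCohomologyBasis 3 Phi := by
  refine isBasicCohomologyBasis_of_weightZero isWeightZero_Phi
    (fun i => d_eq_zero_of_weightZero (isWeightZero_Phi i)) (fun γ hγ _ _ => ?_)
    (fun c ζ hζ h => ?_)
  -- The coboundary of the 2-cochain on (L, N) is 2 at ((L,0),(L,2),(N,0)) and -1 at
  -- ((L,1),(L,0),(N,1)). The first value fixes its multiple, the second the correction to the
  -- coefficient of Φ². The last entry is halved because Φ³ takes the value 2.
  · refine ⟨![coeffs 3 γ ![(L, 0), (N, 1), (N, 0)],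
      coeffs 3 γ ![(L, 1), (L, 0), (N, 1)] + coeffs 3 γ ![(L, 0), (L, 2), (N, 0)] / 2,
      coeffs 3 γ ![(L, 1), (L, 0), (L, 2)] / 2],
      (coeffs 3 γ ![(L, 0), (L, 2), (N, 0)] / 2) • cochainOfValue ![L, N] (MvPolynomial.X 0),
      Submodule.smul_mem _ _ isWeightZero_LN.1, ?_, fun y hy => ?_⟩
    · rw [map_smul]
      exact Submodule.smul_mem _ _ isWeightZero_LN.coeffs_mem
    · rw [map_smul, map_smul, Pi.smul_apply,
        ce_two_apply_of_mem (coeffs_mem isWeightZero_LN.1) y hy, coeffs_LN, Fin.sum_univ_three,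
        coeffs_Phi_zero y hy, coeffs_Phi_one y hy, coeffs_Phi_two y hy]
      simp only [weightZeroTuples, List.mem_cons, List.not_mem_nil, or_false] at hy
      rcases hy with rfl | rfl | rfl | rfl <;> simp
  · have h' : ∀ y ∈ weightZeroTuples 3, _ := fun y hy => by
      have := h y hy
      rw [ce_two_apply_of_mem (coeffs_mem hζ) y hy, Fin.sum_univ_three, coeffs_Phi_zero y hy,
        coeffs_Phi_one y hy, coeffs_Phi_two y hy] at this
      exact this
    have h1 := h' ![(L, 1), (L, 0), (L, 2)] (by simp [weightZeroTuples])
    have h2 := h' ![(L, 0), (L, 2), (N, 0)] (by simp [weightZeroTuples])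
    have h3 := h' ![(L, 1), (L, 0), (N, 1)] (by simp [weightZeroTuples])
    have h4 := h' ![(L, 0), (N, 1), (N, 0)] (by simp [weightZeroTuples])
    simp at h1 h2 h3 h4
    funext i
    fin_cases i
    · simpa using h4
    · simpa [h2] using h3
    · simpa using h1

theorem isBasicCohomologyBasis_four : IsBasicCohomologyBasis 4 Psi := by
  refine isBasicCohomologyBasis_of_weightZero isWeightZero_Psi
    (fun i => d_eq_zero_of_weightZero (isWeightZero_Psi i)) (fun γ hγ _ _ => ?_)
    (fun c ζ hζ h => ?_)
  -- No coboundary is needed, since the differential into degree 4 vanishes in weight zero. The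
  -- halving reflects the value 2 of Ψ².
  · refine ⟨![coeffs 4 γ ![(L, 1), (L, 0), (N, 1), (N, 0)],
      coeffs 4 γ ![(L, 1), (L, 0), (L, 2), (N, 0)] / 2], 0, Submodule.zero_mem _, ?_,
      fun y hy => ?_⟩
    · rw [map_zero]
      exact Submodule.zero_mem _
    · rw [map_zero, map_zero, Fin.sum_univ_two, coeffs_Psi_zero y hy, coeffs_Psi_one y hy]
      simp only [weightZeroTuples, List.mem_cons, List.not_mem_nil, or_false] at hy
      rcases hy with rfl | rfl <;> simp
  · have h' : ∀ y ∈ weightZeroTuples 4, _ := fun y hy => by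
      have := h y hy
      rw [ce_three_apply_of_mem (coeffs_mem hζ) y hy, Fin.sum_univ_two, coeffs_Psi_zero y hy,
        coeffs_Psi_one y hy] at this
      exact this
    have h1 := h' ![(L, 1), (L, 0), (L, 2), (N, 0)] (by simp [weightZeroTuples])
    have h2 := h' ![(L, 1), (L, 0), (N, 1), (N, 0)] (by simp [weightZeroTuples])
    simp at h1 h2
    funext i
    fin_cases i
    · simpa using h2
    · simpa using h1

theorem isBasicCohomologyBasis_add_five (n : ℕ) :
    IsBasicCohomologyBasis (n + 5) (fun i : Empty => (i.elim : PreCochain Carrier (n + 5))) := by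
  refine isBasicCohomologyBasis_of_weightZero (fun i => i.elim) (fun i => i.elim)
    (fun γ _ _ _ => ?_) (fun c _ _ _ => Subsingleton.elim _ _)
  refine ⟨0, 0, Submodule.zero_mem _, by rw [map_zero]; exact Submodule.zero_mem _, ?_⟩
  intro y hy
  simp [weightZeroTuples] at hy

/-! ### Assembly of the reduced cohomology -/

theorem hat_Phi_mem (i : Fin 3) : hat (Phi i) ∈ cochains extendedSV 2 :=
  tau_mem (del_mem (isWeightZero_Phi i).1)

theorem hat_Psi_mem (i : Fin 2) : hat (Psi i) ∈ cochains extendedSV 3 :=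
  tau_mem (del_mem (isWeightZero_Psi i).1)

theorem d_hat_Phi (i : Fin 3) : d extendedSV 2 (hat (Phi i)) = del Carrier 3 (Phi i) :=
  d_hat (isWeightZero_Phi i) (isBasicCohomologyBasis_three.d_eq_zero i)

theorem d_hat_Psi (i : Fin 2) : d extendedSV 3 (hat (Psi i)) = del Carrier 4 (Psi i) :=
  d_hat (isWeightZero_Psi i) (isBasicCohomologyBasis_four.d_eq_zero i)

theorem reducedCohomologyBasis_zero :
    IsReducedCohomologyBasis extendedSV 0 (fun _ : Fin 1 => fun _ => 1) := by
  have h := isReducedCohomologyBasis_of_basic (H := fun i : Empty => i.elim)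
    isBasicCohomologyBasis_zero isBasicCohomologyBasis_one (fun i => i.elim) (fun i => i.elim)
    (fun i => by
      refine (Submodule.mem_bot ℂ).mpr ?_
      funext a
      simp [del_apply])
  exact isReducedCohomologyBasis_reindex h (Equiv.sumEmpty (Fin 1) Empty).symm

theorem reducedCohomologyBasis_two :
    IsReducedCohomologyBasis extendedSV 2 (fun i : Fin 3 => hat (Phi i)) := by
  have h := isReducedCohomologyBasis_of_basic isBasicCohomologyBasis_two
    isBasicCohomologyBasis_three hat_Phi_mem d_hat_Phi (fun i => i.elim)
  exact isReducedCohomologyBasis_reindex h (Equiv.emptySum Empty (Fin 3)).symm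

/-- The only degree where both kinds of classes meet; that ∂Φ is exact is witnessed by the hats of
the Φ from degree 2. -/
theorem reducedCohomologyBasis_three :
    IsReducedCohomologyBasis extendedSV 3 (Sum.elim Phi (fun j : Fin 2 => hat (Psi j))) :=
  isReducedCohomologyBasis_of_basic isBasicCohomologyBasis_three isBasicCohomologyBasis_four
    hat_Psi_mem d_hat_Psi fun i => ⟨_, hat_Phi_mem i, d_hat_Phi i⟩

theorem reducedCohomologyBasis_four : IsReducedCohomologyBasis extendedSV 4 Psi := by
  have h := isReducedCohomologyBasis_of_basic (H := fun i : Empty => i.elim)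
    isBasicCohomologyBasis_four (isBasicCohomologyBasis_add_five 0) (fun i => i.elim)
    (fun i => i.elim) (fun i => ⟨_, hat_Psi_mem i, d_hat_Psi i⟩)
  exact isReducedCohomologyBasis_reindex h (Equiv.sumEmpty (Fin 2) Empty).symm

theorem subsingleton_reducedCohomology (q : ℕ) (h0 : q ≠ 0) (h2 : q ≠ 2) (h3 : q ≠ 3)
    (h4 : q ≠ 4) : Subsingleton (ReducedCohomology extendedSV q) := by
  match q with
  | 1 =>
    exact subsingleton_of_isReducedCohomologyBasis (isReducedCohomologyBasis_of_basic
      (H := fun i : Empty => i.elim) isBasicCohomologyBasis_one isBasicCohomologyBasis_two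
      (fun i => i.elim) (fun i => i.elim) (fun i => i.elim))
  | n + 5 =>
    exact subsingleton_of_isReducedCohomologyBasis (isReducedCohomologyBasis_of_basic
      (H := fun i : Empty => i.elim) (isBasicCohomologyBasis_add_five n)
      (isBasicCohomologyBasis_add_five (n + 1)) (fun i => i.elim) (fun i => i.elim)
      (fun i => i.elim))

end ExtendedSV

end

theorem mainTheorem3 :
    -- degree 0
    LieConformal.IsReducedCohomologyBasis ExtendedSV.extendedSV 0 (fun _ : Fin 1 => fun _ => 1) ∧
    -- degree 2
    LieConformal.IsReducedCohomologyBasis ExtendedSV.extendedSV 2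
      (fun i : Fin 3 => ExtendedSV.hat (ExtendedSV.Phi i)) ∧
    -- degree 3
    LieConformal.IsReducedCohomologyBasis ExtendedSV.extendedSV 3
      (Sum.elim ExtendedSV.Phi (fun j : Fin 2 => ExtendedSV.hat (ExtendedSV.Psi j))) ∧
    -- degree 4
    LieConformal.IsReducedCohomologyBasis ExtendedSV.extendedSV 4 ExtendedSV.Psi ∧
    -- all other degrees
    (∀ q : ℕ, q ≠ 0 → q ≠ 2 → q ≠ 3 → q ≠ 4 →
      Subsingleton (LieConformal.ReducedCohomology ExtendedSV.extendedSV q)) ∧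
    -- the cochains `Φ` and `Ψ`
    ExtendedSV.IsDeterminedBy (ExtendedSV.Phi 0) ![.L, .N, .N]
      (MvPolynomial.X 1 - MvPolynomial.X 2) ∧
    ExtendedSV.IsDeterminedBy (ExtendedSV.Phi 1) ![.L, .L, .N]
      ((MvPolynomial.X 0 - MvPolynomial.X 1) * MvPolynomial.X 2) ∧
    ExtendedSV.IsDeterminedBy (ExtendedSV.Phi 2) ![.L, .L, .L]
      ((MvPolynomial.X 0 - MvPolynomial.X 1) * (MvPolynomial.X 0 - MvPolynomial.X 2) *
        (MvPolynomial.X 1 - MvPolynomial.X 2)) ∧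
    ExtendedSV.IsDeterminedBy (ExtendedSV.Psi 0) ![.L, .L, .N, .N]
      ((MvPolynomial.X 0 - MvPolynomial.X 1) * (MvPolynomial.X 2 - MvPolynomial.X 3)) ∧
    ExtendedSV.IsDeterminedBy (ExtendedSV.Psi 1) ![.L, .L, .L, .N]
      ((MvPolynomial.X 0 - MvPolynomial.X 1) * (MvPolynomial.X 0 - MvPolynomial.X 2) *
        (MvPolynomial.X 1 - MvPolynomial.X 2)) ∧
    -- the explicit formulas for `τ(∂Φ)` and `τ(∂Ψ)`
    ExtendedSV.IsDeterminedBy (ExtendedSV.hat (ExtendedSV.Phi 0)) ![.N, .N]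
      (MvPolynomial.X 0 - MvPolynomial.X 1) ∧
    ExtendedSV.IsDeterminedBy (ExtendedSV.hat (ExtendedSV.Phi 1)) ![.L, .N]
      (MvPolynomial.X 1 ^ 2) ∧
    ExtendedSV.IsDeterminedBy (ExtendedSV.hat (ExtendedSV.Phi 2)) ![.L, .L]
      (-MvPolynomial.X 0 ^ 3 + MvPolynomial.X 1 ^ 3) ∧
    ExtendedSV.IsDeterminedBy (ExtendedSV.hat (ExtendedSV.Psi 0)) ![.L, .N, .N]
      (MvPolynomial.X 1 ^ 2 - MvPolynomial.X 2 ^ 2) ∧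
    ExtendedSV.IsDeterminedBy (ExtendedSV.hat (ExtendedSV.Psi 1)) ![.L, .L, .N]
      (-MvPolynomial.X 0 ^ 3 - MvPolynomial.X 0 ^ 2 * MvPolynomial.X 2 +
        MvPolynomial.X 1 ^ 3 + MvPolynomial.X 1 ^ 2 * MvPolynomial.X 2) := by
  exact ⟨ExtendedSV.reducedCohomologyBasis_zero, ExtendedSV.reducedCohomologyBasis_two,
    ExtendedSV.reducedCohomologyBasis_three, ExtendedSV.reducedCohomologyBasis_four,
    ExtendedSV.subsingleton_reducedCohomology, ExtendedSV.isDeterminedBy_Phi_zero,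
    ExtendedSV.isDeterminedBy_Phi_one, ExtendedSV.isDeterminedBy_Phi_two,
    ExtendedSV.isDeterminedBy_Psi_zero, ExtendedSV.isDeterminedBy_Psi_one,
    ExtendedSV.isDeterminedBy_hat_Phi_zero, ExtendedSV.isDeterminedBy_hat_Phi_one,
    ExtendedSV.isDeterminedBy_hat_Phi_two, ExtendedSV.isDeterminedBy_hat_Psi_zero,
    ExtendedSV.isDeterminedBy_hat_Psi_one⟩
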